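/- Let $G$ be a (discrete) group and let $\mathcal F$ be a family of subgroups of $G$, i.e. a non-empty set of subgroups closed under conjugation and under passing to subgroups. Let $\mathcal O_{\mathcal F}G$ be the orbit category, whose objects are the coset spaces $G/H$ with $H\in\mathcal F$ and whose morphisms are the $G$-equivariant maps. An $\mathcal O_{\mathcal F}G$-module is a contravariant functor $\mathcal O_{\mathcal F}G\to\mathbb Z\text{-Mod}$; for $P\in\mathcal F$ let $\mathcal A_P=\mathbb Z[\hom_G(-,G/P)]$, and let $\underline{\mathbb Z}$ be the constant module. For a module $M$ put $H^n_{\mathcal F}(G;M)=\mathrm{Ext}^n(\underline{\mathbb Z},M)$, where $\mathrm{Ext}$ is taken in the category of $\mathcal O_{\mathcal F}G$-modules, and $$\mathrm{cd}_{\mathcal F}G=\sup\{n\in\mathbb N\mid H^n_{\mathcal F}(G;M)\neq 0\text{ for some }\mathcal O_{\mathcal F}G\text{-module }M\}.$$ A $G$-CW-complex is a CW-complex $X$ with an action of $G$ by homeomorphisms that permutes the cells of each dimension and such that every group element that maps a cell to itself fixes that cell pointwise. Its Bredon cohomology $H^n_{\mathcal F}(X;M)$ is the cohomology of the cochain complex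 $\mathrm{Hom}_{\mathcal F}(C^{\mathcal F}_*(X),M)$ of natural transformations, where $C^{\mathcal F}_n(X)(G/H)=C_n(X^H)$ is the module of cellular $n$-chains of the fixed point set $X^H$. A $G$-CW-complex $X$ is a model for $E_{\mathcal F}G$ if all its cell stabilisers lie in $\mathcal F$ and $X^H$ is contractible for every $H\in\mathcal F$; it is cocompact if $X/G$ is compact. **Theorem.** Suppose that $X$ is a cocompact model for $E_{\mathcal F}G$. Then $\mathrm{cd}_{\mathcal F}G$ is finite and $$\mathrm{cd}_{\mathcal F}G=\max\{k\in\mathbb N\mid H^k_{\mathcal F}(X;\mathcal A_H)\neq 0\text{ for some cell stabiliser }H\text{ of }X\}.$$ Moreover, if $n=\mathrm{cd}_{\mathcal F}G$ and $L\in\mathcal F$ satisfies $H^n_{\mathcal F}(G;\mathcal A_L)\neq 0$, then there is a cell stabiliser $H\leqslant L$ of $X$ such that $H^n_{\mathcal F}(G;\mathcal A_H)\neq 0$. -/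

import Mathlib

open CategoryTheory CategoryTheory.Limits
open scoped Pointwise

universe u v

/-! ### Families of subgroups and the orbit category -/

/-- A family of subgroups: a nonempty collection of subgroups closed under conjugation and under
passing to subgroups. -/
structure IsSubgroupFamily {G : Type u} [Group G] (F : Set (Subgroup G)) : Prop where
  nonempty : F.Nonempty
  conj_mem : ∀ H ∈ F, ∀ g : G, H.map (MulAut.conj g).toMonoidHom ∈ F
  mem_of_le : ∀ H ∈ F, ∀ K : Subgroup G, K ≤ H → K ∈ F

/-- Objects of the orbit category `O_F G`: the coset spaces `G ⧸ H` with `H ∈ F`, recorded by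
the subgroup `H`. -/
structure OrbitCat {G : Type u} [Group G] (F : Set (Subgroup G)) : Type u where
  subgroup : Subgroup G
  mem : subgroup ∈ F

/-- Morphisms of the orbit category are all `G`-equivariant maps `G ⧸ H → G ⧸ K`. -/
instance OrbitCat.category {G : Type u} [Group G] (F : Set (Subgroup G)) :
    Category.{u} (OrbitCat F) where
  Hom A B := (G ⧸ A.subgroup) →[G] (G ⧸ B.subgroup)
  id A := MulActionHom.id G
  comp f g := MulActionHom.comp g f

/-- `O_F G`-modules: contravariant functors from the orbit category to `ℤ`-modules. -/
abbrev OrbitModule {G : Type u} [Group G] (F : Set (Subgroup G)) :=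
  (OrbitCat F)ᵒᵖ ⥤ ModuleCat.{u} ℤ

/-- The module `A_P = ℤ[hom_G(-, G ⧸ P)]`. -/
noncomputable def orbitFree {G : Type u} [Group G] {F : Set (Subgroup G)} (P : OrbitCat F) :
    OrbitModule F where
  obj A := ModuleCat.of ℤ ((A.unop ⟶ P) →₀ ℤ)
  map f := ModuleCat.ofHom (Finsupp.lmapDomain ℤ ℤ fun q => f.unop ≫ q)
  map_id A := by
    ext : 1
    exact (congrArg (Finsupp.lmapDomain ℤ ℤ) (funext fun q => Category.id_comp q)).trans
      (Finsupp.lmapDomain_id ℤ ℤ)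
  map_comp f g := by
    ext : 1
    exact (congrArg (Finsupp.lmapDomain ℤ ℤ)
      (funext fun q => Category.assoc g.unop f.unop q)).trans
      (Finsupp.lmapDomain_comp ℤ ℤ (fun q => f.unop ≫ q) fun q => g.unop ≫ q)

/-- The constant module `ℤ` (all morphisms act as the identity). -/
noncomputable def orbitConst {G : Type u} [Group G] (F : Set (Subgroup G)) : OrbitModule F :=
  (Functor.const _).obj (ModuleCat.of ℤ (ULift.{u} ℤ))

/-! ### Bredon cohomology of a group -/

/-- `H^n_F(G; M) = Ext^n(ℤ, M)`, computed in the abelian category of `O_F G`-modules. -/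
noncomputable def GroupBredonCohomology {G : Type u} [Group G] (F : Set (Subgroup G))
    (n : ℕ) (M : OrbitModule F) : Type (u + 1) :=
  letI : HasExt.{u + 1} (OrbitModule F) := HasExt.standard _
  Abelian.Ext.{u + 1} (orbitConst F) M n

noncomputable instance {G : Type u} [Group G] (F : Set (Subgroup G))
    (n : ℕ) (M : OrbitModule F) : AddCommGroup (GroupBredonCohomology F n M) :=
  letI : HasExt.{u + 1} (OrbitModule F) := HasExt.standard _
  inferInstanceAs (AddCommGroup (Abelian.Ext.{u + 1} (orbitConst F) M n))

/-- `cd_F G`: the supremum in `ℕ ∪ {∞}` of all `n` such that `H^n_F(G; M) ≠ 0` for some `M`. -/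
noncomputable def bredonCohomologicalDimension {G : Type u} [Group G] (F : Set (Subgroup G)) :
    ℕ∞ :=
  ⨆ (n : ℕ) (_ : ∃ M : OrbitModule F, Nontrivial (GroupBredonCohomology F n M)), (n : ℕ∞)

/-! ### `G`-CW-complexes and classifying spaces -/

/-- `X`, a CW-complex on which the group `G` acts by homeomorphisms, is a `G`-CW-complex: the
action permutes the (open) cells of each dimension, and it is admissible, that is, an element that
maps a cell to itself fixes this cell pointwise. -/
structure IsGCWComplex (G : Type u) [Group G] (X : Type v) [TopologicalSpace X] [T2Space X]
    [Topology.CWComplex (Set.univ : Set X)] [MulAction G X] [ContinuousConstSMul G X] :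
    Prop where
  smul_openCell : ∀ (g : G) (n : ℕ) (e : Topology.RelCWComplex.cell (Set.univ : Set X) n),
    ∃ e' : Topology.RelCWComplex.cell (Set.univ : Set X) n,
      g • Topology.RelCWComplex.openCell n e = Topology.RelCWComplex.openCell n e'
  admissible : ∀ (g : G) (n : ℕ) (e : Topology.RelCWComplex.cell (Set.univ : Set X) n),
    g • Topology.RelCWComplex.openCell n e = Topology.RelCWComplex.openCell n e →
      ∀ x ∈ Topology.RelCWComplex.openCell n e, g • x = x

/-- The subgroup `H` is the (setwise) stabiliser of some cell of `X`. -/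
def IsCellStabilizer {G : Type u} [Group G] (X : Type v) [TopologicalSpace X] [T2Space X]
    [Topology.CWComplex (Set.univ : Set X)] [MulAction G X] (H : Subgroup G) : Prop :=
  ∃ (n : ℕ) (e : Topology.RelCWComplex.cell (Set.univ : Set X) n),
    H = MulAction.stabilizer G (Topology.RelCWComplex.openCell n e)

/-- `X` is a model for the classifying space `E_F G`: a `G`-CW-complex all of whose cell
stabilisers belong to `F` and such that `X^H` is contractible for all `H ∈ F`. -/
structure IsClassifyingSpace {G : Type u} [Group G] (F : Set (Subgroup G))
    (X : Type v) [TopologicalSpace X] [T2Space X]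
    [Topology.CWComplex (Set.univ : Set X)] [MulAction G X] [ContinuousConstSMul G X] :
    Prop where
  isGCWComplex : IsGCWComplex G X
  stabilizer_mem : ∀ H : Subgroup G, IsCellStabilizer X H → H ∈ F
  contractible : ∀ H ∈ F, ContractibleSpace (MulAction.fixedPoints H X)

/-- The action is cocompact: `X / G` is compact. -/
def IsCocompactAction (G : Type u) [Group G] (X : Type v) [TopologicalSpace X]
    [MulAction G X] : Prop :=
  CompactSpace (MulAction.orbitRel.Quotient G X)

/-! ### Skeleta of the fixed point sets, as functors on the orbit category -/

/-- The part of the fixed point set `X^H` in the union `X_{<p}` of the cells of dimension `< p`.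
For an admissible action this is the `(p - 1)`-skeleton of `X^H`. -/
def fixedSkeleton {G : Type u} [Group G] (X : Type v) [TopologicalSpace X] [T2Space X]
    [Topology.CWComplex (Set.univ : Set X)] [MulAction G X]
    (H : Subgroup G) (p : ℕ) : Set X :=
  MulAction.fixedPoints H X ∩ (Topology.RelCWComplex.skeletonLT (Set.univ : Set X) (p : ℕ∞) : Set X)

lemma fixedSkeleton_mono {G : Type u} [Group G] {X : Type v} [TopologicalSpace X] [T2Space X]
    [Topology.CWComplex (Set.univ : Set X)] [MulAction G X]
    (H : Subgroup G) (p : ℕ) :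
    fixedSkeleton X H p ⊆ fixedSkeleton X H (p + 1) :=
  Set.inter_subset_inter_right _
    (Topology.RelCWComplex.skeletonLT_mono (by exact_mod_cast Nat.le_succ p))

lemma IsGCWComplex.smul_mem_skeletonLT {G : Type u} [Group G] {X : Type v} [TopologicalSpace X] [T2Space X]
    [Topology.CWComplex (Set.univ : Set X)] [MulAction G X]
    [ContinuousConstSMul G X] (hX : IsGCWComplex G X) (g : G) (p : ℕ) (x : X)
    (hx : x ∈ (Topology.RelCWComplex.skeletonLT (Set.univ : Set X) (p : ℕ∞) : Set X)) :
    g • x ∈ (Topology.RelCWComplex.skeletonLT (Set.univ : Set X) (p : ℕ∞) : Set X) := by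
  rw [← Topology.CWComplex.iUnion_openCell_eq_skeletonLT] at hx ⊢
  simp only [Set.mem_iUnion] at hx ⊢
  obtain ⟨n, hn, e, he⟩ := hx
  obtain ⟨e', he'⟩ := hX.smul_openCell g n e
  exact ⟨n, hn, e', he' ▸ Set.smul_mem_smul_set he⟩

/-- On points fixed by `K` the action of `g` depends only on the coset `g K`. -/
lemma smul_eq_of_mk_eq {G : Type u} [Group G] {X : Type v} [MulAction G X]
    {K : Subgroup G} {x : X} (hx : x ∈ MulAction.fixedPoints K X) {a b : G}
    (h : (a : G ⧸ K) = b) : a • x = b • x := by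
  have h1 : a⁻¹ * b ∈ K := QuotientGroup.eq.mp h
  have h2 : (a⁻¹ * b) • x = x := hx ⟨_, h1⟩
  calc a • x = a • ((a⁻¹ * b) • x) := by rw [h2]
    _ = b • x := by rw [smul_smul, mul_inv_cancel_left]

lemma IsGCWComplex.smul_mem_fixedSkeleton {G : Type u} [Group G] {X : Type v} [TopologicalSpace X] [T2Space X]
    [Topology.CWComplex (Set.univ : Set X)] [MulAction G X]
    [ContinuousConstSMul G X] {F : Set (Subgroup G)} (hX : IsGCWComplex G X)
    {A B : OrbitCat F} (f : A ⟶ B)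
    (p : ℕ) {x : X} (hx : x ∈ fixedSkeleton X B.subgroup p) :
    (f.toFun ((1 : G) : G ⧸ A.subgroup)).out • x ∈ fixedSkeleton X A.subgroup p := by
  refine ⟨fun h => ?_, hX.smul_mem_skeletonLT _ p x hx.2⟩
  change (h : G) • _ • x = _
  rw [smul_smul]
  refine smul_eq_of_mk_eq hx.1 ?_
  have h1 : ((h : G) • ((1 : G) : G ⧸ A.subgroup)) = ((1 : G) : G ⧸ A.subgroup) := by
    rw [MulAction.Quotient.smul_coe, QuotientGroup.eq]
    simp
  have h2 := f.map_smul' (h : G) ((1 : G) : G ⧸ A.subgroup)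
  rw [h1] at h2
  rw [← smul_eq_mul, ← MulAction.Quotient.smul_coe, QuotientGroup.out_eq']
  exact h2.symm

section Cellular

variable {G : Type u} [Group G] (F : Set (Subgroup G)) {X : Type u} [TopologicalSpace X]
  [T2Space X] [Topology.CWComplex (Set.univ : Set X)] [MulAction G X] [ContinuousConstSMul G X]

/-- The functor `G ⧸ H ↦ (X^H)_{<p}` from the orbit category to spaces. A morphism
`G ⧸ H → G ⧸ K`, `H ↦ g K`, acts by `X^K → X^H`, `x ↦ g • x`. -/
noncomputable def fixedSkeletonFunctor (hX : IsGCWComplex G X) (p : ℕ) :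
    (OrbitCat F)ᵒᵖ ⥤ TopCat.{u} where
  obj A := TopCat.of (fixedSkeleton X A.unop.subgroup p)
  map f := TopCat.ofHom
    ⟨fun x => ⟨(f.unop.toFun ((1 : G) : G ⧸ _)).out • x.1,
      hX.smul_mem_fixedSkeleton f.unop p x.2⟩, by fun_prop⟩
  map_id A := by
    ext x
    change (((1 : G) : G ⧸ A.unop.subgroup)).out • x.1 = x.1
    rw [smul_eq_of_mk_eq x.2.1 (QuotientGroup.out_eq' _), one_smul]
  map_comp {A B C} f g := by
    ext x
    change (f.unop.toFun (g.unop.toFun ((1 : G) : G ⧸ C.unop.subgroup))).out • x.1 =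
      (g.unop.toFun ((1 : G) : G ⧸ C.unop.subgroup)).out •
        (f.unop.toFun ((1 : G) : G ⧸ B.unop.subgroup)).out • x.1
    rw [smul_smul]
    refine smul_eq_of_mk_eq x.2.1 ?_
    rw [QuotientGroup.out_eq', ← smul_eq_mul, ← MulAction.Quotient.smul_coe,
      QuotientGroup.out_eq']
    refine Eq.trans ?_ (f.unop.map_smul' _ _)
    congr 1
    rw [MulAction.Quotient.smul_coe, smul_eq_mul, mul_one]
    exact (QuotientGroup.out_eq' _).symm

/-- The inclusions `(X^H)_{<p} ⊆ (X^H)_{<p+1}`. -/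
noncomputable def fixedSkeletonIncl (hX : IsGCWComplex G X) (p : ℕ) :
    fixedSkeletonFunctor F hX p ⟶ fixedSkeletonFunctor F hX (p + 1) where
  app A := TopCat.ofHom ⟨Set.inclusion (fixedSkeleton_mono A.unop.subgroup p),
    continuous_inclusion _⟩

/-! ### Cellular chains and Bredon cohomology of a `G`-CW-complex -/

/-- Integral singular chains. -/
noncomputable abbrev singularChains : TopCat.{u} ⥤ ChainComplex (ModuleCat.{u} ℤ) ℕ :=
  (AlgebraicTopology.singularChainComplexFunctor (ModuleCat.{u} ℤ)).obj
    (ModuleCat.of ℤ (ULift.{u} ℤ))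

/-- The complex of `O_F G`-modules given by the singular chains of a functor from the orbit
category to spaces, evaluated objectwise. -/
noncomputable def orbitSingularChains {F : Set (Subgroup G)} (T : (OrbitCat F)ᵒᵖ ⥤ TopCat.{u}) :
    ChainComplex (OrbitModule F) ℕ where
  X n := T ⋙ singularChains ⋙ HomologicalComplex.eval _ _ n
  d i j :=
    { app := fun A => (singularChains.obj (T.obj A)).d i j
      naturality := fun _ _ f => (singularChains.map (T.map f)).comm i j }
  shape i j h := by
    ext A : 2
    exact (singularChains.obj (T.obj A)).shape i j h
  d_comp_d' i j k _ _ := by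
    ext A : 2
    exact (singularChains.obj (T.obj A)).d_comp_d i j k

/-- The chain map induced by a natural transformation. -/
noncomputable def orbitSingularChainsMap {F : Set (Subgroup G)}
    {T T' : (OrbitCat F)ᵒᵖ ⥤ TopCat.{u}} (φ : T ⟶ T') :
    orbitSingularChains T ⟶ orbitSingularChains T' where
  f n := Functor.whiskerRight φ (singularChains ⋙ HomologicalComplex.eval _ _ n)
  comm' i j _ := by
    ext A : 2
    exact (singularChains.map (φ.app A)).comm i j

/-- The inclusion of the singular chains of `(X^H)_{<p}` into those of `(X^H)_{<p+1}`. -/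
noncomputable def skeletonChainsIncl (hX : IsGCWComplex G X) (p : ℕ) :
    orbitSingularChains (fixedSkeletonFunctor F hX p) ⟶
      orbitSingularChains (fixedSkeletonFunctor F hX (p + 1)) :=
  orbitSingularChainsMap (fixedSkeletonIncl F hX p)

instance skeletonChainsIncl_mono (hX : IsGCWComplex G X) (p : ℕ) :
    Mono (skeletonChainsIncl F hX p) := by
  have key : ∀ (A : (OrbitCat F)ᵒᵖ) (n : ℕ),
      Mono ((singularChains.map ((fixedSkeletonIncl F hX p).app A)).f n) := by
    intro A n
    have : Mono ((fixedSkeletonIncl F hX p).app A) := by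
      rw [TopCat.mono_iff_injective]
      exact Set.inclusion_injective (fixedSkeleton_mono A.unop.subgroup p)
    have : Mono (singularChains.map ((fixedSkeletonIncl F hX p).app A)) :=
      Functor.map_mono _ _
    infer_instance
  have : ∀ n, Mono ((skeletonChainsIncl F hX p).f n) := by
    intro n
    have : ∀ A, Mono (((skeletonChainsIncl F hX p).f n).app A) := fun A => key A n
    exact NatTrans.mono_of_mono_app _
  exact HomologicalComplex.mono_of_mono_f _ this

/-- The short complex `S((X^H)_{<p}) → S((X^H)_{<p+1}) → S((X^H)_{<p+1}) / S((X^H)_{<p})`,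
whose last term is the relative singular chain complex of two consecutive skeleta. -/
noncomputable def skeletonPair (hX : IsGCWComplex G X) (p : ℕ) :
    ShortComplex (ChainComplex (OrbitModule F) ℕ) :=
  ShortComplex.mk (skeletonChainsIncl F hX p) (cokernel.π (skeletonChainsIncl F hX p))
    (cokernel.condition _)

lemma skeletonPair_shortExact (hX : IsGCWComplex G X) (p : ℕ) :
    (skeletonPair F hX p).ShortExact where
  exact := ShortComplex.exact_cokernel _
  mono_f := skeletonChainsIncl_mono F hX p
  epi_g := coequalizer.π_epi

/-- The module of cellular `n`-chains, `G ⧸ H ↦ C_n(X^H) = H_n((X^H)_n, (X^H)_{n-1})`. -/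
noncomputable def cellularModule (hX : IsGCWComplex G X) (n : ℕ) : OrbitModule F :=
  (skeletonPair F hX n).X₃.homology n

/-- The cellular boundary map
`H_{n+1}(X_{n+1}, X_n) → H_n(X_n) → H_n(X_n, X_{n-1})` of the fixed point sets. -/
noncomputable def cellularBoundary (hX : IsGCWComplex G X) (n : ℕ) :
    cellularModule F hX (n + 1) ⟶ cellularModule F hX n :=
  (skeletonPair_shortExact F hX (n + 1)).δ (n + 1) n (by simp) ≫
    HomologicalComplex.homologyMap (skeletonPair F hX n).g n

lemma comp_comp_eq_zero {C : Type v} [Category.{u} C] [HasZeroMorphisms C] {V W Y Z T : C}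
    (a : V ⟶ W) (b : W ⟶ Y) (c : Y ⟶ Z) (d : Z ⟶ T) (h : b ≫ c = 0) :
    (a ≫ b) ≫ c ≫ d = 0 := by
  rw [Category.assoc, reassoc_of% h, zero_comp, comp_zero]

lemma cellularBoundary_comp (hX : IsGCWComplex G X) (n : ℕ) :
    cellularBoundary F hX (n + 1) ≫ cellularBoundary F hX n = 0 := by
  have h := (skeletonPair_shortExact F hX (n + 1)).comp_δ (n + 1) n (by simp)
  exact comp_comp_eq_zero _ _ _ _ h

/-- The cellular chain complex `C_*^F(X)` of `O_F G`-modules, `C_n^F(X)(G ⧸ H) = C_n(X^H)`. -/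
noncomputable def cellularComplex (hX : IsGCWComplex G X) : ChainComplex (OrbitModule F) ℕ :=
  ChainComplex.of (cellularModule F hX) (cellularBoundary F hX) (cellularBoundary_comp F hX)

/-- The Bredon cohomology `H^n_F(X; M)`: the cohomology of the cochain complex
`Hom_F(C_*^F(X), M)`. -/
noncomputable def BredonCohomology (hX : IsGCWComplex G X) (n : ℕ) (M : OrbitModule F) :
    ModuleCat.{u} ℤ :=
  ((cellularComplex F hX).linearYonedaObj ℤ M).homology n

end Cellular

/-! ### Free abelian groups on simplices -/

/-! The cellular complex of a cocompact model is a finite resolution of the constant module by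
finitely generated free modules; the top cohomology is then right exact and commutes with finite
sums, and this forces it to be seen on the free modules at cell stabilisers.

In detail, the n-cells of `X^H` correspond to pairs consisting of an orbit of n-cells, with
stabiliser `K` of a representative, and a morphism `G/H → G/K`. So the n-th cellular module is the
direct sum of the modules `A_K` over the orbits of n-cells (`isCellAttachment`,
`isFreeOn_cellularModule`), hence projective. Contractibility of all `X^H` makes the augmented
complex exact (`cellularBoundary_exact`, `cellularAug_exact`), so it computes `Ext` from the
constant module, and the Bredon cohomologies of `X` and `G` vanish simultaneously
(`nontrivial_bredonCohomology_iff`). Compactness of `X/G` leaves finitely many orbits of cells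
(`finite_cellOrbit`), so the dimension is some finite n, and the supremum is attained.

Let a cocycle `f : C_n → M` represent a nonzero class in this top degree, and let `f` factor as `P`
followed by `Q` through a finite sum of modules `N_j`. The map `P` need not be a cocycle, but its
composite to the image of `Q` is one, and its class is nonzero because it maps to that of `f`. Since
`H^{n+1}` vanishes, the class lifts along the epimorphism from the sum to the image of `Q`, and so
some `H^n(G; N_j)` is nonzero (`exists_nontrivial_ext`). For arbitrary `M`, the decomposition of
`C_n` itself gives such a factorisation, with the `N_j` free at cell stabilisers. For `M = A_L`,
each generator goes to a finite combination of morphisms `G/K → G/L`, and each of these factors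
through `G/H` with `H ≤ L` the stabiliser of a translated cell (`exists_factor_repStabilizer`).

Most of the work is the topology behind the first step: that relative singular homology of
consecutive skeleta of `X^H` is free on the cells and concentrated in one degree. This rests on
barycentric subdivision (`exists_sub_bd_mem_sup`), prism operators, excision for relative
homeomorphisms (`IsRelHomeo`) and an induction for the ball modulo its sphere (`ball_relHomology`).
-/

lemma Finsupp.map_mem_of_mem_supported {α M : Type*} [AddCommGroup M] (L : (α →₀ ℤ) →ₗ[ℤ] M)
    {s : Set α} {P : Submodule ℤ M} (h : ∀ x ∈ s, L (Finsupp.single x 1) ∈ P) {c : α →₀ ℤ}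
    (hc : c ∈ Finsupp.supported ℤ ℤ s) : L c ∈ P := by
  rw [Finsupp.supported_eq_span_single] at hc
  refine (Submodule.span_le.mpr ?_ : _ ≤ P.comap L) hc
  rintro _ ⟨x, hx, rfl⟩
  exact h x hx

lemma Finsupp.lmapDomain_mem_supported {α β : Type*} (f : α → β) {s : Set α} {t : Set β}
    (h : ∀ x ∈ s, f x ∈ t) {c : α →₀ ℤ} (hc : c ∈ Finsupp.supported ℤ ℤ s) :
    Finsupp.lmapDomain ℤ ℤ f c ∈ Finsupp.supported ℤ ℤ t := by
  refine Finsupp.map_mem_of_mem_supported _ (fun x hx => ?_) hc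
  rw [Finsupp.lmapDomain_apply, Finsupp.mapDomain_single]
  exact Finsupp.single_mem_supported ℤ _ (h x hx)

/-! ### Explicit augmented singular chains and formal chains of tuples -/

namespace SingularChain

/-- The standard simplex with `n` vertices. -/
abbrev Splx (n : ℕ) := stdSimplex ℝ (Fin n)

/-- The inclusion of the `i`-th face. -/
noncomputable def face {n : ℕ} (i : Fin (n + 1)) : C(Splx n, Splx (n + 1)) :=
  ⟨stdSimplex.map i.succAbove, stdSimplex.continuous_map _⟩

/-- Integral singular chains of degree `n - 1`; for `n = 0` this is the augmentation module. -/
abbrev Chain (n : ℕ) (Y : Type*) [TopologicalSpace Y] := C(Splx n, Y) →₀ ℤ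

/-- Formal chains of `n`-tuples of points. -/
abbrev TChain (n : ℕ) (K : Type*) := (Fin n → K) →₀ ℤ

section Basic

variable {Y Z W : Type*} [TopologicalSpace Y] [TopologicalSpace Z] [TopologicalSpace W]
variable {K K' : Type*}

/-- The boundary of singular chains. -/
noncomputable def bd (n : ℕ) : Chain (n + 1) Y →ₗ[ℤ] Chain n Y :=
  ∑ i : Fin (n + 1), (-1 : ℤ) ^ (i : ℕ) • Finsupp.lmapDomain ℤ ℤ fun σ => σ.comp (face i)

/-- The chain map induced by a continuous map. -/
noncomputable def push (f : C(Y, Z)) (n : ℕ) : Chain n Y →ₗ[ℤ] Chain n Z :=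
  Finsupp.lmapDomain ℤ ℤ fun σ => f.comp σ

/-- The boundary of formal chains of tuples. -/
noncomputable def tbd (n : ℕ) : TChain (n + 1) K →ₗ[ℤ] TChain n K :=
  ∑ i : Fin (n + 1), (-1 : ℤ) ^ (i : ℕ) • Finsupp.lmapDomain ℤ ℤ fun w => w ∘ i.succAbove

/-- The chain map induced by a map of points. -/
noncomputable def tpush (f : K → K') (n : ℕ) : TChain n K →ₗ[ℤ] TChain n K' :=
  Finsupp.lmapDomain ℤ ℤ fun w => f ∘ w

/-- The cone with apex `b`. -/
noncomputable def cone (b : K) (n : ℕ) : TChain n K →ₗ[ℤ] TChain (n + 1) K :=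
  Finsupp.lmapDomain ℤ ℤ fun w => (Fin.cons b w : Fin (n + 1) → K)

lemma bd_single {n : ℕ} (σ : C(Splx (n + 1), Y)) (m : ℤ) :
    bd n (Finsupp.single σ m) =
      ∑ i : Fin (n + 1), (-1 : ℤ) ^ (i : ℕ) • Finsupp.single (σ.comp (face i)) m := by
  simp [bd, LinearMap.sum_apply]

@[simp] lemma push_single (f : C(Y, Z)) {n : ℕ} (σ : C(Splx n, Y)) (m : ℤ) :
    push f n (Finsupp.single σ m) = Finsupp.single (f.comp σ) m := by
  simp [push]

lemma tbd_single {n : ℕ} (w : Fin (n + 1) → K) (m : ℤ) :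
    tbd n (Finsupp.single w m) =
      ∑ i : Fin (n + 1), (-1 : ℤ) ^ (i : ℕ) • Finsupp.single (w ∘ i.succAbove) m := by
  simp [tbd, LinearMap.sum_apply]

@[simp] lemma tpush_single (f : K → K') {n : ℕ} (w : Fin n → K) (m : ℤ) :
    tpush f n (Finsupp.single w m) = Finsupp.single (f ∘ w) m := by
  simp [tpush]

@[simp] lemma cone_single (b : K) {n : ℕ} (w : Fin n → K) (m : ℤ) :
    cone b n (Finsupp.single w m) = Finsupp.single (Fin.cons b w : Fin (n + 1) → K) m := by
  simp [cone]

lemma push_push (g : C(Z, W)) (f : C(Y, Z)) {n : ℕ} (c : Chain n Y) :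
    push g n (push f n c) = push (g.comp f) n c := by
  induction c using Finsupp.induction_linear with
  | zero => simp
  | add a b ha hb => simp [ha, hb]
  | single σ m => simp [ContinuousMap.comp_assoc]

@[simp] lemma push_id {n : ℕ} (c : Chain n Y) : push (ContinuousMap.id Y) n c = c := by
  induction c using Finsupp.induction_linear with
  | zero => simp
  | add a b ha hb => simp [ha, hb]
  | single σ m => simp

lemma bd_push (f : C(Y, Z)) {n : ℕ} (c : Chain (n + 1) Y) :
    bd n (push f (n + 1) c) = push f n (bd n c) := by
  induction c using Finsupp.induction_linear with
  | zero => simp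
  | add a b ha hb => simp [ha, hb]
  | single σ m => simp only [push_single, bd_single, map_sum, map_smul, ContinuousMap.comp_assoc]

lemma tbd_tpush (f : K → K') {n : ℕ} (c : TChain (n + 1) K) :
    tbd n (tpush f (n + 1) c) = tpush f n (tbd n c) := by
  induction c using Finsupp.induction_linear with
  | zero => simp
  | add a b ha hb => simp [ha, hb]
  | single σ m => simp only [tpush_single, tbd_single, map_sum, map_smul, Function.comp_assoc]

lemma tpush_cone (f : K → K') (b : K) {n : ℕ} (c : TChain n K) :
    tpush f (n + 1) (cone b n c) = cone (f b) n (tpush f n c) := by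
  induction c using Finsupp.induction_linear with
  | zero => simp
  | add a b ha hb => simp [ha, hb]
  | single w m =>
    simp only [cone_single, tpush_single]
    congr 1
    ext i
    refine Fin.cases ?_ (fun j => ?_) i <;> simp

/-- Deleting the apex returns the base, and deleting any other vertex gives the cone on a face with
the opposite sign. Thus coning is a contracting homotopy of the augmented complex of tuples; all
later operators are built from it. -/
lemma tbd_cone (b : K) {n : ℕ} (c : TChain (n + 1) K) :
    tbd (n + 1) (cone b (n + 1) c) = c - cone b n (tbd n c) := by
  induction c using Finsupp.induction_linear with
  | zero => simp
  | add a b ha hb => simp only [map_add, ha, hb]; abel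
  | single w m =>
    have h0 : (Fin.cons b w : Fin (n + 1 + 1) → K) ∘ (0 : Fin (n + 1 + 1)).succAbove = w := by
      ext i; simp
    have h1 : ∀ i : Fin (n + 1), (Fin.cons b w : Fin (n + 1 + 1) → K) ∘ i.succ.succAbove =
        (Fin.cons b (w ∘ i.succAbove) : Fin (n + 1) → K) := by
      intro i
      ext j
      refine Fin.cases ?_ (fun k => ?_) j <;> simp
    simp only [cone_single, tbd_single, Fin.sum_univ_succ (n := n + 1), h0, h1, map_sum, map_smul]
    simp [pow_succ, sub_eq_add_neg]

lemma tbd_cone_zero (b : K) (c : TChain 0 K) : tbd 0 (cone b 0 c) = c := by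
  induction c using Finsupp.induction_linear with
  | zero => simp
  | add a b ha hb => simp only [map_add, ha, hb]
  | single w m =>
    simp only [cone_single, tbd_single]
    simp [Subsingleton.elim _ w]

/-- A tuple is the cone on its tail with apex its first entry, so the cone formula reduces the claim
to one degree lower and no sign bookkeeping is needed. -/
lemma tbd_tbd {n : ℕ} (c : TChain (n + 2) K) : tbd n (tbd (n + 1) c) = 0 := by
  induction n with
  | zero =>
    induction c using Finsupp.induction_linear with
    | zero => simp
    | add a b ha hb => simp only [map_add, ha, hb, add_zero]
    | single w m =>
      have : Finsupp.single w m = cone (w 0) 1 (Finsupp.single (Fin.tail w) m) := by simp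
      rw [this, tbd_cone, map_sub, tbd_cone_zero, sub_self]
  | succ n ih =>
    induction c using Finsupp.induction_linear with
    | zero => simp
    | add a b ha hb => simp only [map_add, ha, hb, add_zero]
    | single w m =>
      have : Finsupp.single w m = cone (w 0) (n + 2) (Finsupp.single (Fin.tail w) m) := by simp
      rw [this, tbd_cone, map_sub, tbd_cone, ih, map_zero, sub_zero, sub_self]

/-- Chains supported in a subset. -/
def chainsIn (n : ℕ) (U : Set Y) : Submodule ℤ (Chain n Y) :=
  Finsupp.supported ℤ ℤ {σ | ∀ t, σ t ∈ U}

lemma single_mem_chainsIn {n : ℕ} {U : Set Y} {σ : C(Splx n, Y)} (h : ∀ t, σ t ∈ U) (m : ℤ) :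
    Finsupp.single σ m ∈ chainsIn n U :=
  Finsupp.single_mem_supported ℤ _ h

lemma chainsIn_mono {n : ℕ} {U V : Set Y} (h : U ⊆ V) : chainsIn n U ≤ chainsIn n V :=
  Finsupp.supported_mono fun _ hσ t => h (hσ t)

lemma mem_chainsIn_univ {n : ℕ} (c : Chain n Y) : c ∈ chainsIn n (Set.univ : Set Y) := by
  simp [chainsIn]

lemma push_mem_chainsIn {f : C(Y, Z)} {n : ℕ} {U : Set Y} {V : Set Z} (h : Set.MapsTo f U V)
    {c : Chain n Y} (hc : c ∈ chainsIn n U) : push f n c ∈ chainsIn n V :=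
  Finsupp.lmapDomain_mem_supported (s := {σ : C(Splx n, Y) | ∀ t, σ t ∈ U})
    (t := {σ : C(Splx n, Z) | ∀ t, σ t ∈ V}) _ (fun _ hσ t => h (hσ t)) hc

lemma bd_mem_chainsIn {n : ℕ} {U : Set Y} {c : Chain (n + 1) Y} (hc : c ∈ chainsIn (n + 1) U) :
    bd n c ∈ chainsIn n U := by
  refine Finsupp.map_mem_of_mem_supported _ (fun σ hσ => ?_) hc
  rw [bd_single]
  exact Submodule.sum_mem _ fun i _ =>
    Submodule.smul_mem _ _ (single_mem_chainsIn (fun t => hσ (face i t)) _)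

end Basic

/-! ### Affine simplices -/

section Affine

variable {V : Type*} [NormedAddCommGroup V] [NormedSpace ℝ V] {s : Set V} (hs : Convex ℝ s)
variable {V' : Type*} [NormedAddCommGroup V'] [NormedSpace ℝ V'] {s' : Set V'} (hs' : Convex ℝ s')
variable {Y Z : Type*} [TopologicalSpace Y] [TopologicalSpace Z]

/-- The affine simplex with given vertices in a convex set. -/
noncomputable def aff {n : ℕ} (w : Fin n → s) : C(Splx n, s) :=
  ⟨fun t => ⟨∑ i, t.1 i • (w i).1,
    hs.sum_mem (fun i _ => t.2.1 i) t.2.2 (fun i _ => (w i).2)⟩,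
    Continuous.subtype_mk (continuous_finsetSum _ fun i _ =>
      ((continuous_apply i).comp continuous_subtype_val).smul continuous_const) _⟩

lemma aff_coe {n : ℕ} (w : Fin n → s) (t : Splx n) :
    (aff hs w t : V) = ∑ i, t.1 i • (w i).1 := rfl

lemma aff_face {n : ℕ} (w : Fin (n + 1) → s) (i : Fin (n + 1)) :
    (aff hs w).comp (face i) = aff hs (w ∘ i.succAbove) := by
  ext t
  change ∑ j, (stdSimplex.map i.succAbove t) j • (w j).1 = ∑ j, t.1 j • (w (i.succAbove j)).1
  simp only [stdSimplex.map_coe, FunOnFinite.linearMap_apply_apply]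
  rw [← Finset.sum_fiberwise Finset.univ i.succAbove]
  refine Finset.sum_congr rfl fun j _ => ?_
  rw [Finset.sum_smul]
  refine Finset.sum_congr rfl fun k hk => ?_
  rw [(Finset.mem_filter.mp hk).2]
  rfl

/-- A map between convex sets preserving convex combinations. -/
def IsAffineMap (f : s → s') : Prop :=
  ∀ (n : ℕ) (w : Fin n → s) (t : Splx n), f (aff hs w t) = aff hs' (f ∘ w) t

lemma aff_isAffineMap {n : ℕ} (w : Fin n → s) :
    IsAffineMap (convex_stdSimplex ℝ (Fin n)) hs (aff hs w) := by
  intro m v t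
  apply Subtype.ext
  simp only [aff_coe, Function.comp_apply, Finset.sum_smul, Finset.smul_sum, Finset.sum_apply,
    Pi.smul_apply, smul_eq_mul, mul_smul]
  exact Finset.sum_comm

/-- Vertices of the standard simplex. -/
noncomputable def vert (n : ℕ) : Fin n → Splx n := fun i => stdSimplex.vertex i

lemma aff_vert (n : ℕ) : aff (convex_stdSimplex ℝ (Fin n)) (vert n) = ContinuousMap.id _ := by
  ext1 t
  apply Subtype.ext
  ext j
  simp [aff_coe, vert, Pi.single_apply]

lemma aff_comp_vert {n : ℕ} (w : Fin n → s) : aff hs w ∘ vert n = w := by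
  ext i
  simp [aff_coe, vert, Pi.single_apply]

/-- The chain map from formal chains in a convex set to singular chains. -/
noncomputable def tsing (g : C(s, Y)) (n : ℕ) : TChain n s →ₗ[ℤ] Chain n Y :=
  Finsupp.lmapDomain ℤ ℤ fun w => g.comp (aff hs w)

@[simp] lemma tsing_single (g : C(s, Y)) {n : ℕ} (w : Fin n → s) (m : ℤ) :
    tsing hs g n (Finsupp.single w m) = Finsupp.single (g.comp (aff hs w)) m := by
  simp [tsing]

lemma bd_tsing (g : C(s, Y)) {n : ℕ} (c : TChain (n + 1) s) :
    bd n (tsing hs g (n + 1) c) = tsing hs g n (tbd n c) := by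
  induction c using Finsupp.induction_linear with
  | zero => simp
  | add a b ha hb => simp [ha, hb]
  | single σ m =>
    simp only [tsing_single, tbd_single, bd_single, map_sum, map_smul, ContinuousMap.comp_assoc,
      aff_face]

lemma push_tsing (f : C(Y, Z)) (g : C(s, Y)) {n : ℕ} (c : TChain n s) :
    push f n (tsing hs g n c) = tsing hs (f.comp g) n c := by
  induction c using Finsupp.induction_linear with
  | zero => simp
  | add a b ha hb => simp [ha, hb]
  | single σ m => simp [ContinuousMap.comp_assoc]

-- An affine map carries the affine simplex on `w` to the one on the images of `w`. This makes
-- constructions on tuples natural enough to transport to singular simplices.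
variable {hs hs'} in
lemma tsing_tpush (g : C(s', Y)) (f : C(s, s')) (hf : IsAffineMap hs hs' f) {n : ℕ}
    (c : TChain n s) : tsing hs' g n (tpush f n c) = tsing hs (g.comp f) n c := by
  induction c using Finsupp.induction_linear with
  | zero => simp
  | add a b ha hb => simp [ha, hb]
  | single w m =>
    have : (aff hs' (f ∘ w)) = f.comp (aff hs w) := by
      ext t
      exact congrArg _ (hf n w t).symm
    simp [ContinuousMap.comp_assoc, this]

/-- The tautological chain of the standard simplex. -/
noncomputable def taut (n : ℕ) : TChain n (Splx n) := Finsupp.single (vert n) 1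

/-- Every singular simplex is the image of the tautological chain, so a natural operator may be
defined, and its identities checked, on that one chain. -/
lemma tsing_taut {n : ℕ} (σ : C(Splx n, Y)) :
    tsing (convex_stdSimplex ℝ (Fin n)) σ n (taut n) = Finsupp.single σ 1 := by
  simp [taut, aff_vert]

lemma tpush_aff_taut {n : ℕ} (w : Fin n → s) :
    tpush (aff hs w) n (taut n) = Finsupp.single w 1 := by
  simp [taut, aff_comp_vert]

lemma bd_bd {n : ℕ} (c : Chain (n + 2) Y) : bd n (bd (n + 1) c) = 0 := by
  induction c using Finsupp.induction_linear with
  | zero => simp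
  | add a b ha hb => simp [ha, hb]
  | single σ m =>
    have : Finsupp.single σ m = m • Finsupp.single σ 1 := by simp
    rw [this, map_smul, map_smul, ← tsing_taut, bd_tsing, bd_tsing, tbd_tbd, map_zero, smul_zero]

lemma tsing_mem_chainsIn (g : C(s, Y)) {n : ℕ} {U : Set Y} (h : ∀ x, g x ∈ U) (c : TChain n s) :
    tsing hs g n c ∈ chainsIn n U :=
  Finsupp.lmapDomain_mem_supported (s := Set.univ) (t := {σ : C(Splx n, Y) | ∀ t, σ t ∈ U}) _
    (fun _ _ _ => h _) (by simp)

end Affine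

/-! ### Barycentric subdivision -/

section Subdivision

variable {V : Type*} [NormedAddCommGroup V] [NormedSpace ℝ V] {s : Set V} (hs : Convex ℝ s)
variable {V' : Type*} [NormedAddCommGroup V'] [NormedSpace ℝ V'] {s' : Set V'} (hs' : Convex ℝ s')
variable {Y Z : Type*} [TopologicalSpace Y] [TopologicalSpace Z]

/-- The barycenter of a tuple in a convex set. -/
noncomputable def bary {n : ℕ} (w : Fin (n + 1) → s) : s :=
  aff hs w (stdSimplex.barycenter (𝕜 := ℝ) (X := Fin (n + 1)))

/-- The homotopy operator of barycentric subdivision on formal chains. -/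
noncomputable def tsub : ∀ n : ℕ, TChain n s →ₗ[ℤ] TChain (n + 1) s
  | 0 => 0
  | n + 1 => Finsupp.linearCombination ℤ fun w =>
      cone (bary hs w) (n + 1) (Finsupp.single w 1 - tsub n (tbd n (Finsupp.single w 1)))

lemma tsub_single {n : ℕ} (w : Fin (n + 1) → s) :
    tsub hs (n + 1) (Finsupp.single w 1) =
      cone (bary hs w) (n + 1) (Finsupp.single w 1 - tsub hs n (tbd n (Finsupp.single w 1))) := by
  rw [tsub, Finsupp.linearCombination_single, one_smul]

-- Affine maps preserve barycentres, hence commute with the recursive coning.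
variable {hs hs'} in
lemma tsub_tpush {f : s → s'} (hf : IsAffineMap hs hs' f) {n : ℕ} (c : TChain n s) :
    tsub hs' n (tpush f n c) = tpush f (n + 1) (tsub hs n c) := by
  induction n with
  | zero => simp [tsub]
  | succ n ih =>
    induction c using Finsupp.induction_linear with
    | zero => simp
    | add a b ha hb => simp [ha, hb]
    | single w m =>
      have : Finsupp.single w m = m • Finsupp.single w 1 := by simp
      rw [this, map_smul, map_smul, map_smul, map_smul, tsub_single, tpush_cone, map_sub, ← ih,
        ← tbd_tpush, tpush_single, tsub_single, bary, bary, hf]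

/-- Barycentric subdivision of formal chains. -/
noncomputable def tdiv : ∀ n : ℕ, TChain n s →ₗ[ℤ] TChain n s
  | 0 => LinearMap.id
  | n + 1 => LinearMap.id - tbd (n + 1) ∘ₗ tsub hs (n + 1) - tsub hs n ∘ₗ tbd n

/-- Subdivision is defined through its homotopy to the identity, so the homotopy formula is free and
the geometric description has to be recovered: subdivide the boundary and cone it off from the
barycentre. The size estimates use this form. -/
lemma tdiv_single {n : ℕ} (w : Fin (n + 1) → s) :
    tdiv hs (n + 1) (Finsupp.single w 1) =
      cone (bary hs w) n (tdiv hs n (tbd n (Finsupp.single w 1))) := by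
  have h : tbd n (Finsupp.single w 1 - tsub hs n (tbd n (Finsupp.single w 1))) =
      tdiv hs n (tbd n (Finsupp.single w 1)) := by
    cases n with
    | zero => simp [tdiv, tsub]
    | succ n => simp [tdiv, tbd_tbd]
  simp only [tdiv, LinearMap.sub_apply, LinearMap.comp_apply, tsub_single, tbd_cone, h,
    LinearMap.id_apply]
  abel

/-- The vector from the barycentre to a vertex is the mean of `n + 1` differences of vertices, one
of which is zero; hence the factor `n / (n + 1)`. Balls are convex, so the bound at the vertices
passes to the hull. -/
lemma norm_bary_sub_le {n : ℕ} (w : Fin (n + 1) → s) {δ : ℝ} (h : ∀ i j, dist (w i) (w j) ≤ δ)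
    {x : s} (hx : (x : V) ∈ convexHull ℝ (Set.range fun i => (w i : V))) :
    dist (bary hs w) x ≤ (1 - 1 / ((n + 1 : ℕ) : ℝ)) * δ := by
  have key : convexHull ℝ (Set.range fun i => (w i : V)) ⊆
      Metric.closedBall (bary hs w : V) ((1 - 1 / ((n + 1 : ℕ) : ℝ)) * δ) := by
    refine convexHull_min ?_ (convex_closedBall _ _)
    rintro _ ⟨j, rfl⟩
    have hn : ((n + 1 : ℕ) : ℝ) ≠ 0 := by positivity
    have e : ((w j : V) - (bary hs w : V)) =
        (1 / ((n + 1 : ℕ) : ℝ)) • ∑ i, ((w j : V) - (w i : V)) := by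
      rw [bary, aff_coe, Finset.sum_sub_distrib, smul_sub, Finset.sum_const, Finset.card_univ,
        Fintype.card_fin, ← Nat.cast_smul_eq_nsmul ℝ, smul_smul, one_div_mul_cancel hn, one_smul,
        Finset.smul_sum]
      congr 1
      refine Finset.sum_congr rfl fun i _ => ?_
      congr 1
      have := stdSimplex.barycenter_apply (𝕜 := ℝ) (X := Fin (n + 1)) i
      simp at this ⊢
    rw [Metric.mem_closedBall, dist_eq_norm, e, norm_smul, Real.norm_of_nonneg (by positivity)]
    have b1 : ‖∑ i, ((w j : V) - (w i : V))‖ ≤ n * δ := by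
      rw [← Finset.sum_erase (a := j) _ (by simp)]
      refine (norm_sum_le_of_le _ fun i _ => ?_).trans_eq (b := ∑ i ∈ Finset.univ.erase j, δ) ?_
      · rw [← dist_eq_norm]
        exact h j i
      · simp
    have : (1 - 1 / ((n + 1 : ℕ) : ℝ)) * δ = 1 / ((n + 1 : ℕ) : ℝ) * (n * δ) := by
      field_simp
      push_cast
      ring
    rw [this]
    gcongr
  rw [dist_comm]
  exact key hx

/-- Two vertices of a small simplex either lie in a subdivided face, where induction gives the
better factor `1 - 1 / n`, or include the barycentre. The convex hull clause is carried along to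
bound distances to the barycentre. -/
lemma tdiv_single_mem {n : ℕ} (w : Fin n → s) {δ : ℝ} (h : ∀ i j, dist (w i) (w j) ≤ δ) :
    tdiv hs n (Finsupp.single w 1) ∈ Finsupp.supported ℤ ℤ {v : Fin n → s |
      (∀ i, (v i : V) ∈ convexHull ℝ (Set.range fun i => (w i : V))) ∧
      ∀ i j, dist (v i) (v j) ≤ (1 - 1 / (n : ℝ)) * δ} := by
  induction n with
  | zero => exact Finsupp.single_mem_supported ℤ _ ⟨fun i => i.elim0, fun i => i.elim0⟩
  | succ n ih =>
    have hδ : 0 ≤ δ := dist_nonneg.trans (h 0 0)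
    rw [tdiv_single]
    have : tdiv hs n (tbd n (Finsupp.single w 1)) ∈ Finsupp.supported ℤ ℤ {v : Fin n → s |
        (∀ i, (v i : V) ∈ convexHull ℝ (Set.range fun i => (w i : V))) ∧
        ∀ i j, dist (v i) (v j) ≤ (1 - 1 / (n : ℝ)) * δ} := by
      rw [tbd_single, map_sum]
      refine Submodule.sum_mem _ fun k _ => ?_
      rw [map_smul]
      refine Submodule.smul_mem _ _ (Finsupp.supported_mono ?_
        (ih (w ∘ k.succAbove) fun i j => h _ _))
      rintro v ⟨hv, hv'⟩
      refine ⟨fun i => convexHull_mono ?_ (hv i), hv'⟩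
      rintro _ ⟨j, rfl⟩
      exact ⟨_, rfl⟩
    refine Finsupp.lmapDomain_mem_supported _ (fun v hv => ?_) this
    have hb : ∀ x : s, (x : V) ∈ convexHull ℝ (Set.range fun i => (w i : V)) →
      dist (bary hs w) x ≤ (1 - 1 / ((n + 1 : ℕ) : ℝ)) * δ := fun x => norm_bary_sub_le hs w h
    refine ⟨fun i => ?_, fun i j => ?_⟩
    · refine Fin.cases ?_ (fun j => hv.1 j) i
      refine mem_convexHull_of_exists_fintype (ι := Fin (n + 1))
        (stdSimplex.barycenter (𝕜 := ℝ) (X := Fin (n + 1))).1 (fun i => (w i : V)) ?_ ?_ ?_ ?_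
      · exact fun i => (stdSimplex.barycenter (𝕜 := ℝ) (X := Fin (n + 1))).2.1 i
      · exact (stdSimplex.barycenter (𝕜 := ℝ) (X := Fin (n + 1))).2.2
      · exact fun i => ⟨i, rfl⟩
      · rfl
    · have h0 : 0 ≤ (1 - 1 / ((n + 1 : ℕ) : ℝ)) * δ := by
        refine mul_nonneg ?_ hδ
        rw [sub_nonneg, div_le_one (by positivity)]
        exact_mod_cast Nat.succ_le_succ (Nat.zero_le n)
      induction i using Fin.cases <;> induction j using Fin.cases
      · simpa using h0
      · exact hb _ (hv.1 _)
      · rw [dist_comm]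
        exact hb _ (hv.1 _)
      · rename_i i j
        refine (hv.2 i j).trans ?_
        have : 0 < n := i.pos
        gcongr
        simp

lemma tdiv_iterate_mem {n : ℕ} {δ : ℝ} {c : TChain n s}
    (hc : c ∈ Finsupp.supported ℤ ℤ {v : Fin n → s | ∀ i j, dist (v i) (v j) ≤ δ}) (k : ℕ) :
    (tdiv hs n)^[k] c ∈
      Finsupp.supported ℤ ℤ {v : Fin n → s | ∀ i j, dist (v i) (v j) ≤ (1 - 1 / (n : ℝ)) ^ k * δ} := by
  induction k with
  | zero => simpa using hc
  | succ k ih =>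
    rw [Function.iterate_succ_apply']
    refine Finsupp.map_mem_of_mem_supported _ (fun w hw => ?_) ih
    refine Finsupp.supported_mono ?_ (tdiv_single_mem hs w hw)
    rintro v ⟨-, hv⟩ i j
    rw [pow_succ', mul_assoc]
    exact hv i j

/-- The homotopy operator of barycentric subdivision on singular chains. -/
noncomputable def sub (n : ℕ) : Chain n Y →ₗ[ℤ] Chain (n + 1) Y :=
  Finsupp.linearCombination ℤ fun σ => tsing (convex_stdSimplex ℝ (Fin n)) σ (n + 1)
    (tsub (convex_stdSimplex ℝ (Fin n)) n (taut n))

lemma sub_single {n : ℕ} (σ : C(Splx n, Y)) :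
    sub n (Finsupp.single σ 1) = tsing (convex_stdSimplex ℝ (Fin n)) σ (n + 1)
      (tsub (convex_stdSimplex ℝ (Fin n)) n (taut n)) := by
  rw [sub, Finsupp.linearCombination_single, one_smul]

lemma sub_tsing (g : C(s, Y)) {n : ℕ} (c : TChain n s) :
    sub n (tsing hs g n c) = tsing hs g (n + 1) (tsub hs n c) := by
  induction c using Finsupp.induction_linear with
  | zero => simp
  | add a b ha hb => simp [ha, hb]
  | single w m =>
    have : Finsupp.single w m = m • Finsupp.single w 1 := by simp
    rw [this]
    simp only [map_smul]
    rw [tsing_single, sub_single, ← tsing_tpush g (aff hs w) (aff_isAffineMap hs w),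
      ← tsub_tpush (aff_isAffineMap hs w), tpush_aff_taut]

/-- Barycentric subdivision of singular chains. -/
noncomputable def sdiv : ∀ n : ℕ, Chain n Y →ₗ[ℤ] Chain n Y
  | 0 => LinearMap.id
  | n + 1 => LinearMap.id - bd (n + 1) ∘ₗ sub (n + 1) - sub n ∘ₗ bd n

lemma sdiv_tsing (g : C(s, Y)) {n : ℕ} (c : TChain n s) :
    sdiv n (tsing hs g n c) = tsing hs g n (tdiv hs n c) := by
  cases n with
  | zero => rfl
  | succ n => simp [sdiv, tdiv, sub_tsing, bd_tsing]

lemma sdiv_iterate_tsing (g : C(s, Y)) {n : ℕ} (c : TChain n s) (k : ℕ) :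
    (sdiv n)^[k] (tsing hs g n c) = tsing hs g n ((tdiv hs n)^[k] c) := by
  induction k with
  | zero => rfl
  | succ k ih => rw [Function.iterate_succ_apply', Function.iterate_succ_apply', ih, sdiv_tsing]

lemma sub_mem_chainsIn {n : ℕ} {U : Set Y} {c : Chain n Y} (hc : c ∈ chainsIn n U) :
    sub n c ∈ chainsIn (n + 1) U := by
  refine Finsupp.map_mem_of_mem_supported _ (fun σ hσ => ?_) hc
  rw [sub_single]
  exact tsing_mem_chainsIn _ _ hσ _

lemma sdiv_mem_chainsIn {n : ℕ} {U : Set Y} {c : Chain n Y} (hc : c ∈ chainsIn n U) :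
    sdiv n c ∈ chainsIn n U := by
  cases n with
  | zero => exact hc
  | succ n =>
    exact Submodule.sub_mem _ (Submodule.sub_mem _ hc (bd_mem_chainsIn (sub_mem_chainsIn hc)))
      (sub_mem_chainsIn (bd_mem_chainsIn hc))

lemma map_mem_sup_chainsIn {n m : ℕ} {U V : Set Y} (L : Chain n Y →ₗ[ℤ] Chain m Y)
    (hU : ∀ c ∈ chainsIn n U, L c ∈ chainsIn m U) (hV : ∀ c ∈ chainsIn n V, L c ∈ chainsIn m V)
    {c : Chain n Y} (hc : c ∈ chainsIn n U ⊔ chainsIn n V) :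
    L c ∈ chainsIn m U ⊔ chainsIn m V := by
  obtain ⟨a, ha, b, hb, rfl⟩ := Submodule.mem_sup.mp hc
  rw [map_add]
  exact Submodule.add_mem_sup (hU a ha) (hV b hb)

lemma sdiv_iterate_mem_sup {n : ℕ} {U V : Set Y} {c : Chain n Y}
    (hc : c ∈ chainsIn n U ⊔ chainsIn n V) (k : ℕ) :
    (sdiv n)^[k] c ∈ chainsIn n U ⊔ chainsIn n V := by
  induction k with
  | zero => exact hc
  | succ k ih =>
    rw [Function.iterate_succ_apply']
    exact map_mem_sup_chainsIn _ (fun _ => sdiv_mem_chainsIn) (fun _ => sdiv_mem_chainsIn) ih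

/-- Diameters shrink geometrically, so they eventually fall below a Lebesgue number of the pulled
back cover. The simplex with no vertices is empty and is small for trivial reasons. -/
lemma exists_sdiv_iterate_single_mem {n : ℕ} {U V : Set Y} (hU : IsOpen U) (hV : IsOpen V)
    (hUV : U ∪ V = Set.univ) (σ : C(Splx n, Y)) :
    ∃ k, (sdiv n)^[k] (Finsupp.single σ 1) ∈ chainsIn n U ⊔ chainsIn n V := by
  rcases Nat.eq_zero_or_pos n with rfl | hn
  · refine ⟨0, Submodule.mem_sup_left (single_mem_chainsIn (fun t => ?_) _)⟩
    have := t.2.2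
    simp at this
  let hs := convex_stdSimplex ℝ (Fin n)
  obtain ⟨δ, hδ, hL⟩ := lebesgue_number_lemma_of_metric (s := (Set.univ : Set (Splx n)))
    (c := fun b : Bool => σ ⁻¹' (bif b then U else V)) isCompact_univ
    (fun b => by cases b <;> simp [hU.preimage σ.continuous, hV.preimage σ.continuous])
    (fun x _ => by
      have : σ x ∈ U ∪ V := hUV ▸ Set.mem_univ _
      rcases this with h | h
      · exact Set.mem_iUnion.mpr ⟨true, h⟩
      · exact Set.mem_iUnion.mpr ⟨false, h⟩)
  obtain ⟨D, hD⟩ : ∃ D : ℝ, ∀ i j, dist (vert n i) (vert n j) ≤ D :=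
    ⟨_, fun i j => Metric.dist_le_diam_of_mem (s := (Set.univ : Set (Splx n)))
      isCompact_univ.isBounded (Set.mem_univ _) (Set.mem_univ _)⟩
  obtain ⟨k, hk⟩ : ∃ k : ℕ, (1 - 1 / (n : ℝ)) ^ k * D < δ := by
    have h1 : 1 - 1 / (n : ℝ) < 1 := by
      have : 0 < 1 / (n : ℝ) := by positivity
      linarith
    have h0 : 0 ≤ 1 - 1 / (n : ℝ) := by
      rw [sub_nonneg, div_le_one (by positivity)]
      exact_mod_cast hn
    have := (tendsto_pow_atTop_nhds_zero_of_lt_one h0 h1).mul_const D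
    rw [zero_mul] at this
    exact (this.eventually (gt_mem_nhds hδ)).exists
  refine ⟨k, ?_⟩
  rw [← tsing_taut, sdiv_iterate_tsing]
  refine Finsupp.map_mem_of_mem_supported _ (fun w hw => ?_)
    (tdiv_iterate_mem hs (Finsupp.single_mem_supported ℤ (1 : ℤ) hD) k)
  rw [tsing_single]
  obtain ⟨b, hb⟩ := hL (w ⟨0, hn⟩) (Set.mem_univ _)
  have hsub : ∀ t, σ.comp (aff hs w) t ∈ (bif b then U else V) := by
    intro t
    refine hb ?_
    have hball : ∀ i, (w i : Fin n → ℝ) ∈ Metric.ball (w ⟨0, hn⟩ : Fin n → ℝ) δ := fun i =>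
      (hw i _).trans_lt hk
    -- All vertices lie in one Lebesgue ball about the first vertex, and by convexity so does the
    -- whole affine simplex.
    exact (convex_ball _ _).sum_mem (fun i _ => t.2.1 i) t.2.2 (fun i _ => hball i)
  cases b with
  | true => exact Submodule.mem_sup_left (single_mem_chainsIn hsub _)
  | false => exact Submodule.mem_sup_right (single_mem_chainsIn hsub _)

lemma exists_sdiv_iterate_mem {n : ℕ} {U V : Set Y} (hU : IsOpen U) (hV : IsOpen V)
    (hUV : U ∪ V = Set.univ) (c : Chain n Y) :
    ∃ k, (sdiv n)^[k] c ∈ chainsIn n U ⊔ chainsIn n V := by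
  induction c using Finsupp.induction_linear with
  | zero => exact ⟨0, Submodule.zero_mem _⟩
  | add a b ha hb =>
    obtain ⟨k, hk⟩ := ha
    obtain ⟨l, hl⟩ := hb
    -- Small chains stay small under further subdivision, so the sum of the two exponents serves
    -- both summands.
    refine ⟨k + l, ?_⟩
    rw [iterate_map_add (sdiv n)]
    refine Submodule.add_mem _ ?_ ?_
    · rw [add_comm, Function.iterate_add_apply]
      exact sdiv_iterate_mem_sup hk l
    · rw [Function.iterate_add_apply]
      exact sdiv_iterate_mem_sup hl k
  | single σ m =>
    obtain ⟨k, hk⟩ := exists_sdiv_iterate_single_mem hU hV hUV σ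
    refine ⟨k, ?_⟩
    have : Finsupp.single σ m = m • Finsupp.single σ 1 := by simp
    rw [this, ← Module.End.pow_apply, map_smul, Module.End.pow_apply]
    exact Submodule.smul_mem _ _ hk

/-- A chain whose boundary is small with respect to an open cover is homologous, relative to the
small chains, to a small chain. -/
theorem exists_sub_bd_mem_sup {n : ℕ} {U V : Set Y} (hU : IsOpen U) (hV : IsOpen V)
    (hUV : U ∪ V = Set.univ) (c : Chain (n + 1) Y)
    (hc : bd n c ∈ chainsIn n U ⊔ chainsIn n V) :
    ∃ d : Chain (n + 2) Y, c - bd (n + 1) d ∈ chainsIn (n + 1) U ⊔ chainsIn (n + 1) V := by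
  obtain ⟨k, hk⟩ := exists_sdiv_iterate_mem hU hV hUV c
  induction k generalizing c with
  | zero => exact ⟨0, by simpa using hk⟩
  | succ k ih =>
    rw [Function.iterate_succ_apply] at hk
    -- One subdivision changes `c` by a boundary and by `sub (bd c)`, which is small because `bd c`
    -- is. Induction on the number of subdivisions then applies to the subdivided chain.
    have e : sdiv (n + 1) c = c - bd (n + 1) (sub (n + 1) c) - sub n (bd n c) := rfl
    have h1 : sub n (bd n c) ∈ chainsIn (n + 1) U ⊔ chainsIn (n + 1) V :=
      map_mem_sup_chainsIn _ (fun _ => sub_mem_chainsIn) (fun _ => sub_mem_chainsIn) hc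
    have h2 : bd n (sdiv (n + 1) c) ∈ chainsIn n U ⊔ chainsIn n V := by
      rw [e, map_sub, map_sub, bd_bd, sub_zero]
      exact Submodule.sub_mem _ hc (map_mem_sup_chainsIn _ (fun _ => bd_mem_chainsIn)
        (fun _ => bd_mem_chainsIn) h1)
    obtain ⟨d, hd⟩ := ih _ h2 hk
    refine ⟨sub (n + 1) c + d, ?_⟩
    have : c - bd (n + 1) (sub (n + 1) c + d) =
        (sdiv (n + 1) c - bd (n + 1) d) + sub n (bd n c) := by
      rw [e, map_add]
      abel
    rw [this]
    exact Submodule.add_mem _ hd h1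

end Subdivision

end SingularChain

namespace SingularChain

/-! ### The prism operator -/

set_option linter.unusedSectionVars false

section Prism

variable {V : Type*} [NormedAddCommGroup V] [NormedSpace ℝ V] {s : Set V} (hs : Convex ℝ s)
variable {V' : Type*} [NormedAddCommGroup V'] [NormedSpace ℝ V'] {s' : Set V'} (hs' : Convex ℝ s')
variable {Y Z : Type*} [TopologicalSpace Y] [TopologicalSpace Z]

/-- The cylinder over a convex set. -/
abbrev cyl (s : Set V) : Set (V × ℝ) := s ×ˢ unitInterval

/-- The horizontal slices of a cylinder. -/
def slice (t : unitInterval) : C(s, cyl s) :=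
  ⟨fun x => ⟨(x.1, t.1), x.2, t.2⟩, by fun_prop⟩

/-- The map between cylinders with a given base map. -/
def cylMap (f : C(s, Y)) : C(cyl s, Y × unitInterval) :=
  ⟨fun x => (f ⟨x.1.1, x.2.1⟩, ⟨x.1.2, x.2.2⟩), by fun_prop⟩

/-- The map between cylinders over convex sets with a given base map. -/
def cylPush (f : C(s, s')) : C(cyl s, cyl s') :=
  ⟨fun x => ⟨((f ⟨x.1.1, x.2.1⟩).1, x.1.2), (f ⟨x.1.1, x.2.1⟩).2, x.2.2⟩, by fun_prop⟩

lemma convex_cyl {s : Set V} (hs : Convex ℝ s) : Convex ℝ (cyl s) :=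
  hs.prod (convex_Icc 0 1)

lemma slice_isAffineMap (t : unitInterval) :
    IsAffineMap hs (convex_cyl hs) (slice (s := s) t) := by
  intro n w x
  apply Subtype.ext
  rw [aff_coe]
  simp only [slice, ContinuousMap.coe_mk, Function.comp_apply, aff_coe]
  refine Prod.ext ?_ ?_
  · simp [Prod.fst_sum]
  · simp only [Prod.snd_sum, Prod.smul_snd, smul_eq_mul, ← Finset.sum_mul]
    rw [x.2.2, one_mul]

lemma cylPush_isAffineMap {f : C(s, s')} (hf : IsAffineMap hs hs' f) :
    IsAffineMap (convex_cyl hs) (convex_cyl hs') (cylPush f) := by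
  intro n w x
  apply Subtype.ext
  rw [aff_coe]
  have h1 : (⟨(aff (convex_cyl hs) w x).1.1, (aff (convex_cyl hs) w x).2.1⟩ : s) =
      aff hs (fun i => ⟨(w i).1.1, (w i).2.1⟩) x := by
    apply Subtype.ext
    change (aff (convex_cyl hs) w x).1.1 = _
    rw [aff_coe, aff_coe, Prod.fst_sum]
    rfl
  simp only [cylPush, ContinuousMap.coe_mk, Function.comp_apply, h1]
  refine Prod.ext ?_ ?_
  · rw [hf, aff_coe]
    simp [Prod.fst_sum]
  · simp [aff_coe, Prod.snd_sum]

/-- The prism operator on formal chains. -/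
noncomputable def tprism : ∀ n : ℕ, TChain n s →ₗ[ℤ] TChain (n + 1) (cyl s)
  | 0 => 0
  | n + 1 => Finsupp.linearCombination ℤ fun w => cone (slice 0 (w 0)) (n + 1)
      (tpush (slice 1) _ (Finsupp.single w 1) - tpush (slice 0) _ (Finsupp.single w 1)
        - tprism n (tbd n (Finsupp.single w 1)))

lemma tprism_single {n : ℕ} (w : Fin (n + 1) → s) :
    tprism (n + 1) (Finsupp.single w 1) = cone (slice 0 (w 0)) (n + 1)
      (tpush (slice 1) _ (Finsupp.single w 1) - tpush (slice 0) _ (Finsupp.single w 1)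
        - tprism n (tbd n (Finsupp.single w 1))) := by
  rw [tprism, Finsupp.linearCombination_single, one_smul]

lemma tbd_tprism_zero (c : TChain 0 s) :
    tbd 0 (tprism 0 c) = tpush (slice 1) 0 c - tpush (slice 0) 0 c := by
  induction c using Finsupp.induction_linear with
  | zero => simp
  | add a b ha hb => simp only [map_add, ha, hb]; abel
  | single w m =>
    simp only [tprism, LinearMap.zero_apply, map_zero, tpush_single]
    rw [Subsingleton.elim (slice 1 ∘ w) (slice 0 ∘ w), sub_self]

/-- The base of the cone in the recursion is top minus bottom minus the prism on the boundary. By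
induction it is a cycle, so the boundary of the cone is the base itself. -/
lemma tbd_tprism {n : ℕ} (c : TChain (n + 1) s) :
    tbd (n + 1) (tprism (n + 1) c) =
      tpush (slice 1) _ c - tpush (slice 0) _ c - tprism n (tbd n c) := by
  induction n with
  | zero =>
    induction c using Finsupp.induction_linear with
    | zero => simp
    | add a b ha hb => simp only [map_add, ha, hb]; abel
    | single w m =>
      have : Finsupp.single w m = m • Finsupp.single w 1 := by simp
      rw [this]
      simp only [map_smul, ← smul_sub]
      rw [tprism_single, tbd_cone]
      simp only [map_sub, tbd_tpush, tbd_tprism_zero]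
      simp
  | succ n ih =>
    induction c using Finsupp.induction_linear with
    | zero => simp
    | add a b ha hb => simp only [map_add, ha, hb]; abel
    | single w m =>
      have : Finsupp.single w m = m • Finsupp.single w 1 := by simp
      rw [this]
      simp only [map_smul, ← smul_sub]
      rw [tprism_single, tbd_cone]
      simp only [map_sub, tbd_tpush, ih, tbd_tbd]
      simp

-- The apex is a vertex of the bottom face rather than a barycentre, so no affineness is required
-- here.
variable {hs hs'} in
lemma tprism_tpush (f : C(s, s')) {n : ℕ} (c : TChain n s) :
    tprism n (tpush f n c) = tpush (cylPush f) (n + 1) (tprism n c) := by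
  induction n with
  | zero => simp [tprism]
  | succ n ih =>
    induction c using Finsupp.induction_linear with
    | zero => simp
    | add a b ha hb => simp [ha, hb]
    | single w m =>
      have : Finsupp.single w m = m • Finsupp.single w 1 := by simp
      rw [this]
      simp only [map_smul]
      rw [tprism_single, tpush_cone, map_sub (tpush (cylPush f) (n + 1)), ← ih, ← tbd_tpush,
        tpush_single, tprism_single, map_sub (tpush (cylPush f) (n + 1))]
      simp only [tpush_single]
      rfl

/-- The prism operator of a homotopy on singular chains. -/
noncomputable def prism (h : C(Y × unitInterval, Z)) (n : ℕ) : Chain n Y →ₗ[ℤ] Chain (n + 1) Z :=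
  Finsupp.linearCombination ℤ fun σ => tsing (convex_cyl (convex_stdSimplex ℝ (Fin n)))
    (h.comp (cylMap σ)) (n + 1) (tprism n (taut n))

lemma prism_single (h : C(Y × unitInterval, Z)) {n : ℕ} (σ : C(Splx n, Y)) :
    prism h n (Finsupp.single σ 1) = tsing (convex_cyl (convex_stdSimplex ℝ (Fin n)))
    (h.comp (cylMap σ)) (n + 1) (tprism n (taut n)) := by
  rw [prism, Finsupp.linearCombination_single, one_smul]

lemma prism_tsing (h : C(Y × unitInterval, Z)) (g : C(s, Y)) {n : ℕ} (c : TChain n s) :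
    prism h n (tsing hs g n c) =
      tsing (convex_cyl hs) (h.comp (cylMap g)) (n + 1) (tprism n c) := by
  induction c using Finsupp.induction_linear with
  | zero => simp
  | add a b ha hb => simp [ha, hb]
  | single w m =>
    have : Finsupp.single w m = m • Finsupp.single w 1 := by simp
    rw [this]
    simp only [map_smul]
    rw [tsing_single, prism_single, ← tpush_aff_taut hs w, tprism_tpush,
      tsing_tpush _ _ (cylPush_isAffineMap _ _ (aff_isAffineMap hs w))]
    rfl

/-- The time slices of a homotopy. -/
def atTime (h : C(Y × unitInterval, Z)) (t : unitInterval) : C(Y, Z) :=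
  ⟨fun y => h (y, t), by fun_prop⟩

lemma bd_prism (h : C(Y × unitInterval, Z)) {n : ℕ} (c : Chain (n + 1) Y) :
    bd (n + 1) (prism h (n + 1) c) =
      push (atTime h 1) _ c - push (atTime h 0) _ c - prism h n (bd n c) := by
  induction c using Finsupp.induction_linear with
  | zero => simp
  | add a b ha hb => simp only [map_add, ha, hb]; abel
  | single σ m =>
    have : Finsupp.single σ m = m • Finsupp.single σ 1 := by simp
    rw [this]
    simp only [map_smul, ← smul_sub]
    congr 1
    have hb : ∀ c : TChain (n + 1) (Splx (n + 1)), ∀ t, tsing (convex_cyl (convex_stdSimplex ℝ _))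
        (h.comp (cylMap σ)) _ (tpush (slice t) _ c) =
        push (atTime h t) _ (tsing (convex_stdSimplex ℝ _) σ _ c) := fun c t => by
      rw [tsing_tpush _ _ (slice_isAffineMap (convex_stdSimplex ℝ _) t), push_tsing]
      rfl
    rw [prism_single, bd_tsing, tbd_tprism, map_sub, map_sub, ← prism_tsing, ← bd_tsing, hb, hb,
      tsing_taut]
    exact convex_stdSimplex ℝ _

lemma prism_mem_chainsIn (h : C(Y × unitInterval, Z)) {n : ℕ} {A : Set Y} {B : Set Z}
    (hAB : ∀ a ∈ A, ∀ t, h (a, t) ∈ B) {c : Chain n Y} (hc : c ∈ chainsIn n A) :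
    prism h n c ∈ chainsIn (n + 1) B := by
  refine Finsupp.map_mem_of_mem_supported _ (fun σ hσ => ?_) hc
  rw [prism_single]
  exact tsing_mem_chainsIn _ _ (fun x => hAB _ (hσ _) _) _

/-- If `Y` can be deformed into `A`, keeping `A` in `A`, then the relative homology vanishes. -/
lemma exists_sub_bd_mem_of_deformation {A : Set Y} (h : C(Y × unitInterval, Y))
    (h0 : ∀ y, h (y, 0) = y) (h1 : ∀ y, h (y, 1) ∈ A) (hA : ∀ a ∈ A, ∀ t, h (a, t) ∈ A)
    {n : ℕ} (c : Chain (n + 1) Y) (hc : bd n c ∈ chainsIn n A) :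
    ∃ d, c - bd (n + 1) d ∈ chainsIn (n + 1) A := by
  refine ⟨- prism h (n + 1) c, ?_⟩
  have e0 : atTime h 0 = ContinuousMap.id Y := by ext y; exact h0 y
  rw [map_neg, bd_prism, e0, push_id]
  have : c - -(push (atTime h 1) (n + 1) c - c - prism h n (bd n c)) =
    push (atTime h 1) (n + 1) c - prism h n (bd n c) := by abel
  rw [this]
  exact Submodule.sub_mem _ (push_mem_chainsIn (fun y _ => h1 y) (mem_chainsIn_univ c))
    (prism_mem_chainsIn h hA hc)

/-- A point carries one simplex in each degree, and the alternating sum of its equal faces is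
alternately 0 and 1. So a cycle is either a boundary of the next constant simplex or zero. -/
lemma exists_bd_eq_of_mem_chainsIn_singleton {n : ℕ} (y : Y) (c : Chain (n + 1) Y)
    (hc : c ∈ chainsIn (n + 1) {y}) (h : bd n c = 0) : ∃ d, bd (n + 1) d = c := by
  have hb : ∀ n : ℕ, bd n (Finsupp.single (ContinuousMap.const (Splx (n + 1)) y) 1) =
      (if Even (n + 1) then (0 : ℤ) else 1) •
        Finsupp.single (ContinuousMap.const (Splx n) y) 1 := by
    intro n
    rw [bd_single, ← Fin.sum_neg_one_pow, Finset.sum_smul]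
    rfl
  obtain ⟨m, rfl⟩ : ∃ m : ℤ, c = m • Finsupp.single (ContinuousMap.const (Splx (n + 1)) y) 1 := by
    rw [chainsIn, show {σ : C(Splx (n + 1), Y) | ∀ t, σ t ∈ ({y} : Set Y)} =
      {ContinuousMap.const (Splx (n + 1)) y} by ext σ; simp [ContinuousMap.ext_iff],
      Finsupp.supported_eq_span_single, Set.image_singleton, Submodule.mem_span_singleton] at hc
    exact hc.imp fun _ h => h.symm
  by_cases he : Even (n + 1)
  · refine ⟨m • Finsupp.single (ContinuousMap.const (Splx (n + 2)) y) 1, ?_⟩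
    rw [map_smul, hb, if_neg (by rw [Nat.even_add_one]; simpa using he), one_smul]
  · rw [map_smul, hb, if_neg he, one_smul] at h
    have hm : m = 0 := by simpa using h
    exact ⟨0, by simp [hm]⟩

/-- The augmented singular chain complex of a contractible space is exact. -/
lemma exists_bd_eq_of_contractible [ContractibleSpace Y] {n : ℕ} (c : Chain (n + 1) Y)
    (hc : bd n c = 0) : ∃ d, bd (n + 1) d = c := by
  obtain ⟨y, ⟨H⟩⟩ := id_nullhomotopic Y
  let h : C(Y × unitInterval, Y) := H.toContinuousMap.comp ⟨Prod.swap, continuous_swap⟩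
  have e0 : atTime h 0 = ContinuousMap.id Y := by ext y; exact H.apply_zero y
  have e1 : atTime h 1 = ContinuousMap.const Y y := by ext y; exact H.apply_one y
  have key := bd_prism h c
  rw [e0, e1, push_id, hc, map_zero, sub_zero] at key
  obtain ⟨d, hd⟩ := exists_bd_eq_of_mem_chainsIn_singleton y
    (push (ContinuousMap.const Y y) (n + 1) c)
    (push_mem_chainsIn (U := Set.univ) (fun _ _ => rfl) (mem_chainsIn_univ c))
    (by rw [bd_push, hc, map_zero])
  exact ⟨d - prism h (n + 1) c, by rw [map_sub, key, hd]; abel⟩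

end Prism

/-! ### Relative homeomorphisms -/

section RelHomeo

variable {Y Z : Type*} [TopologicalSpace Y] [TopologicalSpace Z]

/-- Injectivity on `S` rules out cancellation, so every simplex of `c` is visible in its image. -/
lemma mem_chainsIn_of_push {f : C(Z, Y)} {S : Set Z} (hf : Set.InjOn f S) {n : ℕ} {c : Chain n Z}
    (hc : c ∈ chainsIn n S) {U : Set Y} (h : push f n c ∈ chainsIn n U) :
    c ∈ chainsIn n (f ⁻¹' U) := by
  classical
  rw [chainsIn, Finsupp.mem_supported] at hc h ⊢
  intro σ hσ t
  have hinj : Set.InjOn (fun σ : C(Splx n, Z) => f.comp σ) c.support := by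
    intro σ hσ τ hτ e
    ext x
    exact hf (hc hσ x) (hc hτ x) (DFunLike.congr_fun e x)
  have : f.comp σ ∈ (push f n c).support := by
    rw [push, Finsupp.lmapDomain_apply, Finsupp.mapDomain_support_of_injOn _ hinj]
    exact Finset.mem_image_of_mem _ hσ
  exact h this t

/-- Lifting of chains along a map with a continuous section over a subset. -/
lemma exists_push_eq {f : C(Z, Y)} {S : Set Z} {U : Set Y} (g : U → Z) (hg : Continuous g)
    (hgS : ∀ x, g x ∈ S) (hfg : ∀ x, f (g x) = x) {n : ℕ} {c : Chain n Y} (hc : c ∈ chainsIn n U) :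
    ∃ d ∈ chainsIn n S, push f n d = c := by
  have : chainsIn n U ≤ (chainsIn n S).map (push f n) := by
    rw [chainsIn, Finsupp.supported_eq_span_single, Submodule.span_le]
    rintro _ ⟨σ, hσ, rfl⟩
    refine ⟨Finsupp.single ⟨fun t => g ⟨σ t, hσ t⟩, by fun_prop⟩ 1,
      single_mem_chainsIn (fun t => hgS _) _, ?_⟩
    rw [push_single]
    congr 1
    ext t
    exact hfg _
  exact this hc

/-- The inclusion of a subset. -/
def inclSet (U : Set Y) : C(U, Y) := ⟨Subtype.val, continuous_subtype_val⟩

lemma exists_push_inclSet {U : Set Y} {n : ℕ} {c : Chain n Y} (hc : c ∈ chainsIn n U) :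
    ∃ d : Chain n U, push (inclSet U) n d = c := by
  obtain ⟨d, -, hd⟩ := exists_push_eq (f := inclSet U) (S := Set.univ) (fun x : U => x)
    continuous_id (fun _ => Set.mem_univ _) (fun _ => rfl) hc
  exact ⟨d, hd⟩

/-- A neighbourhood `V` of `A` together with a deformation of `V` onto `A` relative to `A`. -/
structure NbhdDeformation (A V : Set Y) where
  isOpen : IsOpen V
  subset : A ⊆ V
  homotopy : C(V × unitInterval, V)
  map_zero : ∀ x, homotopy (x, 0) = x
  map_one : ∀ x, (homotopy (x, 1) : Y) ∈ A
  map_of_mem : ∀ x : V, (x : Y) ∈ A → ∀ t, homotopy (x, t) = x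

lemma NbhdDeformation.exists_sub_bd_mem {A V : Set Y} (h : NbhdDeformation A V) {n : ℕ}
    {c : Chain (n + 1) Y} (hc : c ∈ chainsIn (n + 1) V) (hb : bd n c ∈ chainsIn n A) :
    ∃ d ∈ chainsIn (n + 2) V, c - bd (n + 1) d ∈ chainsIn (n + 1) A := by
  obtain ⟨c, rfl⟩ := exists_push_inclSet hc
  rw [bd_push] at hb
  obtain ⟨d, hd⟩ := exists_sub_bd_mem_of_deformation (A := inclSet V ⁻¹' A) h.homotopy h.map_zero
    h.map_one (fun a ha t => by rw [h.map_of_mem a ha]; exact ha) c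
    (mem_chainsIn_of_push (S := Set.univ) Subtype.val_injective.injOn (mem_chainsIn_univ _) hb)
  refine ⟨push (inclSet V) _ d, push_mem_chainsIn (U := Set.univ) (fun x _ => x.2)
    (mem_chainsIn_univ d), ?_⟩
  rw [bd_push, ← map_sub]
  exact push_mem_chainsIn (fun _ h => h) hd

/-- The simplex with no vertices is empty, so support conditions are vacuous in the augmentation
degree. Hence every chain of points is a relative cycle, even relative to the empty set. -/
lemma mem_chainsIn_zero {A : Set Y} (c : Chain 0 Y) : c ∈ chainsIn 0 A :=
  (Finsupp.mem_supported _ _).mpr fun _ _ t => by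
    have := t.2.2
    simp at this

lemma NbhdDeformation.exists_bd_sub_bd_mem {A V : Set Y} (h : NbhdDeformation A V) {n : ℕ}
    {c : Chain (n + 1) Y} (hc : bd n c ∈ chainsIn n V) :
    ∃ d ∈ chainsIn (n + 1) V, bd n c - bd n d ∈ chainsIn n A := by
  cases n with
  | zero => exact ⟨0, Submodule.zero_mem _, mem_chainsIn_zero _⟩
  | succ n => exact h.exists_sub_bd_mem hc (by rw [bd_bd]; exact Submodule.zero_mem _)

/-! ### Excision for relative homeomorphisms -/

/-- A relative homeomorphism `(Z, W) → (Y, A)` such that `Y` carries the quotient topology of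
`Z ⊔ A`. -/
structure IsRelHomeo (f : C(Z, Y)) (W : Set Z) (A : Set Y) : Prop where
  isClosed : IsClosed A
  mapsTo : Set.MapsTo f W A
  mapsTo_compl : Set.MapsTo f Wᶜ Aᶜ
  injOn : Set.InjOn f Wᶜ
  surjOn : Set.SurjOn f Wᶜ Aᶜ
  isClosed_of : ∀ C : Set Y, IsClosed (C ∩ A) → IsClosed (f ⁻¹' C) → IsClosed C

namespace IsRelHomeo

variable {f : C(Z, Y)} {W : Set Z} {A : Set Y} (hf : IsRelHomeo f W A)
include hf

lemma mem_iff (z : Z) : f z ∈ A ↔ z ∈ W :=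
  ⟨fun h => by_contra fun hz => hf.mapsTo_compl hz h, fun h => hf.mapsTo h⟩

lemma preimage_union_image {V : Set Z} (hV : W ⊆ V) : f ⁻¹' (A ∪ f '' V) = V := by
  ext z
  constructor
  · rintro (h | ⟨z', hz', e⟩)
    · exact hV ((hf.mem_iff z).mp h)
    · by_cases hz : z ∈ W
      · exact hV hz
      · have : z' ∉ W := fun h => hz ((hf.mem_iff z).mp (e ▸ hf.mapsTo h))
        exact hf.injOn this hz e ▸ hz'
  · exact fun h => Or.inr ⟨z, h, rfl⟩

lemma isClosed_isRelHomeo : IsClosed W := by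
  have : f ⁻¹' A = W := Set.ext hf.mem_iff
  exact this ▸ hf.isClosed.preimage f.continuous

lemma isOpen_of {C : Set Y} (h : IsClosed (Cᶜ ∩ A)) (h' : IsOpen (f ⁻¹' C)) : IsOpen C :=
  isClosed_compl_iff.mp (hf.isClosed_of _ h (by rwa [Set.preimage_compl, isClosed_compl_iff]))

lemma isOpen_union_image {V : Set Z} (hV : W ⊆ V) (hVo : IsOpen V) : IsOpen (A ∪ f '' V) := by
  refine hf.isOpen_of ?_ (by rwa [hf.preimage_union_image hV])
  convert isClosed_empty
  ext y
  simp only [Set.mem_inter_iff, Set.mem_compl_iff, Set.mem_union, Set.mem_empty_iff_false]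
  tauto

omit hf in
open Classical in
/-- The paths of the deformation induced on the target of a relative homeomorphism. -/
noncomputable def targetPath {V : Set Z} (h : NbhdDeformation W V) (f : C(Z, Y)) (A : Set Y)
    (y : ↥(A ∪ f '' V)) : C(unitInterval, ↥(A ∪ f '' V)) :=
  if hy : ∃ z : V, f z = y then
    ⟨fun t => ⟨f (h.homotopy (hy.choose, t)), Or.inr ⟨_, (h.homotopy (hy.choose, t)).2, rfl⟩⟩,
      by fun_prop⟩
  else ContinuousMap.const _ y

/-- The path does not depend on the chosen preimage: off `W` the map is injective, and on `W` the
deformation is stationary. -/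
lemma targetPath_apply {V : Set Z} (h : NbhdDeformation W V) (z : V) (t : unitInterval) :
    (targetPath h f A ⟨f z, Or.inr ⟨_, z.2, rfl⟩⟩ t : Y) = f (h.homotopy (z, t)) := by
  have hy : ∃ z' : V, f z' = f z := ⟨z, rfl⟩
  rw [targetPath, dif_pos hy]
  change f (h.homotopy (hy.choose, t)) = _
  have e := hy.choose_spec
  generalize hy.choose = z' at e
  by_cases hz : (z : Z) ∈ W
  · have hz' : (z' : Z) ∈ W := (hf.mem_iff _).mp (e ▸ hf.mapsTo hz)
    rw [h.map_of_mem _ hz, h.map_of_mem _ hz', e]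
  · have hz' : (z' : Z) ∉ W := fun h' => hz ((hf.mem_iff _).mp (e ▸ hf.mapsTo h'))
    rw [Subtype.ext (hf.injOn hz' hz e)]

lemma targetPath_of_mem {V : Set Z} (h : NbhdDeformation W V) (y : ↥(A ∪ f '' V))
    (hy : (y : Y) ∈ A) : targetPath h f A y = ContinuousMap.const _ y := by
  ext t
  by_cases hz : ∃ z : V, f z = y
  · obtain ⟨z, hz⟩ := hz
    obtain rfl : y = ⟨f z, Or.inr ⟨_, z.2, rfl⟩⟩ := Subtype.ext hz.symm
    rw [hf.targetPath_apply h z t, h.map_of_mem _ ((hf.mem_iff _).mp hy)]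
    rfl
  · rw [targetPath, dif_neg hz]

/-- Currying to the path space lets the quotient topology be tested separately on `A`, where paths
are constant, and on `Z`, where the map is the curried deformation. No statement about a product of
a quotient map with the interval is needed. -/
lemma continuous_targetPath {V : Set Z} (h : NbhdDeformation W V) :
    Continuous (targetPath h f A) := by
  rw [continuous_def]
  intro U hU
  have hsub := h.subset
  rw [(hf.isOpen_union_image hsub h.isOpen).isOpenEmbedding_subtypeVal.isOpen_iff_image_isOpen]
  refine hf.isOpen_of ?_ ?_
  · let q : A → C(unitInterval, ↥(A ∪ f '' V)) := fun a => ContinuousMap.const _ ⟨a, Or.inl a.2⟩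
    have hq : Continuous q := ContinuousMap.continuous_const'.comp (by fun_prop)
    have h2 := hf.isClosed.isClosedEmbedding_subtypeVal.isClosedMap _ (hU.preimage hq).isClosed_compl
    convert h2 using 1
    ext y
    constructor
    · rintro ⟨hy, hyA⟩
      refine ⟨⟨y, hyA⟩, fun hm => hy ⟨⟨y, Or.inl hyA⟩, ?_, rfl⟩, rfl⟩
      rw [Set.mem_preimage, hf.targetPath_of_mem h _ hyA]
      exact hm
    · rintro ⟨⟨a, ha⟩, hm, rfl⟩
      refine ⟨?_, ha⟩
      rintro ⟨⟨y, hy⟩, hy', rfl⟩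
      rw [Set.mem_preimage, hf.targetPath_of_mem h _ ha] at hy'
      exact hm hy'
  · let F : C(V × unitInterval, ↥(A ∪ f '' V)) :=
      ⟨fun x => ⟨f (h.homotopy x), Or.inr ⟨_, (h.homotopy x).2, rfl⟩⟩, by fun_prop⟩
    have h2 := h.isOpen.isOpenEmbedding_subtypeVal.isOpenMap _ (hU.preimage F.curry.continuous)
    have hc : ∀ z : V, F.curry z = targetPath h f A ⟨f z, Or.inr ⟨_, z.2, rfl⟩⟩ := fun z => by
      ext t
      rw [hf.targetPath_apply h z t]
      rfl
    convert h2 using 1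
    ext z
    constructor
    · rintro ⟨⟨y, hy⟩, hy', e⟩
      change y = f z at e
      subst e
      have hz : z ∈ V := by
        rw [← hf.preimage_union_image hsub]
        exact hy
      refine ⟨⟨z, hz⟩, ?_, rfl⟩
      rw [Set.mem_preimage, hc]
      exact hy'
    · rintro ⟨z, hz, rfl⟩
      rw [Set.mem_preimage, hc] at hz
      exact ⟨_, hz, rfl⟩

/-- A deformation of a neighbourhood of `W` induces one of a neighbourhood of `A`. -/
noncomputable def nbhdDeformation {V : Set Z} (h : NbhdDeformation W V) :
    NbhdDeformation A (A ∪ f '' V) where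
  isOpen := hf.isOpen_union_image h.subset h.isOpen
  subset := Set.subset_union_left
  homotopy := ⟨fun x => targetPath h f A x.1 x.2, by
    have := hf.continuous_targetPath h
    fun_prop⟩
  map_zero := by
    rintro ⟨y, hy | ⟨z, hz, rfl⟩⟩
    · change targetPath h f A _ _ = _
      rw [hf.targetPath_of_mem h _ hy]
      rfl
    · exact Subtype.ext ((hf.targetPath_apply h ⟨z, hz⟩ 0).trans (by rw [h.map_zero]))
  map_one := by
    rintro ⟨y, hy | ⟨z, hz, rfl⟩⟩
    · change (targetPath h f A _ _ : Y) ∈ _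
      rw [hf.targetPath_of_mem h _ hy]
      exact hy
    · change (targetPath h f A _ _ : Y) ∈ _
      rw [hf.targetPath_apply h ⟨z, hz⟩ 1]
      exact hf.mapsTo (h.map_one _)
  map_of_mem := by
    intro y hy t
    change targetPath h f A _ _ = _
    rw [hf.targetPath_of_mem h _ hy]
    rfl

/-- The set-theoretic inverse off `A` is continuous because `f` maps an open subset of `Wᶜ` to a set
whose complement contains `A` and whose preimage is that open subset. -/
lemma exists_section : ∃ g : (Aᶜ : Set Y) → Z, Continuous g ∧ (∀ x, g x ∈ Wᶜ) ∧
    ∀ x, f (g x) = x := by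
  choose g hg hfg using fun x : (Aᶜ : Set Y) => hf.surjOn x.2
  refine ⟨g, ?_, hg, hfg⟩
  rw [continuous_def]
  intro U hU
  have hAo : IsOpen (Aᶜ : Set Y) := hf.isClosed.isOpen_compl
  rw [hAo.isOpenEmbedding_subtypeVal.isOpen_iff_image_isOpen]
  have e : Subtype.val '' (g ⁻¹' U) = f '' (U ∩ Wᶜ) := by
    ext y
    constructor
    · rintro ⟨x, hx, rfl⟩
      exact ⟨g x, ⟨hx, hg x⟩, hfg x⟩
    · rintro ⟨z, ⟨hz, hzW⟩, rfl⟩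
      refine ⟨⟨f z, hf.mapsTo_compl hzW⟩, ?_, rfl⟩
      rw [Set.mem_preimage, hf.injOn (hg _) hzW (hfg _)]
      exact hz
  rw [e]
  refine hf.isOpen_of ?_ ?_
  · convert hf.isClosed using 1
    rw [Set.inter_eq_right]
    rintro y hy ⟨z, ⟨-, hz⟩, rfl⟩
    exact hf.mapsTo_compl hz hy
  · convert hU.inter hf.isClosed_isRelHomeo.isOpen_compl using 1
    ext z
    constructor
    · rintro ⟨z', ⟨hz', hzW'⟩, e⟩
      have : z ∉ W := fun h => hf.mapsTo_compl hzW' (e ▸ hf.mapsTo h)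
      exact hf.injOn hzW' this e ▸ ⟨hz', hzW'⟩
    · exact fun h => ⟨z, h, rfl⟩

/-- Surjectivity of a relative homeomorphism on relative homology. -/
theorem exists_push_sub_mem {V : Set Z} (h : NbhdDeformation W V) {n : ℕ} (c : Chain (n + 1) Y)
    (hc : bd n c ∈ chainsIn n A) :
    ∃ x : Chain (n + 1) Z, bd n x ∈ chainsIn n W ∧
      ∃ d, c - push f _ x - bd (n + 1) d ∈ chainsIn (n + 1) A := by
  have hY := hf.nbhdDeformation h
  obtain ⟨g, hgc, hgW, hfg⟩ := hf.exists_section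
  -- Modulo a boundary, `c` is the sum of a chain `v` near `A` and a chain `u` off `A`; the latter
  -- lifts to `Z`.
  obtain ⟨d, hd⟩ := exists_sub_bd_mem_sup hY.isOpen hf.isClosed.isOpen_compl
    (by ext y; simp only [Set.mem_union, Set.mem_compl_iff, Set.mem_univ]; tauto) c
    (Submodule.mem_sup_left (chainsIn_mono hY.subset hc))
  obtain ⟨v, hv, u, hu, e⟩ := Submodule.mem_sup.mp hd
  obtain ⟨u', hu', rfl⟩ := exists_push_eq g hgc hgW hfg hu
  have h1 : bd n (push f _ u') ∈ chainsIn n (A ∪ f '' V) := by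
    have : bd n (push f _ u') = bd n c - bd n v := by
      rw [eq_sub_iff_add_eq', ← map_add, e, map_sub, bd_bd, sub_zero]
    rw [this]
    exact Submodule.sub_mem _ (chainsIn_mono hY.subset hc) (bd_mem_chainsIn hv)
  have h2 : bd n u' ∈ chainsIn n V := by
    have := mem_chainsIn_of_push hf.injOn (bd_mem_chainsIn hu') (by rwa [← bd_push])
    rwa [hf.preimage_union_image h.subset] at this
  -- The boundary of the lift lies only in `V`; a correction inside `V` moves it into `W`. The error
  -- this creates is near `A` and is absorbed by deforming the neighbourhood.
  obtain ⟨v', hv', hw'⟩ := h.exists_bd_sub_bd_mem h2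
  refine ⟨u' - v', by rwa [map_sub], ?_⟩
  obtain ⟨d', -, hd'⟩ := hY.exists_sub_bd_mem (c := v + push f _ v')
    (Submodule.add_mem _ hv (push_mem_chainsIn (fun z hz => Set.mem_union_right A (Set.mem_image_of_mem f hz)) hv')) (by
      have : bd n (v + push f _ v') = bd n c - push f _ (bd n (u' - v')) := by
        rw [← bd_push, map_add, map_sub (push f _), map_sub (bd n), sub_sub_eq_add_sub,
          eq_sub_iff_add_eq, add_right_comm, ← map_add, e, map_sub, bd_bd, sub_zero]
      rw [this]
      exact Submodule.sub_mem _ hc (push_mem_chainsIn hf.mapsTo (by rwa [map_sub])))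
  refine ⟨d + d', ?_⟩
  convert hd' using 1
  have : c = v + push f _ u' + bd _ d := by rw [e]; abel
  rw [this, map_sub, map_add]
  abel

/-- Injectivity of a relative homeomorphism on relative homology. -/
theorem exists_sub_bd_mem_of_push {V : Set Z} (h : NbhdDeformation W V) {n : ℕ}
    (x : Chain (n + 1) Z) (hx : bd n x ∈ chainsIn n W) (y : Chain (n + 2) Y)
    (hy : push f _ x - bd (n + 1) y ∈ chainsIn (n + 1) A) :
    ∃ d, x - bd (n + 1) d ∈ chainsIn (n + 1) W := by
  have hY := hf.nbhdDeformation h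
  obtain ⟨g, hgc, hgW, hfg⟩ := hf.exists_section
  obtain ⟨d, hd⟩ := exists_sub_bd_mem_sup h.isOpen hf.isClosed_isRelHomeo.isOpen_compl
    (by
      ext z
      have := @h.subset z
      simp only [Set.mem_union, Set.mem_compl_iff, Set.mem_univ]
      tauto) x
    (Submodule.mem_sup_left (chainsIn_mono h.subset hx))
  obtain ⟨v, hv, w, hw, e⟩ := Submodule.mem_sup.mp hd
  have hfv : push f _ v ∈ chainsIn (n + 1) (A ∪ f '' V) :=
    push_mem_chainsIn (fun z hz => Set.mem_union_right A (Set.mem_image_of_mem f hz)) hv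
  -- The bounding chain, corrected by the image of `d`, has small boundary, so it too splits. Its
  -- part off `A` lifts to `u1`, and then `w - bd u1` lies in `V`, where the deformation finishes
  -- the argument.
  obtain ⟨d', hd'⟩ := exists_sub_bd_mem_sup hY.isOpen hf.isClosed.isOpen_compl
    (by ext y; simp only [Set.mem_union, Set.mem_compl_iff, Set.mem_univ]; tauto)
    (y - push f _ d) (by
      have : bd (n + 1) (y - push f _ d) =
          (push f _ v - (push f _ x - bd (n + 1) y)) + push f _ w := by
        have e' : x = v + w + bd _ d := by rw [e]; abel
        rw [e', map_sub, bd_push, map_add, map_add]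
        abel
      rw [this]
      exact Submodule.add_mem_sup (Submodule.sub_mem _ hfv (chainsIn_mono hY.subset hy))
        (push_mem_chainsIn hf.mapsTo_compl hw))
  obtain ⟨v1, hv1, u1, hu1, e1⟩ := Submodule.mem_sup.mp hd'
  obtain ⟨u1, hu1', rfl⟩ := exists_push_eq g hgc hgW hfg hu1
  have hwm : w - bd (n + 1) u1 ∈ chainsIn (n + 1) Wᶜ :=
    Submodule.sub_mem _ hw (bd_mem_chainsIn hu1')
  have h1 : w - bd (n + 1) u1 ∈ chainsIn (n + 1) V := by
    have := mem_chainsIn_of_push hf.injOn hwm (U := A ∪ f '' V) (by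
      have : push f _ (w - bd (n + 1) u1) =
          (push f _ x - bd (n + 1) y) - push f _ v + bd (n + 1) v1 := by
        have e' : x = v + w + bd _ d := by rw [e]; abel
        have e1' : y = v1 + push f _ u1 + bd _ d' + push f _ d := by rw [e1]; abel
        rw [e', e1']
        simp only [map_add, map_sub, bd_bd, ← bd_push]
        abel
      rw [this]
      exact Submodule.add_mem _ (Submodule.sub_mem _ (chainsIn_mono hY.subset hy) hfv)
        (bd_mem_chainsIn hv1))
    rwa [hf.preimage_union_image h.subset] at this
  obtain ⟨d2, -, hd2⟩ := h.exists_sub_bd_mem (c := x - bd (n + 1) (d + u1)) (by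
      have : x - bd (n + 1) (d + u1) = v + (w - bd (n + 1) u1) := by
        have e' : x = v + w + bd _ d := by rw [e]; abel
        rw [e', map_add]
        abel
      rw [this]
      exact Submodule.add_mem _ hv h1) (by rwa [map_sub, bd_bd, sub_zero])
  exact ⟨d + u1 + d2, by rwa [map_add, ← sub_sub]⟩

end IsRelHomeo

end RelHomeo

end SingularChain

namespace SingularChain

/-! ### Relative homology: acyclicity and bases -/

section RelBasis

variable {Y Z : Type*} [TopologicalSpace Y] [TopologicalSpace Z] {E : Type*}

/-- The relative homology of `(Y, A)` vanishes in degree `q`. -/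
def RelAcyclic (A : Set Y) (q : ℕ) : Prop :=
  ∀ c : Chain (q + 1) Y, bd q c ∈ chainsIn q A → ∃ d, c - bd (q + 1) d ∈ chainsIn (q + 1) A

/-- The classes of the chains `γ e` form a basis of the relative homology of `(Y, A)` in
degree `q`. -/
structure IsRelBasis (A : Set Y) (q : ℕ) (γ : E → Chain (q + 1) Y) : Prop where
  bd_mem : ∀ e, bd q (γ e) ∈ chainsIn q A
  exists_sub : ∀ c : Chain (q + 1) Y, bd q c ∈ chainsIn q A → ∃ (m : E →₀ ℤ) (d : _),
    c - Finsupp.linearCombination ℤ γ m - bd (q + 1) d ∈ chainsIn (q + 1) A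
  eq_zero : ∀ (m : E →₀ ℤ) (d : _),
    Finsupp.linearCombination ℤ γ m - bd (q + 1) d ∈ chainsIn (q + 1) A → m = 0

lemma bd_linearCombination_mem {A : Set Y} {q : ℕ} {γ : E → Chain (q + 1) Y}
    (h : ∀ e, bd q (γ e) ∈ chainsIn q A) (m : E →₀ ℤ) :
    bd q (Finsupp.linearCombination ℤ γ m) ∈ chainsIn q A := by
  rw [Finsupp.linearCombination_apply, Finsupp.sum, map_sum]
  exact Submodule.sum_mem _ fun e _ => by
    rw [map_smul]
    exact Submodule.smul_mem _ _ (h e)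

namespace IsRelHomeo

variable {f : C(Z, Y)} {W : Set Z} {A : Set Y} (hf : IsRelHomeo f W A)
include hf

lemma relAcyclic {V : Set Z} (h : NbhdDeformation W V) {q : ℕ} (hW : RelAcyclic W q) :
    RelAcyclic A q := by
  intro c hc
  obtain ⟨x, hx, d, hd⟩ := hf.exists_push_sub_mem h c hc
  obtain ⟨y, hy⟩ := hW x hx
  refine ⟨d + push f _ y, ?_⟩
  have : c - bd (q + 1) (d + push f _ y) =
      (c - push f _ x - bd (q + 1) d) + push f _ (x - bd (q + 1) y) := by
    rw [map_add, bd_push, map_sub]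
    abel
  rw [this]
  exact Submodule.add_mem _ hd (push_mem_chainsIn hf.mapsTo hy)

lemma isRelBasis {V : Set Z} (h : NbhdDeformation W V) {q : ℕ} {γ : E → Chain (q + 1) Z}
    (hγ : IsRelBasis W q γ) : IsRelBasis A q (fun e => push f _ (γ e)) := by
  have hl : ∀ m : E →₀ ℤ, Finsupp.linearCombination ℤ (fun e => push f _ (γ e)) m =
      push f _ (Finsupp.linearCombination ℤ γ m) := fun m =>
    (Finsupp.apply_linearCombination ℤ (push f (q + 1)) γ m).symm
  refine ⟨fun e => ?_, fun c hc => ?_, fun m d hd => ?_⟩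
  · rw [bd_push]
    exact push_mem_chainsIn hf.mapsTo (hγ.bd_mem e)
  · obtain ⟨x, hx, d, hd⟩ := hf.exists_push_sub_mem h c hc
    obtain ⟨m, y, hy⟩ := hγ.exists_sub x hx
    refine ⟨m, d + push f _ y, ?_⟩
    rw [hl]
    have : c - push f _ (Finsupp.linearCombination ℤ γ m) - bd (q + 1) (d + push f _ y) =
        (c - push f _ x - bd (q + 1) d) +
          push f _ (x - Finsupp.linearCombination ℤ γ m - bd (q + 1) y) := by
      rw [map_add, bd_push, map_sub, map_sub]
      abel
    rw [this]
    exact Submodule.add_mem _ hd (push_mem_chainsIn hf.mapsTo hy)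
  · rw [hl] at hd
    obtain ⟨d', hd'⟩ := hf.exists_sub_bd_mem_of_push h _ (bd_linearCombination_mem hγ.bd_mem m) d hd
    exact hγ.eq_zero m d' hd'

end IsRelHomeo

/-- A subset whose augmented singular chain complex is exact. -/
structure IsAcyclicSet (A : Set Y) : Prop where
  nonempty : A.Nonempty
  exists_bd : ∀ (n : ℕ) (c : Chain (n + 1) Y), c ∈ chainsIn (n + 1) A → bd n c = 0 →
    ∃ d ∈ chainsIn (n + 2) A, bd (n + 1) d = c

/-- The augmentation degree is generated by the empty simplex, which is the boundary of any point.
-/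
lemma bd_zero_surjective {A : Set Y} (h : A.Nonempty) (c : Chain 0 Y) :
    ∃ d ∈ chainsIn 1 A, bd 0 d = c := by
  obtain ⟨y, hy⟩ := h
  induction c using Finsupp.induction_linear with
  | zero => exact ⟨0, Submodule.zero_mem _, map_zero _⟩
  | add a b ha hb =>
    obtain ⟨a', ha', rfl⟩ := ha
    obtain ⟨b', hb', rfl⟩ := hb
    exact ⟨a' + b', Submodule.add_mem _ ha' hb', map_add _ _ _⟩
  | single σ m =>
    refine ⟨Finsupp.single (ContinuousMap.const _ y) m, single_mem_chainsIn (fun _ => hy) _, ?_⟩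
    rw [bd_single]
    simp only [Fin.sum_univ_succ]
    simp only [Fin.val_zero, pow_zero, one_smul, Finset.univ_eq_empty, Finset.sum_empty, add_zero]
    congr 1
    ext t
    have := t.2.2
    simp at this

lemma IsAcyclicSet.exists_bd_sub {A : Set Y} (hA : IsAcyclicSet A) {n : ℕ} (c : Chain (n + 1) Y)
    (hc : bd n c ∈ chainsIn n A) : ∃ a ∈ chainsIn (n + 1) A, bd n (c - a) = 0 := by
  cases n with
  | zero =>
    obtain ⟨a, ha, e⟩ := bd_zero_surjective hA.nonempty (bd 0 c)
    exact ⟨a, ha, by rw [map_sub, e, sub_self]⟩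
  | succ n =>
    obtain ⟨a, ha, e⟩ := hA.exists_bd n _ hc (bd_bd _)
    exact ⟨a, ha, by rw [map_sub, e, sub_self]⟩

/-- A filling found in the contractible space is pushed into `A` by the retraction, which fixes
chains already in `A`. -/
lemma isAcyclicSet_of_retract [ContractibleSpace Y] {A : Set Y} (r : C(Y, Y)) (hr : ∀ y, r y ∈ A)
    (hA : ∀ a ∈ A, r a = a) : IsAcyclicSet A := by
  obtain ⟨y⟩ := (inferInstance : Nonempty Y)
  refine ⟨⟨_, hr y⟩, fun n c hc h => ?_⟩
  obtain ⟨d, rfl⟩ := exists_bd_eq_of_contractible c h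
  refine ⟨push r _ d, push_mem_chainsIn (fun y _ => hr y) (mem_chainsIn_univ d), ?_⟩
  rw [bd_push]
  have : ∀ c ∈ chainsIn (n + 1) A, push r (n + 1) c - c ∈ (⊥ : Submodule ℤ (Chain (n + 1) Y)) := by
    intro c hc
    refine Finsupp.map_mem_of_mem_supported (push r (n + 1) - LinearMap.id) (fun σ hσ => ?_) hc
    rw [LinearMap.sub_apply, push_single, LinearMap.id_apply, Submodule.mem_bot, sub_eq_zero]
    congr 1
    ext t
    exact hA _ (hσ t)
  exact sub_eq_zero.mp ((Submodule.mem_bot ℤ).mp (this _ hc))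

/-! ### The connecting map of a triple with contractible total space and acyclic smallest subset -/

section Triple

variable [ContractibleSpace Y] {A B : Set Y} (hA : IsAcyclicSet A) (hAB : A ⊆ B)
include hA

lemma relAcyclic_of_isAcyclicSet (q : ℕ) : RelAcyclic A q := by
  intro c hc
  obtain ⟨a, ha, h⟩ := hA.exists_bd_sub c hc
  obtain ⟨d, hd⟩ := exists_bd_eq_of_contractible _ h
  exact ⟨d, by rwa [hd, sub_sub_cancel]⟩

include hAB

lemma exists_sub_bd_mem_of_triple {q : ℕ} (c : Chain (q + 1) Y) {b : Chain (q + 1) Y}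
    (hb : b ∈ chainsIn (q + 1) B) (h : bd q (c - b) ∈ chainsIn q A) :
    ∃ d, c - bd (q + 1) d ∈ chainsIn (q + 1) B := by
  obtain ⟨d, hd⟩ := relAcyclic_of_isAcyclicSet hA q _ h
  refine ⟨d, ?_⟩
  have : c - bd (q + 1) d = c - b - bd (q + 1) d + b := by abel
  rw [this]
  exact Submodule.add_mem _ (chainsIn_mono hAB hd) hb

lemma relAcyclic_zero_of_triple : RelAcyclic B 0 := fun c _ =>
  exists_sub_bd_mem_of_triple hA hAB c (Submodule.zero_mem _) (mem_chainsIn_zero _)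

/-- This is the part of the exact sequence of the triple `A ⊆ B ⊆ Y` that remains when `(Y, A)` is
acyclic: the boundary identifies degree `q + 1` of `(Y, B)` with degree `q` of `(B, A)`. -/
lemma relAcyclic_succ_of_triple {q : ℕ} (h : RelAcyclic (inclSet B ⁻¹' A) q) :
    RelAcyclic B (q + 1) := by
  intro c hc
  obtain ⟨b, hb⟩ := exists_push_inclSet hc
  obtain ⟨d, hd⟩ := h b (by
    refine mem_chainsIn_of_push (S := Set.univ) Subtype.val_injective.injOn (mem_chainsIn_univ _) ?_
    rw [← bd_push, hb, bd_bd]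
    exact Submodule.zero_mem _)
  refine exists_sub_bd_mem_of_triple hA hAB c (b := push (inclSet B) _ d)
    (push_mem_chainsIn (U := Set.univ) (fun x _ => x.2) (mem_chainsIn_univ d)) ?_
  rw [map_sub, bd_push, ← hb, ← map_sub]
  exact push_mem_chainsIn (fun _ h => h) hd

/-- The new basis consists of chains whose boundaries are the old basis elements modulo `A`; they
exist because `A` is acyclic and `Y` contractible. -/
lemma exists_isRelBasis_succ_of_triple {q : ℕ} {γ : E → Chain (q + 1) B}
    (h : IsRelBasis (inclSet B ⁻¹' A) q γ) :
    ∃ γ' : E → Chain (q + 2) Y, IsRelBasis B (q + 1) γ' := by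
  have key : ∀ e, ∃ c : Chain (q + 2) Y,
      bd (q + 1) c - push (inclSet B) _ (γ e) ∈ chainsIn (q + 1) A := by
    intro e
    obtain ⟨a, ha, h0⟩ := hA.exists_bd_sub (push (inclSet B) _ (γ e)) (by
      rw [bd_push]
      exact push_mem_chainsIn (fun _ h => h) (h.bd_mem e))
    obtain ⟨d, hd⟩ := exists_bd_eq_of_contractible _ h0
    exact ⟨d, by rw [hd, sub_sub_cancel_left]; exact Submodule.neg_mem _ ha⟩
  choose γ' hγ' using key
  have hB : ∀ {n} (c : Chain n B), push (inclSet B) n c ∈ chainsIn n B := fun c =>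
    push_mem_chainsIn (U := Set.univ) (fun x _ => x.2) (mem_chainsIn_univ c)
  have hl : ∀ m : E →₀ ℤ, bd (q + 1) (Finsupp.linearCombination ℤ γ' m) -
      push (inclSet B) _ (Finsupp.linearCombination ℤ γ m) ∈ chainsIn (q + 1) A := by
    intro m
    simp only [Finsupp.linearCombination_apply, Finsupp.sum, map_sum, map_smul,
      ← Finset.sum_sub_distrib, ← smul_sub]
    exact Submodule.sum_mem _ fun e _ => Submodule.smul_mem _ _ (hγ' e)
  refine ⟨γ', fun e => ?_, fun c hc => ?_, fun m d hd => ?_⟩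
  · rw [← sub_add_cancel (bd (q + 1) (γ' e)) (push (inclSet B) _ (γ e))]
    exact Submodule.add_mem _ (chainsIn_mono hAB (hγ' e)) (hB _)
  · obtain ⟨b, hb⟩ := exists_push_inclSet hc
    obtain ⟨m, d, hd⟩ := h.exists_sub b (by
      refine mem_chainsIn_of_push (S := Set.univ) Subtype.val_injective.injOn
        (mem_chainsIn_univ _) ?_
      rw [← bd_push, hb, bd_bd]
      exact Submodule.zero_mem _)
    obtain ⟨d', hd'⟩ := exists_sub_bd_mem_of_triple hA hAB
      (c - Finsupp.linearCombination ℤ γ' m) (hB d) (by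
        have : bd (q + 1) (c - Finsupp.linearCombination ℤ γ' m - push (inclSet B) _ d) =
            push (inclSet B) _ (b - Finsupp.linearCombination ℤ γ m - bd (q + 1) d) -
            (bd (q + 1) (Finsupp.linearCombination ℤ γ' m) -
              push (inclSet B) _ (Finsupp.linearCombination ℤ γ m)) := by
          rw [map_sub, map_sub, map_sub, map_sub, ← bd_push, hb]
          abel
        rw [this]
        exact Submodule.sub_mem _ (push_mem_chainsIn (fun _ h => h) hd) (hl m))
    exact ⟨m, d', hd'⟩
  · obtain ⟨b, hb⟩ := exists_push_inclSet hd
    refine h.eq_zero m b (mem_chainsIn_of_push (S := Set.univ) Subtype.val_injective.injOn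
        (mem_chainsIn_univ _) ?_)
    have : push (inclSet B) _ (Finsupp.linearCombination ℤ γ m - bd (q + 1) b) =
        - (bd (q + 1) (Finsupp.linearCombination ℤ γ' m) -
              push (inclSet B) _ (Finsupp.linearCombination ℤ γ m)) := by
      rw [map_sub, ← bd_push, hb, map_sub, bd_bd]
      abel
    rw [this]
    exact Submodule.neg_mem _ (hl m)

end Triple

end RelBasis

/-! ### The relative homology of a ball modulo its boundary sphere -/

section Ball

variable {V : Type*} [NormedAddCommGroup V] [NormedSpace ℝ V]

/-- The closed unit ball as a space. -/
abbrev Ball (V : Type*) [NormedAddCommGroup V] := ↥(Metric.closedBall (0 : V) 1)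

/-- The boundary sphere of the closed unit ball. -/
def bdry (V : Type*) [NormedAddCommGroup V] : Set (Ball V) := {x | ‖(x : V)‖ = 1}

omit [NormedSpace ℝ V] in
lemma Ball.norm_le (x : Ball V) : ‖(x : V)‖ ≤ 1 := mem_closedBall_zero_iff.mp x.2

instance : ContractibleSpace (Ball V) :=
  (convex_closedBall (0 : V) 1).contractibleSpace ⟨0, by simp⟩

/-- The radial deformation of the punctured ball onto the sphere. -/
noncomputable def bdryDeformation : NbhdDeformation (bdry V) {x : Ball V | (x : V) ≠ 0} where
  isOpen := isOpen_ne_fun continuous_subtype_val continuous_const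
  subset x hx h := by simp [bdry, h] at hx
  homotopy := ⟨fun x => ⟨⟨((1 - x.2.1) + x.2.1 / ‖(x.1.1.1 : V)‖) • x.1.1.1, by
    obtain ⟨⟨x, hx⟩, t⟩ := x
    have h0 : 0 < ‖(x : V)‖ := norm_pos_iff.mpr hx
    have h1 := x.norm_le
    have h2 := t.2.1
    have h3 := t.2.2
    have : 0 ≤ (1 - (t : ℝ)) + t / ‖(x : V)‖ := by
      have : 0 ≤ (t : ℝ) / ‖(x : V)‖ := by positivity
      linarith
    rw [mem_closedBall_zero_iff, norm_smul, Real.norm_of_nonneg this, add_mul,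
      div_mul_cancel₀ _ h0.ne']
    nlinarith⟩, by
    obtain ⟨⟨x, hx⟩, t⟩ := x
    have h0 : 0 < ‖(x : V)‖ := norm_pos_iff.mpr hx
    have h1 := x.norm_le
    have h2 := t.2.1
    have h3 := t.2.2
    have : 0 < (1 - (t : ℝ)) + t / ‖(x : V)‖ := by
      have : (t : ℝ) ≤ t / ‖(x : V)‖ := le_div_self h2 h0 h1
      have := sub_nonneg.mpr h3
      by_cases ht : (t : ℝ) = 0
      · simp [ht]
      · have : 0 < (t : ℝ) := lt_of_le_of_ne h2 (Ne.symm ht)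
        linarith
    exact smul_ne_zero this.ne' hx⟩, by
    refine Continuous.subtype_mk (Continuous.subtype_mk (Continuous.smul (Continuous.add
      (by fun_prop) (Continuous.div (by fun_prop) (by fun_prop) ?_)) (by fun_prop)) _) _
    exact fun x => norm_ne_zero_iff.mpr x.1.2⟩
  map_zero x := by
    apply Subtype.ext
    apply Subtype.ext
    simp
  map_one x := by
    have h0 : ‖(x.1 : V)‖ ≠ 0 := norm_ne_zero_iff.mpr x.2
    simp [bdry, norm_smul, h0]
  map_of_mem x hx t := by
    apply Subtype.ext
    apply Subtype.ext
    have : ‖(x.1 : V)‖ = 1 := hx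
    simp [this]

/-- The complement of the open top face in the boundary of a cube. -/
def cup (n : ℕ) : Set (Ball (Fin (n + 1) → ℝ)) :=
  {p | p.1 0 = -1 ∨ ‖Fin.tail p.1‖ = 1}

/-- In the sup norm the unit ball is a cube, the product of an interval and a lower cube; the
induction on dimension uses its faces. -/
lemma norm_eq_max {n : ℕ} (p : Fin (n + 1) → ℝ) : ‖p‖ = max |p 0| ‖Fin.tail p‖ := by
  refine le_antisymm ((pi_norm_le_iff_of_nonneg (by positivity)).mpr fun i => ?_)
    (max_le (norm_le_pi_norm p 0)
      ((pi_norm_le_iff_of_nonneg (by positivity)).mpr fun i => norm_le_pi_norm p i.succ))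
  induction i using Fin.cases with
  | zero => exact le_max_left _ _
  | succ i => exact (norm_le_pi_norm (Fin.tail p) i).trans (le_max_right _ _)

lemma continuous_tail (n : ℕ) : Continuous fun p : Fin (n + 1) → ℝ => Fin.tail p :=
  continuous_pi fun i => continuous_apply i.succ

lemma continuous_cons {X : Type*} [TopologicalSpace X] {n : ℕ} {a : X → ℝ} {b : X → Fin n → ℝ}
    (ha : Continuous a) (hb : Continuous b) :
    Continuous fun x => (Fin.cons (a x) (b x) : Fin (n + 1) → ℝ) := by
  refine continuous_pi fun i => ?_
  induction i using Fin.cases with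
  | zero => simpa using ha
  | succ i =>
    simp only [Fin.cons_succ]
    exact (continuous_apply i).comp hb

lemma cup_subset_bdry (n : ℕ) : cup n ⊆ bdry (Fin (n + 1) → ℝ) := by
  intro p hp
  have h1 := p.norm_le
  rw [norm_eq_max] at h1
  change ‖(p : Fin (n + 1) → ℝ)‖ = 1
  rw [norm_eq_max]
  refine le_antisymm h1 ?_
  rcases hp with h | h
  · rw [h]
    simp
  · rw [h]
    exact le_max_right _ _

/-- The scaling factor of the projection of a cube from a point above it. -/
noncomputable def cupScale {n : ℕ} (p : Fin (n + 1) → ℝ) : ℝ := max ‖Fin.tail p‖ ((3 - p 0) / 4)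

/-- The cube retracts onto its bottom and sides by projection from the point with first coordinate 3
and zero tail. The ray through `p` reaches the sides at scale `‖tail p‖` and the bottom, at distance
4 below the centre, at scale `(3 - p 0) / 4`; the larger scale is met first. -/
lemma isAcyclicSet_cup (n : ℕ) : IsAcyclicSet (cup n) := by
  have hp : ∀ p : Ball (Fin (n + 1) → ℝ), -1 ≤ p.1 0 ∧ p.1 0 ≤ 1 ∧ ‖Fin.tail p.1‖ ≤ 1 := by
    intro p
    have h1 := p.norm_le
    rw [norm_eq_max, max_le_iff, abs_le] at h1
    exact ⟨h1.1.1, h1.1.2, h1.2⟩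
  have hs : ∀ p : Ball (Fin (n + 1) → ℝ), 0 < cupScale p.1 := fun p =>
    lt_max_of_lt_right (by linarith [(hp p).2.1])
  have hr : ∀ p : Ball (Fin (n + 1) → ℝ), ‖(cupScale p.1)⁻¹ • Fin.tail p.1‖ ≤ 1 := fun p => by
    rw [norm_smul, norm_inv, Real.norm_of_nonneg (hs p).le, inv_mul_le_one₀ (hs p)]
    exact le_max_left _ _
  have hr0 : ∀ p : Ball (Fin (n + 1) → ℝ), |3 - (3 - p.1 0) / cupScale p.1| ≤ 1 := fun p => by
    obtain ⟨h1, h2, h3⟩ := hp p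
    have h4 : (3 - p.1 0) / cupScale p.1 ≤ 4 := by
      rw [div_le_iff₀ (hs p)]
      have : (3 - p.1 0) / 4 ≤ cupScale p.1 := le_max_right _ _
      linarith
    have h5 : 2 ≤ (3 - p.1 0) / cupScale p.1 := by
      rw [le_div_iff₀ (hs p)]
      -- As `p 0 ≤ 1`, the right side is at least 1 and so dominates both scales; this keeps the
      -- image at height at most 1.
      have : cupScale p.1 ≤ (3 - p.1 0) / 2 := max_le (by linarith) (by linarith)
      linarith
    rw [abs_le]
    constructor <;> linarith
  have hcs : Continuous fun p : Ball (Fin (n + 1) → ℝ) => cupScale p.1 :=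
    (((continuous_tail n).comp continuous_subtype_val).norm).max
      ((continuous_const.sub ((continuous_apply 0).comp continuous_subtype_val)).div_const 4)
  let r : C(Ball (Fin (n + 1) → ℝ), Ball (Fin (n + 1) → ℝ)) :=
    ⟨fun p => ⟨(Fin.cons (3 - (3 - p.1 0) / cupScale p.1) ((cupScale p.1)⁻¹ • Fin.tail p.1) :
      Fin (n + 1) → ℝ), by
      rw [mem_closedBall_zero_iff, norm_eq_max, Fin.cons_zero, Fin.tail_cons]
      exact max_le (hr0 p) (hr p)⟩, by
      refine Continuous.subtype_mk (continuous_cons ?_ ?_) _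
      · exact continuous_const.sub ((continuous_const.sub
          ((continuous_apply 0).comp continuous_subtype_val)).div hcs fun p => (hs p).ne')
      · exact (hcs.inv₀ fun p => (hs p).ne').smul
          ((continuous_tail n).comp continuous_subtype_val)⟩
  refine isAcyclicSet_of_retract r (fun p => ?_) fun p h => ?_
  · change (Fin.cons (3 - (3 - p.1 0) / cupScale p.1) ((cupScale p.1)⁻¹ • Fin.tail p.1) :
        Fin (n + 1) → ℝ) 0 = -1 ∨
      ‖Fin.tail (Fin.cons (3 - (3 - p.1 0) / cupScale p.1) ((cupScale p.1)⁻¹ • Fin.tail p.1) :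
        Fin (n + 1) → ℝ)‖ = 1
    rw [Fin.cons_zero, Fin.tail_cons]
    rcases max_cases ‖Fin.tail p.1‖ ((3 - p.1 0) / 4) with ⟨h, -⟩ | ⟨h, -⟩
    · right
      have h' : cupScale p.1 = ‖Fin.tail p.1‖ := h
      rw [norm_smul, norm_inv, Real.norm_of_nonneg (hs p).le, ← h', inv_mul_cancel₀ (hs p).ne']
    · left
      have h' : cupScale p.1 = (3 - p.1 0) / 4 := h
      have := (hs p).ne'
      rw [h'] at this ⊢
      have h3 : 3 - p.1 0 ≠ 0 := fun h => this (by rw [h, zero_div])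
      field_simp
      norm_num
  · have h1 : cupScale p.1 = 1 := by
      obtain ⟨h1, h2, h3⟩ := hp p
      rcases h with h | h
      · rw [cupScale, h, max_eq_right]
        · norm_num
        · norm_num
          exact h3
      · rw [cupScale, h, max_eq_left]
        linarith
    apply Subtype.ext
    change (Fin.cons (3 - (3 - p.1 0) / cupScale p.1) ((cupScale p.1)⁻¹ • Fin.tail p.1) :
      Fin (n + 1) → ℝ) = p.1
    rw [h1, inv_one, one_smul, div_one, sub_sub_cancel, Fin.cons_self_tail]

/-- The inclusion of the top face into the boundary of a cube. -/
def topFace (n : ℕ) : C(Ball (Fin n → ℝ), bdry (Fin (n + 1) → ℝ)) :=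
  ⟨fun x => ⟨⟨(Fin.cons 1 x.1 : Fin (n + 1) → ℝ), by
    rw [mem_closedBall_zero_iff, norm_eq_max, Fin.cons_zero, Fin.tail_cons, abs_one]
    exact max_le le_rfl x.norm_le⟩, by
    change ‖(Fin.cons 1 x.1 : Fin (n + 1) → ℝ)‖ = 1
    rw [norm_eq_max, Fin.cons_zero, Fin.tail_cons, abs_one]
    exact max_eq_left x.norm_le⟩,
    Continuous.subtype_mk (Continuous.subtype_mk
      (continuous_cons continuous_const continuous_subtype_val) _) _⟩

/-- Off the bottom and sides, the boundary of the cube is the open top face, on which taking tails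
inverts the inclusion. -/
lemma topFace_isRelHomeo (n : ℕ) :
    IsRelHomeo (topFace n) (bdry (Fin n → ℝ)) (inclSet (bdry (Fin (n + 1) → ℝ)) ⁻¹' cup n) := by
  have h0 : ∀ x, ((topFace n x).1.1 : Fin (n + 1) → ℝ) 0 = 1 := fun x => rfl
  have ht : ∀ x, Fin.tail ((topFace n x).1.1 : Fin (n + 1) → ℝ) = x.1 := fun x => rfl
  have hc : Continuous fun p : bdry (Fin (n + 1) → ℝ) => (p.1.1 : Fin (n + 1) → ℝ) :=
    continuous_subtype_val.comp continuous_subtype_val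
  have htl : ∀ p : bdry (Fin (n + 1) → ℝ), ‖Fin.tail (p.1.1 : Fin (n + 1) → ℝ)‖ ≤ 1 := by
    intro p
    have := p.1.norm_le
    rw [norm_eq_max] at this
    exact (le_max_right _ _).trans this
  have htop : ∀ p : bdry (Fin (n + 1) → ℝ), (p.1.1 : Fin (n + 1) → ℝ) 0 = 1 →
      topFace n ⟨Fin.tail p.1.1, mem_closedBall_zero_iff.mpr (htl p)⟩ = p := by
    intro p hp
    apply Subtype.ext
    apply Subtype.ext
    change (Fin.cons 1 (Fin.tail p.1.1) : Fin (n + 1) → ℝ) = p.1.1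
    conv_rhs => rw [← Fin.cons_self_tail (p.1.1 : Fin (n + 1) → ℝ), hp]
  have hout : ∀ p : bdry (Fin (n + 1) → ℝ), p ∉ inclSet (bdry (Fin (n + 1) → ℝ)) ⁻¹' cup n →
      (p.1.1 : Fin (n + 1) → ℝ) 0 = 1 := by
    intro p hp
    have h1 : ‖(p.1.1 : Fin (n + 1) → ℝ)‖ = 1 := p.2
    have h2 : ¬ ((p.1.1 : Fin (n + 1) → ℝ) 0 = -1 ∨ ‖Fin.tail (p.1.1 : Fin (n + 1) → ℝ)‖ = 1) := hp
    rw [not_or] at h2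
    rw [norm_eq_max] at h1
    rcases max_choice |(p.1.1 : Fin (n + 1) → ℝ) 0| ‖Fin.tail (p.1.1 : Fin (n + 1) → ℝ)‖ with h | h
    · rw [h] at h1
      exact (eq_or_eq_neg_of_abs_eq h1).resolve_right h2.1
    · rw [h] at h1
      exact absurd h1 h2.2
  refine ⟨?_, fun x hx => Or.inr hx, fun x hx h => ?_, fun x _ y _ e => ?_, fun p hp => ?_,
    fun C h1 h2 => ?_⟩
  · exact (isClosed_eq ((continuous_apply 0).comp hc) continuous_const).union
      (isClosed_eq ((continuous_tail n).comp hc).norm continuous_const)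
  · rcases h with h | h
    · change (1 : ℝ) = -1 at h
      norm_num at h
    · exact hx h
  · apply Subtype.ext
    rw [← ht x, ← ht y, e]
  · refine ⟨_, ?_, htop p (hout p hp)⟩
    exact fun h => hp (Or.inr h)
  · have : C = (C ∩ inclSet (bdry (Fin (n + 1) → ℝ)) ⁻¹' cup n) ∪
        ({p | (p.1.1 : Fin (n + 1) → ℝ) 0 = 1} ∩
          (fun p : bdry (Fin (n + 1) → ℝ) => (⟨Fin.tail p.1.1,
            mem_closedBall_zero_iff.mpr (htl p)⟩ : Ball (Fin n → ℝ))) ⁻¹' (topFace n ⁻¹' C)) := by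
      ext p
      constructor
      · intro hp
        by_cases h : p ∈ inclSet (bdry (Fin (n + 1) → ℝ)) ⁻¹' cup n
        · exact Or.inl ⟨hp, h⟩
        · refine Or.inr ⟨hout p h, ?_⟩
          change topFace n _ ∈ C
          rwa [htop p (hout p h)]
      · rintro (h | ⟨h, h'⟩)
        · exact h.1
        · change topFace n _ ∈ C at h'
          rwa [htop p h] at h'
    rw [this]
    exact h1.union ((isClosed_eq ((continuous_apply 0).comp hc) continuous_const).inter
      (h2.preimage (Continuous.subtype_mk ((continuous_tail n).comp hc) _)))

/-- The relative homology of `(Dⁿ, Sⁿ⁻¹)`. -/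
theorem ball_relHomology (n : ℕ) :
    (∃ γ : Unit → Chain (n + 1) (Ball (Fin n → ℝ)), IsRelBasis (bdry (Fin n → ℝ)) n γ) ∧
      ∀ q, q ≠ n → RelAcyclic (bdry (Fin n → ℝ)) q := by
  induction n with
  | zero =>
    have hempty : bdry (Fin 0 → ℝ) = ∅ := by
      ext x
      have : ‖(x : Fin 0 → ℝ)‖ = 0 := by rw [Subsingleton.elim (x : Fin 0 → ℝ) 0, norm_zero]
      simp [bdry, this]
    have hzero : ∀ (q : ℕ) (c : Chain (q + 1) (Ball (Fin 0 → ℝ))),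
        c ∈ chainsIn (q + 1) (bdry (Fin 0 → ℝ)) ↔ c = 0 := by
      intro q c
      rw [chainsIn, hempty]
      have : {σ : C(Splx (q + 1), Ball (Fin 0 → ℝ)) | ∀ t, σ t ∈ (∅ : Set _)} = ∅ := by
        ext σ
        simp only [Set.mem_empty_iff_false, Set.mem_ofPred_eq, iff_false, not_forall]
        exact ⟨vert (q + 1) 0, not_false⟩
      rw [this, Finsupp.supported_empty, Submodule.mem_bot]
    constructor
    · obtain ⟨g, -, hg⟩ := bd_zero_surjective (Y := Ball (Fin 0 → ℝ)) Set.univ_nonempty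
        (Finsupp.single ⟨fun t => ⟨0, by simp⟩, continuous_const⟩ 1)
      refine ⟨fun _ => g, fun _ => mem_chainsIn_zero _, fun c _ => ?_, fun m d h => ?_⟩
      · obtain ⟨k, hk⟩ : ∃ k : ℤ, bd 0 c = k • bd 0 g := by
          have hs : Subsingleton C(Splx 0, Ball (Fin 0 → ℝ)) := ⟨fun a b => by
            ext t
            have := t.2.2
            simp at this⟩
          rw [hg]
          refine ⟨bd 0 c ⟨fun t => ⟨0, by simp⟩, continuous_const⟩, ?_⟩
          ext σ
          rw [Subsingleton.elim σ ⟨fun t => ⟨0, by simp⟩, continuous_const⟩]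
          simp
        obtain ⟨d, hd⟩ := exists_bd_eq_of_contractible (c - k • g) (by
          rw [map_sub, hk, map_smul, sub_self])
        refine ⟨Finsupp.single () k, d, ?_⟩
        rw [Finsupp.linearCombination_single, hd, sub_self]
        exact Submodule.zero_mem _
      · rw [hzero] at h
        have h' := congrArg (bd 0) h
        rw [Finsupp.linearCombination_apply, Finsupp.sum_fintype _ _ (by simp), map_sub, bd_bd] at h'
        simp only [Finset.univ_unique, Finset.sum_singleton, map_smul, hg, sub_zero, map_zero] at h'
        ext
        simpa using h'
    · intro q hq c hc
      obtain ⟨q, rfl⟩ := Nat.exists_eq_succ_of_ne_zero hq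
      rw [hzero] at hc
      obtain ⟨d, hd⟩ := exists_bd_eq_of_contractible c hc
      exact ⟨d, by rw [hd, sub_self]; exact Submodule.zero_mem _⟩
  | succ n ih =>
    obtain ⟨⟨γ, hγ⟩, hq⟩ := ih
    -- The ball modulo its sphere is shifted down to the sphere modulo the cup, which is relatively
    -- homeomorphic to the lower ball modulo its sphere.
    refine ⟨exists_isRelBasis_succ_of_triple (isAcyclicSet_cup n) (cup_subset_bdry n)
      ((topFace_isRelHomeo n).isRelBasis bdryDeformation hγ), fun q hqn => ?_⟩
    cases q with
    | zero => exact relAcyclic_zero_of_triple (isAcyclicSet_cup n) (cup_subset_bdry n)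
    | succ q =>
      exact relAcyclic_succ_of_triple (isAcyclicSet_cup n) (cup_subset_bdry n)
        ((topFace_isRelHomeo n).relAcyclic bdryDeformation (hq q (by omega)))

end Ball

end SingularChain

namespace SingularChain

/-! ### Families of cells -/

section Family

variable {E Z : Type*} [TopologicalSpace Z] [TopologicalSpace E] [DiscreteTopology E]

/-- The inclusion of a component of `E × Z`. -/
def comp (e : E) : C(Z, E × Z) := ⟨fun z => (e, z), by fun_prop⟩

open Classical in
/-- The component at `e` of a chain in `E × Z`. -/
noncomputable def compProj (e : E) (n : ℕ) : Chain n (E × Z) →ₗ[ℤ] Chain n Z :=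
  Finsupp.linearCombination ℤ fun σ =>
    if ∀ t, (σ t).1 = e then Finsupp.single (ContinuousMap.snd.comp σ) 1 else 0

omit [DiscreteTopology E] in
open Classical in
lemma compProj_single (e : E) {n : ℕ} (σ : C(Splx n, E × Z)) :
    compProj e n (Finsupp.single σ 1) =
      if ∀ t, (σ t).1 = e then Finsupp.single (ContinuousMap.snd.comp σ) 1 else 0 := by
  rw [compProj, Finsupp.linearCombination_single, one_smul]

lemma fst_eq {n : ℕ} (σ : C(Splx n, E × Z)) (t t' : Splx n) : (σ t).1 = (σ t').1 := by
  have : PreconnectedSpace (Splx n) :=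
    Subtype.preconnectedSpace (convex_stdSimplex ℝ (Fin n)).isPreconnected
  exact PreconnectedSpace.constant this (f := fun t => (σ t).1) (by fun_prop)

/-- A nonempty simplex lies in one component with all its faces. The index starts at `n + 2` because
the empty simplex belongs to every component, so the identity fails in the augmentation degree. -/
lemma bd_compProj (e : E) {n : ℕ} (c : Chain (n + 2) (E × Z)) :
    bd (n + 1) (compProj e (n + 2) c) = compProj e (n + 1) (bd (n + 1) c) := by
  induction c using Finsupp.induction_linear with
  | zero => simp
  | add a b ha hb => simp [ha, hb]
  | single σ m =>
    have : Finsupp.single σ m = m • Finsupp.single σ 1 := by simp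
    rw [this]
    simp only [map_smul]
    congr 1
    rw [compProj_single, bd_single, map_sum]
    by_cases hσ : ∀ t, (σ t).1 = e
    · rw [if_pos hσ, bd_single]
      refine Finset.sum_congr rfl fun i _ => ?_
      have h : ∀ t, ((σ.comp (face i)) t).1 = e := fun t => hσ _
      rw [map_smul, compProj_single, if_pos h]
      rfl
    · rw [if_neg hσ, map_zero]
      refine (Finset.sum_eq_zero fun i _ => ?_).symm
      rw [map_smul, compProj_single, if_neg (fun h => hσ fun t =>
        (fst_eq σ _ _).trans (h (vert (n + 1) 0))), smul_zero]

omit [DiscreteTopology E] in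
lemma compProj_mem_chainsIn (e : E) {n : ℕ} {W : Set Z} {c : Chain n (E × Z)}
    (hc : c ∈ chainsIn n (Set.univ ×ˢ W)) : compProj e n c ∈ chainsIn n W := by
  refine Finsupp.map_mem_of_mem_supported _ (fun σ hσ => ?_) hc
  rw [compProj_single]
  split_ifs
  · exact single_mem_chainsIn (fun t => (hσ t).2) _
  · exact Submodule.zero_mem _

lemma bd_compProj_mem_chainsIn (e : E) {n : ℕ} {W : Set Z} {c : Chain (n + 1) (E × Z)}
    (hc : bd n c ∈ chainsIn n (Set.univ ×ˢ W)) : bd n (compProj e (n + 1) c) ∈ chainsIn n W := by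
  cases n with
  | zero => exact mem_chainsIn_zero _
  | succ n =>
    rw [bd_compProj]
    exact compProj_mem_chainsIn e hc

omit [DiscreteTopology E] in
lemma compProj_push_self (e : E) {n : ℕ} (c : Chain n Z) :
    compProj e n (push (comp e) n c) = c := by
  induction c using Finsupp.induction_linear with
  | zero => simp
  | add a b ha hb => simp [ha, hb]
  | single σ m =>
    have : Finsupp.single σ m = m • Finsupp.single σ 1 := by simp
    rw [this]
    simp only [map_smul]
    have h : ∀ t, (((comp e).comp σ) t).1 = e := fun _ => rfl
    rw [push_single, compProj_single, if_pos h]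
    rfl

omit [DiscreteTopology E] in
lemma compProj_push_of_ne {e e' : E} (h : e' ≠ e) {n : ℕ} (c : Chain (n + 1) Z) :
    compProj e (n + 1) (push (comp e') (n + 1) c) = 0 := by
  induction c using Finsupp.induction_linear with
  | zero => simp
  | add a b ha hb => simp [ha, hb]
  | single σ m =>
    have : Finsupp.single σ m = m • Finsupp.single σ 1 := by simp
    rw [this]
    simp only [map_smul]
    rw [push_single, compProj_single, if_neg (fun h' => h (h' (vert (n + 1) 0))), smul_zero]

lemma exists_eq_sum_compProj {n : ℕ} (c : Chain (n + 1) (E × Z)) :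
    ∃ s : Finset E, c = ∑ e ∈ s, push (comp e) (n + 1) (compProj e (n + 1) c) := by
  classical
  -- Allowing all larger finite sets makes the statement additive in the chain.
  suffices ∃ s : Finset E, ∀ s', s ⊆ s' →
      c = ∑ e ∈ s', push (comp e) (n + 1) (compProj e (n + 1) c) from
    this.imp fun s h => h s subset_rfl
  induction c using Finsupp.induction_linear with
  | zero => exact ⟨∅, by simp⟩
  | add a b ha hb =>
    obtain ⟨s, hs⟩ := ha
    obtain ⟨s', hs'⟩ := hb
    refine ⟨s ∪ s', fun r hr => ?_⟩
    simp only [map_add, Finset.sum_add_distrib]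
    rw [← hs r (Finset.union_subset_left hr), ← hs' r (Finset.union_subset_right hr)]
  | single σ m =>
    refine ⟨{(σ (vert (n + 1) 0)).1}, fun r hr => ?_⟩
    rw [Finset.singleton_subset_iff] at hr
    have : Finsupp.single σ m = m • Finsupp.single σ 1 := by simp
    rw [this]
    simp only [map_smul, ← Finset.smul_sum]
    congr 1
    rw [Finset.sum_eq_single_of_mem _ hr]
    · rw [compProj_single, if_pos (fun t => fst_eq _ _ _), push_single]
      congr 1
      ext t
      · exact fst_eq σ _ _
      · rfl
    · intro e _ he
      rw [compProj_single, if_neg (fun h => he (h _).symm), map_zero]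

omit [DiscreteTopology E] in
lemma push_comp_mem_chainsIn (e : E) {n : ℕ} {W : Set Z} {c : Chain n Z} (hc : c ∈ chainsIn n W) :
    push (comp e) n c ∈ chainsIn n ((Set.univ : Set E) ×ˢ W) :=
  push_mem_chainsIn (fun _ hz => Set.mk_mem_prod (Set.mem_univ _) hz) hc

lemma relAcyclic_prod {W : Set Z} {q : ℕ} (h : RelAcyclic W q) :
    RelAcyclic ((Set.univ : Set E) ×ˢ W) q := by
  intro c hc
  obtain ⟨s, hs⟩ := exists_eq_sum_compProj c
  choose d hd using fun e => h _ (bd_compProj_mem_chainsIn e hc)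
  refine ⟨∑ e ∈ s, push (comp e) _ (d e), ?_⟩
  have : c - bd (q + 1) (∑ e ∈ s, push (comp e) _ (d e)) =
      ∑ e ∈ s, push (comp e) _ (compProj e _ c - bd (q + 1) (d e)) := by
    simp only [map_sub, Finset.sum_sub_distrib, ← hs, map_sum, bd_push]
  rw [this]
  exact Submodule.sum_mem _ fun e _ => push_comp_mem_chainsIn e (hd e)

lemma isRelBasis_prod {W : Set Z} {q : ℕ} {γ : Unit → Chain (q + 1) Z} (h : IsRelBasis W q γ) :
    IsRelBasis ((Set.univ : Set E) ×ˢ W) q fun e => push (comp e) _ (γ ()) := by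
  refine ⟨fun e => ?_, fun c hc => ?_, fun m d hd => ?_⟩
  · rw [bd_push]
    exact push_comp_mem_chainsIn e (h.bd_mem ())
  · obtain ⟨s, hs⟩ := exists_eq_sum_compProj c
    choose m d hd using fun e => h.exists_sub _ (bd_compProj_mem_chainsIn e hc)
    refine ⟨∑ e ∈ s, Finsupp.single e (m e ()), ∑ e ∈ s, push (comp e) _ (d e), ?_⟩
    have hl : ∀ m : Unit →₀ ℤ, Finsupp.linearCombination ℤ γ m = m () • γ () := fun m => by
      rw [Finsupp.linearCombination_apply, Finsupp.sum_fintype _ _ (by simp)]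
      simp
    have : c - Finsupp.linearCombination ℤ (fun e => push (comp e) _ (γ ()))
        (∑ e ∈ s, Finsupp.single e (m e ())) - bd (q + 1) (∑ e ∈ s, push (comp e) _ (d e)) =
        ∑ e ∈ s, push (comp e) _
          (compProj e _ c - Finsupp.linearCombination ℤ γ (m e) - bd (q + 1) (d e)) := by
      simp only [map_sub, Finset.sum_sub_distrib, ← hs, map_sum, bd_push, hl, map_smul,
        Finsupp.linearCombination_single]
    rw [this]
    exact Submodule.sum_mem _ fun e _ =>
      push_comp_mem_chainsIn e (hd e)
  · ext e
    have h1 := compProj_mem_chainsIn e hd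
    have h2 : compProj e (q + 1)
        (Finsupp.linearCombination ℤ (fun e => push (comp e) (q + 1) (γ ())) m) = m e • γ () := by
      rw [Finsupp.apply_linearCombination, Finsupp.linearCombination_apply, Finsupp.sum,
        Finset.sum_eq_single e]
      · simp [compProj_push_self]
      · intro e' _ he
        simp [compProj_push_of_ne he]
      · intro he
        simp [Finsupp.notMem_support_iff.mp he]
    rw [map_sub, h2, ← bd_compProj] at h1
    have h3 := h.eq_zero (Finsupp.single () (m e)) (compProj e _ d) (by
      rwa [Finsupp.linearCombination_single])
    simpa using h3

/-- The deformation of a family. -/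
def NbhdDeformation.prod {W V : Set Z} (h : NbhdDeformation W V) (E : Type*) [TopologicalSpace E]
    [DiscreteTopology E] :
    NbhdDeformation ((Set.univ : Set E) ×ˢ W) ((Set.univ : Set E) ×ˢ V) where
  isOpen := isOpen_univ.prod h.isOpen
  subset := Set.prod_mono subset_rfl h.subset
  homotopy := ⟨fun x => ⟨(x.1.1.1, h.homotopy (⟨x.1.1.2, x.1.2.2⟩, x.2)), Set.mem_univ _,
    (h.homotopy _).2⟩, by fun_prop⟩
  map_zero x := Subtype.ext (Prod.ext rfl (congrArg Subtype.val (h.map_zero ⟨x.1.2, x.2.2⟩)))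
  map_one x := ⟨Set.mem_univ _, h.map_one _⟩
  map_of_mem x hx t :=
    Subtype.ext (Prod.ext rfl (congrArg Subtype.val (h.map_of_mem ⟨x.1.2, x.2.2⟩ hx.2 t)))

end Family

/-- The space `Y` is obtained from the closed subset `A` by attaching `n`-cells with
characteristic maps `φ e`. -/
structure IsCellAttachment {Y : Type*} [TopologicalSpace Y] (A : Set Y) {E : Type*} (n : ℕ)
    (φ : E → C(Ball (Fin n → ℝ), Y)) : Prop where
  isClosed : IsClosed A
  mem_of_mem_bdry : ∀ e, ∀ x ∈ bdry (Fin n → ℝ), φ e x ∈ A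
  notMem : ∀ e, ∀ x ∉ bdry (Fin n → ℝ), φ e x ∉ A
  inj : ∀ e e' x x', x ∉ bdry (Fin n → ℝ) → x' ∉ bdry (Fin n → ℝ) → φ e x = φ e' x' →
    e = e' ∧ x = x'
  exists_eq : ∀ y ∉ A, ∃ e, ∃ x ∉ bdry (Fin n → ℝ), φ e x = y
  isClosed_of : ∀ C : Set Y, IsClosed (C ∩ A) → (∀ e, IsClosed (φ e ⁻¹' C)) → IsClosed C

namespace IsCellAttachment

variable {Y : Type*} [TopologicalSpace Y] {A : Set Y} {E : Type*} {n : ℕ}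
  {φ : E → C(Ball (Fin n → ℝ), Y)} (h : IsCellAttachment A n φ)
include h

omit h in
/-- The sum of the characteristic maps. -/
def total [TopologicalSpace E] [DiscreteTopology E] (φ : E → C(Ball (Fin n → ℝ), Y)) :
    C(E × Ball (Fin n → ℝ), Y) :=
  ⟨fun x => φ x.1 x.2, continuous_prod_of_discrete_left.mpr fun e => (φ e).continuous⟩

lemma isRelHomeo [TopologicalSpace E] [DiscreteTopology E] :
    IsRelHomeo (total φ) (Set.univ ×ˢ bdry (Fin n → ℝ)) A where
  isClosed := h.isClosed
  mapsTo x hx := h.mem_of_mem_bdry _ _ hx.2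
  mapsTo_compl x hx := h.notMem _ _ fun hx' => hx ⟨Set.mem_univ _, hx'⟩
  injOn x hx y hy e := by
    obtain ⟨h1, h2⟩ := h.inj x.1 y.1 x.2 y.2 (fun hx' => hx ⟨Set.mem_univ _, hx'⟩)
      (fun hy' => hy ⟨Set.mem_univ _, hy'⟩) e
    exact Prod.ext h1 h2
  surjOn y hy := by
    obtain ⟨e, x, hx, rfl⟩ := h.exists_eq y hy
    exact ⟨(e, x), fun h' => hx h'.2, rfl⟩
  isClosed_of C hA hC := h.isClosed_of C hA fun e => hC.preimage (by fun_prop : Continuous fun x =>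
    ((e, x) : E × Ball (Fin n → ℝ)))

lemma relAcyclic {q : ℕ} (hq : q ≠ n) : RelAcyclic A q := by
  let _ : TopologicalSpace E := ⊥
  have : DiscreteTopology E := ⟨rfl⟩
  exact h.isRelHomeo.relAcyclic (bdryDeformation.prod E)
    (relAcyclic_prod ((ball_relHomology n).2 q hq))

omit h in
/-- A chain representing a generator of the relative homology of a ball modulo its boundary. -/
noncomputable def gen (n : ℕ) : Chain (n + 1) (Ball (Fin n → ℝ)) :=
  (ball_relHomology n).1.choose ()

lemma isRelBasis : IsRelBasis A n fun e => push (φ e) _ (gen n) := by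
  let _ : TopologicalSpace E := ⊥
  have : DiscreteTopology E := ⟨rfl⟩
  have := h.isRelHomeo.isRelBasis (bdryDeformation.prod E)
    (isRelBasis_prod (E := E) (ball_relHomology n).1.choose_spec)
  simp only [push_push] at this
  exact this

end IsCellAttachment

end SingularChain

namespace SingularChain

/-! ### Comparison with the singular chain complex -/

section Comparison

open Opposite

/-- The singular simplex of Mathlib corresponding to a map from a standard simplex. -/
noncomputable def toSimplex (Y : TopCat.{u}) (q : ℕ) :
    C(Splx (q + 1), Y) ≃ (TopCat.toSSet.obj Y).obj (op (SimplexCategory.mk q)) :=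
  (TopCat.toSSetObjEquiv Y (op (SimplexCategory.mk q))).symm

/-- The inclusion of the summand of a simplex. -/
noncomputable abbrev simplexIncl (Y : TopCat.{u}) {q : ℕ}
    (x : (TopCat.toSSet.obj Y).obj (op (SimplexCategory.mk q))) :
    ModuleCat.of ℤ (ULift.{u} ℤ) ⟶ (singularChains.obj Y).X q :=
  (TopCat.toSSet.obj Y).ιChainComplex x

/-- The comparison map from explicit chains to the singular chain complex. -/
noncomputable def toChain (Y : TopCat.{u}) (q : ℕ) :
    Chain (q + 1) Y →+ (singularChains.obj Y).X q :=
  Finsupp.liftAddHom fun σ =>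
    (simplexIncl Y (toSimplex Y q σ)).hom.toAddMonoidHom.comp
      AddEquiv.ulift.symm.toAddMonoidHom

lemma toChain_single (Y : TopCat.{u}) (q : ℕ) (σ : C(Splx (q + 1), Y)) (m : ℤ) :
    toChain Y q (Finsupp.single σ m) = simplexIncl Y (toSimplex Y q σ) ⟨m⟩ :=
  Finsupp.liftAddHom_apply_single _ _ _

lemma toChain_neg_one_pow_smul (Y : TopCat.{u}) (q k : ℕ) (c : Chain (q + 1) Y) :
    toChain Y q ((-1 : ℤ) ^ k • c) = (-1 : ℤ) ^ k • toChain Y q c := by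
  rcases neg_one_pow_eq_or ℤ k with h | h <;> rw [h] <;> simp

lemma d_toChain (Y : TopCat.{u}) (q : ℕ) (c : Chain (q + 2) Y) :
    (singularChains.obj Y).d (q + 1) q (toChain Y (q + 1) c) = toChain Y q (bd (q + 1) c) := by
  induction c using Finsupp.induction_linear with
  | zero => simp
  | add a b ha hb => simp only [map_add, ha, hb]
  | single σ m =>
    rw [toChain_single, bd_single, map_sum]
    have h := SSet.ιChainComplex_d (TopCat.toSSet.obj Y) (ModuleCat.of ℤ (ULift.{u} ℤ))
      (toSimplex Y (q + 1) σ)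
    refine (congrArg (fun f => f.hom ⟨m⟩) h).trans ?_
    simp only [ModuleCat.hom_sum, LinearMap.sum_apply]
    refine Finset.sum_congr rfl fun i _ => ?_
    rw [toChain_neg_one_pow_smul, toChain_single]
    rcases neg_one_pow_eq_or ℤ (i : ℕ) with h | h
    · simp only [h, one_smul]
      rfl
    · simp only [h, neg_one_zsmul, ModuleCat.hom_neg, LinearMap.neg_apply]
      rfl

lemma map_toChain {Y Z : TopCat.{u}} (f : Y ⟶ Z) (q : ℕ) (c : Chain (q + 1) Y) :
    (singularChains.map f).f q (toChain Y q c) = toChain Z q (push f.hom (q + 1) c) := by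
  induction c using Finsupp.induction_linear with
  | zero => simp
  | add a b ha hb => simp only [map_add, ha, hb]
  | single σ m =>
    rw [toChain_single, push_single, toChain_single]
    have h := SSet.ι_chainComplexMap_f _ _ (TopCat.toSSet.map f) (ModuleCat.of ℤ (ULift.{u} ℤ))
      (toSimplex Y q σ)
    exact congrArg (fun f => f.hom ⟨m⟩) h

/-- The chain module is a coproduct of copies of the integers indexed by simplices, so the inverse
is prescribed on summands. -/
lemma exists_ofChain (Y : TopCat.{u}) (q : ℕ) :
    ∃ g : (singularChains.obj Y).X q ⟶ ModuleCat.of ℤ (Chain (q + 1) Y),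
      ∀ x : (TopCat.toSSet.obj Y).obj (op (SimplexCategory.mk q)),
        simplexIncl Y x ≫ g = ModuleCat.ofHom
          (Finsupp.lsingle ((toSimplex Y q).symm x) ∘ₗ ULift.moduleEquiv.toLinearMap) := by
  refine ⟨Cofan.IsColimit.desc
    ((TopCat.toSSet.obj Y).isColimitChainComplexXCofan (ModuleCat.of ℤ (ULift.{u} ℤ)) q)
    fun x => ModuleCat.ofHom
      (Finsupp.lsingle ((toSimplex Y q).symm x) ∘ₗ ULift.moduleEquiv.toLinearMap), fun x => ?_⟩
  exact Cofan.IsColimit.fac _ _ x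

/-- The inverse of the comparison map. -/
noncomputable def ofChain (Y : TopCat.{u}) (q : ℕ) :
    (singularChains.obj Y).X q ⟶ ModuleCat.of ℤ (Chain (q + 1) Y) :=
  (exists_ofChain Y q).choose

lemma simplexIncl_ofChain (Y : TopCat.{u}) (q : ℕ)
    (x : (TopCat.toSSet.obj Y).obj (op (SimplexCategory.mk q))) :
    simplexIncl Y x ≫ ofChain Y q = ModuleCat.ofHom
      (Finsupp.lsingle ((toSimplex Y q).symm x) ∘ₗ ULift.moduleEquiv.toLinearMap) :=
  (exists_ofChain Y q).choose_spec x

lemma ofChain_toChain (Y : TopCat.{u}) (q : ℕ) (c : Chain (q + 1) Y) :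
    ofChain Y q (toChain Y q c) = c := by
  induction c using Finsupp.induction_linear with
  | zero => simp
  | add a b ha hb => simp only [map_add, ha, hb]
  | single σ m =>
    rw [toChain_single]
    refine (congrArg (fun f => f.hom ⟨m⟩) (simplexIncl_ofChain Y q (toSimplex Y q σ))).trans ?_
    simp

lemma toChain_ofChain (Y : TopCat.{u}) (q : ℕ) (c : (singularChains.obj Y).X q) :
    toChain Y q (ofChain Y q c) = c := by
  let L : Chain (q + 1) Y →ₗ[ℤ] (singularChains.obj Y).X q :=
    { toFun := toChain Y q
      map_add' := map_add _
      map_smul' := fun m x => by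
        simpa using map_intCast_smul (toChain Y q) ℤ ℤ m x }
  have : ofChain Y q ≫ ModuleCat.ofHom L = 𝟙 _ := by
    refine ((TopCat.toSSet.obj Y).isColimitChainComplexXCofan
      (ModuleCat.of ℤ (ULift.{u} ℤ)) q).hom_ext fun ⟨x⟩ => ?_
    change simplexIncl Y x ≫ _ = simplexIncl Y x ≫ _
    rw [← Category.assoc, simplexIncl_ofChain, Category.comp_id]
    refine ModuleCat.hom_ext (LinearMap.ext fun ⟨m⟩ => ?_)
    change toChain Y q (Finsupp.single ((toSimplex Y q).symm x) m) = _
    rw [toChain_single, Equiv.apply_symm_apply]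
  exact congrArg (fun f => f.hom c) this

lemma toChain_bijective (Y : TopCat.{u}) (q : ℕ) : Function.Bijective (toChain Y q) :=
  ⟨Function.LeftInverse.injective (ofChain_toChain Y q),
    Function.RightInverse.surjective (toChain_ofChain Y q)⟩

end Comparison

end SingularChain

/-! ### Homology classes of complexes of module-valued functors -/

namespace FunctorComplex

variable {J : Type u} [Category.{u} J] (K : ChainComplex (J ⥤ ModuleCat.{u} ℤ) ℕ) (n : ℕ) (A : J)

lemma exact_app {S : ShortComplex (J ⥤ ModuleCat.{u} ℤ)} (hS : S.Exact) (A : J)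
    (x : S.X₂.obj A) (hx : S.g.app A x = 0) : ∃ y, S.f.app A y = x := by
  have h := hS.map ((evaluation J (ModuleCat.{u} ℤ)).obj A)
  exact (ShortComplex.moduleCat_exact_iff _).mp h x hx

/-- Evaluation commutes with homology, and a functor vanishes when all its values do; diagram chases
may therefore be done on elements. -/
lemma exact_of_app {S : ShortComplex (J ⥤ ModuleCat.{u} ℤ)}
    (h : ∀ A (x : S.X₂.obj A), S.g.app A x = 0 → ∃ y, S.f.app A y = x) : S.Exact := by
  rw [ShortComplex.exact_iff_isZero_homology]
  refine (Functor.isZero_iff _).mpr fun A => ?_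
  have h2 : (S.map ((evaluation J (ModuleCat.{u} ℤ)).obj A)).Exact :=
    (ShortComplex.moduleCat_exact_iff _).mpr (h A)
  exact ((ShortComplex.exact_iff_isZero_homology _).mp h2).of_iso
    (S.mapHomologyIso ((evaluation J (ModuleCat.{u} ℤ)).obj A)).symm

lemma app_injective_of_mono {M N : J ⥤ ModuleCat.{u} ℤ} (f : M ⟶ N) [Mono f] (A : J) :
    Function.Injective (f.app A) :=
  (ModuleCat.mono_iff_injective _).mp inferInstance

lemma app_surjective_of_epi {M N : J ⥤ ModuleCat.{u} ℤ} (f : M ⟶ N) [Epi f] (A : J) :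
    Function.Surjective (f.app A) :=
  (ModuleCat.epi_iff_surjective _).mp inferInstance

/-- Elements of degree `n` killed by the differential. -/
def cycleSub : AddSubgroup ((K.X n).obj A) :=
  ⨅ j, ((K.d n j).app A).hom.toAddMonoidHom.ker

variable {K n A} in
lemma mem_cycleSub {x : (K.X n).obj A} : x ∈ cycleSub K n A ↔ ∀ j, (K.d n j).app A x = 0 := by
  simp only [cycleSub, AddSubgroup.mem_iInf]
  rfl

variable {K n A} in
lemma mem_cycleSub_succ {x : (K.X (n + 1)).obj A} :
    x ∈ cycleSub K (n + 1) A ↔ (K.d (n + 1) n).app A x = 0 := by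
  rw [mem_cycleSub]
  refine ⟨fun h => h n, fun h j => ?_⟩
  by_cases hj : j = n
  · exact hj ▸ h
  · rw [K.shape _ _ (by simpa using hj)]
    rfl

variable {K A} in
lemma mem_cycleSub_zero (x : (K.X 0).obj A) : x ∈ cycleSub K 0 A := by
  rw [mem_cycleSub]
  intro j
  rw [K.shape _ _ (by simp)]
  rfl

lemma exists_iCycles_eq (x : cycleSub K n A) : ∃ z, (K.iCycles n).app A z = x := by
  have h := ShortComplex.exact_of_f_is_kernel
    (ShortComplex.mk (K.iCycles n) (K.d n _) (K.iCycles_d n _)) (K.cyclesIsKernel n _ rfl)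
  exact exact_app h A x.1 (mem_cycleSub.mp x.2 _)

lemma iCycles_mem (z : (K.cycles n).obj A) : (K.iCycles n).app A z ∈ cycleSub K n A := by
  rw [mem_cycleSub]
  intro j
  rw [← ModuleCat.comp_apply, ← NatTrans.comp_app, K.iCycles_d]
  rfl

/-- The cycles of a complex of functors at an object. -/
noncomputable def cyclesEquiv : (K.cycles n).obj A ≃+ cycleSub K n A :=
  AddEquiv.ofBijective (((K.iCycles n).app A).hom.toAddMonoidHom.codRestrict _ (iCycles_mem K n A))
    ⟨fun _ _ h => app_injective_of_mono (K.iCycles n) A (congrArg Subtype.val h), fun x => by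
      obtain ⟨z, hz⟩ := exists_iCycles_eq K n A x
      exact ⟨z, Subtype.ext hz⟩⟩

lemma coe_cyclesEquiv (z : (K.cycles n).obj A) :
    (cyclesEquiv K n A z : (K.X n).obj A) = (K.iCycles n).app A z := rfl

/-- The homology class of a cycle. -/
noncomputable def homologyClass : cycleSub K n A →+ (K.homology n).obj A :=
  ((K.homologyπ n).app A).hom.toAddMonoidHom.comp (cyclesEquiv K n A).symm.toAddMonoidHom

lemma homologyClass_cyclesEquiv (z : (K.cycles n).obj A) :
    homologyClass K n A (cyclesEquiv K n A z) = (K.homologyπ n).app A z := by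
  change (K.homologyπ n).app A ((cyclesEquiv K n A).symm (cyclesEquiv K n A z)) = _
  rw [AddEquiv.symm_apply_apply]

lemma homologyClass_surjective : Function.Surjective (homologyClass K n A) := by
  intro y
  obtain ⟨z, rfl⟩ := app_surjective_of_epi (K.homologyπ n) A y
  exact ⟨cyclesEquiv K n A z, homologyClass_cyclesEquiv K n A z⟩

lemma homologyClass_eq_zero_iff (x : cycleSub K n A) :
    homologyClass K n A x = 0 ↔ ∃ y, (K.d (n + 1) n).app A y = x := by
  obtain ⟨z, rfl⟩ := (cyclesEquiv K n A).surjective x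
  rw [homologyClass_cyclesEquiv, coe_cyclesEquiv]
  have hto : ∀ y, (K.iCycles n).app A ((K.toCycles (n + 1) n).app A y) =
      (K.d (n + 1) n).app A y := fun y => by
    rw [← ModuleCat.comp_apply, ← NatTrans.comp_app, K.toCycles_i]
  constructor
  · intro h
    have hex := ShortComplex.exact_of_g_is_cokernel
      (ShortComplex.mk (K.toCycles (n + 1) n) (K.homologyπ n) (K.toCycles_comp_homologyπ _ _))
      (K.homologyIsCokernel (n + 1) n (by simp))
    obtain ⟨y, hy⟩ := exact_app hex A z h
    exact ⟨y, by rw [← hto]; exact congrArg _ hy⟩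
  · rintro ⟨y, hy⟩
    rw [← hto] at hy
    rw [← app_injective_of_mono (K.iCycles n) A hy, ← ModuleCat.comp_apply, ← NatTrans.comp_app,
      K.toCycles_comp_homologyπ]
    rfl

variable {A} in
lemma map_mem_cycleSub {B : J} (f : A ⟶ B) {x : (K.X n).obj A} (hx : x ∈ cycleSub K n A) :
    (K.X n).map f x ∈ cycleSub K n B := by
  rw [mem_cycleSub] at hx ⊢
  intro j
  rw [NatTrans.naturality_apply, hx, map_zero]

variable {A} in
lemma map_homologyClass {B : J} (f : A ⟶ B) (x : cycleSub K n A) :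
    (K.homology n).map f (homologyClass K n A x) =
      homologyClass K n B ⟨(K.X n).map f x, map_mem_cycleSub K n f x.2⟩ := by
  obtain ⟨z, rfl⟩ := (cyclesEquiv K n A).surjective x
  have e' : (⟨(K.X n).map f (cyclesEquiv K n A z).1,
      map_mem_cycleSub K n f (cyclesEquiv K n A z).2⟩ : cycleSub K n B) =
      cyclesEquiv K n B ((K.cycles n).map f z) :=
    Subtype.ext (by
      change (K.X n).map f ((K.iCycles n).app A z) =
        (K.iCycles n).app B ((K.cycles n).map f z)
      rw [NatTrans.naturality_apply])
  rw [e', homologyClass_cyclesEquiv, homologyClass_cyclesEquiv, NatTrans.naturality_apply]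

lemma isZero_homology (h : ∀ (A : J), ∀ x ∈ cycleSub K n A, ∃ y, (K.d (n + 1) n).app A y = x) :
    IsZero (K.homology n) := by
  refine (Functor.isZero_iff _).mpr fun A => ?_
  rw [ModuleCat.isZero_iff_subsingleton]
  refine ⟨fun a b => ?_⟩
  obtain ⟨x, rfl⟩ := homologyClass_surjective K n A a
  obtain ⟨y, rfl⟩ := homologyClass_surjective K n A b
  rw [(homologyClass_eq_zero_iff K n A x).mpr (h A x x.2),
    (homologyClass_eq_zero_iff K n A y).mpr (h A y y.2)]

end FunctorComplex

/-! ### Free modules over the orbit category -/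

namespace OrbitModule

open Opposite

variable {G : Type u} [Group G] {F : Set (Subgroup G)}

/-- The homomorphism from a free abelian group determined by elements `x i` of `M`. -/
noncomputable def freeHom {I : Type v} (M : OrbitModule F) (K : I → OrbitCat F)
    (x : ∀ i, M.obj (op (K i))) (a : OrbitCat F) : ((Σ i, a ⟶ K i) →₀ ℤ) →+ M.obj (op a) :=
  Finsupp.liftAddHom fun s => zmultiplesHom _ (M.map s.2.op (x s.1))

lemma freeHom_single {I : Type v} (M : OrbitModule F) (K : I → OrbitCat F)
    (x : ∀ i, M.obj (op (K i))) (a : OrbitCat F) (s : Σ i, a ⟶ K i) (m : ℤ) :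
    freeHom M K x a (Finsupp.single s m) = zmultiplesHom _ (M.map s.2.op (x s.1)) m :=
  Finsupp.liftAddHom_apply_single _ _ _

/-- The module `M` is free on elements `x i ∈ M(K i)`. -/
def IsFreeOn {I : Type v} (M : OrbitModule F) (K : I → OrbitCat F)
    (x : ∀ i, M.obj (op (K i))) : Prop :=
  ∀ a, Function.Bijective (freeHom M K x a)

variable {I : Type v} {M : OrbitModule F} {K : I → OrbitCat F} {x : ∀ i, M.obj (op (K i))}

lemma map_freeHom (M : OrbitModule F) (x : ∀ i, M.obj (op (K i))) {a b : OrbitCat F} (f : b ⟶ a)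
    (m : (Σ i, a ⟶ K i) →₀ ℤ) :
    M.map f.op (freeHom M K x a m) =
      freeHom M K x b (Finsupp.mapDomain (fun s => ⟨s.1, f ≫ s.2⟩) m) := by
  induction m using Finsupp.induction_linear with
  | zero => simp
  | add m m' h h' => simp only [map_add, h, h', Finsupp.mapDomain_add]
  | single s k =>
    rw [Finsupp.mapDomain_single, freeHom_single, freeHom_single]
    change (M.map f.op).hom.toAddMonoidHom _ = _
    simp only [zmultiplesHom_apply, map_zsmul, op_comp, Functor.map_comp]
    rfl

lemma app_freeHom {N : OrbitModule F} (φ : M ⟶ N) (a : OrbitCat F) (m : (Σ i, a ⟶ K i) →₀ ℤ) :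
    φ.app (op a) (freeHom M K x a m) = freeHom N K (fun i => φ.app _ (x i)) a m := by
  induction m using Finsupp.induction_linear with
  | zero => simp
  | add m m' h h' => simp only [map_add, h, h']
  | single s k =>
    rw [freeHom_single, freeHom_single]
    change (φ.app (op a)).hom.toAddMonoidHom _ = _
    simp only [zmultiplesHom_apply, map_zsmul]
    congr 1
    exact NatTrans.naturality_apply φ s.2.op (x s.1)

namespace IsFreeOn

lemma hom_ext (h : IsFreeOn M K x) {N : OrbitModule F} {φ ψ : M ⟶ N}
    (e : ∀ i, φ.app _ (x i) = ψ.app _ (x i)) : φ = ψ := by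
  ext a y
  obtain ⟨m, rfl⟩ := (h a.unop).surjective y
  exact (app_freeHom φ a.unop m).trans
    ((congrArg (fun z => freeHom N K z a.unop m) (funext e)).trans (app_freeHom ψ a.unop m).symm)

lemma exists_hom (h : IsFreeOn M K x) (N : OrbitModule F) (y : ∀ i, N.obj (op (K i))) :
    ∃ φ : M ⟶ N, ∀ i, φ.app _ (x i) = y i := by
  let L (a : OrbitCat F) : M.obj (op a) →+ N.obj (op a) :=
    (freeHom N K y a).comp (AddEquiv.ofBijective _ (h a)).symm.toAddMonoidHom
  have hL (a : OrbitCat F) (m : _) : L a (freeHom M K x a m) = freeHom N K y a m :=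
    congrArg (freeHom N K y a) ((AddEquiv.ofBijective _ (h a)).symm_apply_apply m)
  refine ⟨{ app := fun a => ModuleCat.ofHom
              { toFun := L a.unop
                map_add' := map_add _
                map_smul' := fun k z => by
                  simpa using map_intCast_smul (L a.unop) ℤ ℤ k z }
            naturality := ?_ }, ?_⟩
  · intro a b f
    ext z
    obtain ⟨m, rfl⟩ := (h a.unop).surjective z
    change L b.unop (M.map f _) = N.map f (L a.unop _)
    rw [hL]
    exact (congrArg (L b.unop) (map_freeHom M x f.unop m)).trans
      ((hL _ _).trans (map_freeHom N y f.unop m).symm)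
  · intro i
    change L (K i) (x i) = y i
    -- The generator at `i` is the basis element indexed by the identity of `K i`, as in the Yoneda
    -- lemma.
    have e (P : OrbitModule F) (z : ∀ i, P.obj (op (K i))) :
        freeHom P K z (K i) (Finsupp.single ⟨i, 𝟙 _⟩ 1) = z i := by
      rw [freeHom_single, zmultiplesHom_apply, one_smul]
      simp
    rw [← e M x, hL, e N y]

/-- Epimorphisms are objectwise surjective, so the images of the generators can be lifted one at a
time. -/
lemma projective (h : IsFreeOn M K x) : Projective M where
  factors {E Z} f e _ := by
    choose y hy using fun i =>
      FunctorComplex.app_surjective_of_epi e (op (K i)) (f.app _ (x i))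
    obtain ⟨φ, hφ⟩ := h.exists_hom E y
    exact ⟨φ, h.hom_ext fun i => by
      change e.app _ (φ.app _ (x i)) = _
      rw [hφ, hy]⟩

end IsFreeOn

/-- The canonical generator of `A_P`. -/
noncomputable def orbitFreeGen (P : OrbitCat F) : (orbitFree P).obj (op P) :=
  (Finsupp.single (𝟙 P) 1 : (P ⟶ P) →₀ ℤ)

lemma map_orbitFreeGen (P : OrbitCat F) {a : OrbitCat F} (f : a ⟶ P) :
    (orbitFree P).map f.op (orbitFreeGen P) = (Finsupp.single f 1 : (a ⟶ P) →₀ ℤ) :=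
  (Finsupp.mapDomain_single).trans
    (congrArg (fun t => Finsupp.single t (1 : ℤ)) (Category.comp_id f))

lemma freeHom_orbitFreeGen (P : OrbitCat F) (a : OrbitCat F) (m : (Σ _ : Unit, a ⟶ P) →₀ ℤ) :
    freeHom (orbitFree P) (fun _ : Unit => P) (fun _ => orbitFreeGen P) a m =
      Finsupp.domCongr (M := ℤ) (Equiv.uniqueSigma fun _ : Unit => (a ⟶ P)) m := by
  induction m using Finsupp.induction_linear with
  | zero => rw [map_zero, map_zero]; rfl
  | add m m' h h' => rw [map_add, h, h', map_add]; rfl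
  | single s k =>
    rw [freeHom_single, zmultiplesHom_apply, map_orbitFreeGen]
    change k • (Finsupp.single s.2 1 : (a ⟶ P) →₀ ℤ) = Finsupp.equivMapDomain _ _
    rw [Finsupp.equivMapDomain_single, Finsupp.smul_single]
    simp [Equiv.uniqueSigma]

lemma isFreeOn_orbitFree (P : OrbitCat F) :
    IsFreeOn (orbitFree P) (fun _ : Unit => P) fun _ => orbitFreeGen P := by
  intro a
  refine (congrArg Function.Bijective (funext (freeHom_orbitFreeGen P a))).mpr ?_
  exact (Finsupp.domCongr (M := ℤ) (Equiv.uniqueSigma fun _ : Unit => (a ⟶ P))).bijective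

end OrbitModule

/-! ### The relative chains of a pair of skeleta -/

namespace SkeletonPair

open Opposite SingularChain OrbitModule

variable {G : Type u} [Group G] (F : Set (Subgroup G)) {X : Type u} [TopologicalSpace X]
  [T2Space X] [Topology.CWComplex (Set.univ : Set X)] [MulAction G X] [ContinuousConstSMul G X]
  (hX : IsGCWComplex G X) (p : ℕ)

/-- The subspace `(X^H)_{<p}` of `(X^H)_{<p+1}`. -/
def lowerSkeleton (H : Subgroup G) : Set (fixedSkeleton X H (p + 1)) :=
  {x | x.1 ∈ fixedSkeleton X H p}

/-- The map `X^K → X^H` of skeleta of fixed point sets given by a morphism `G ⧸ H → G ⧸ K`. -/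
noncomputable def fixedMap {a b : OrbitCat F} (f : a ⟶ b) :
    C(fixedSkeleton X b.subgroup p, fixedSkeleton X a.subgroup p) :=
  ((fixedSkeletonFunctor F hX p).map f.op).hom

lemma coe_fixedMap {a b : OrbitCat F} (f : a ⟶ b) (x : fixedSkeleton X b.subgroup p) :
    (fixedMap F hX p f x : X) = (f.toFun ((1 : G) : G ⧸ a.subgroup)).out • x.1 := rfl

lemma mapsTo_fixedMap {a b : OrbitCat F} (f : a ⟶ b) :
    Set.MapsTo (fixedMap F hX (p + 1) f) (lowerSkeleton p b.subgroup)
      (lowerSkeleton p a.subgroup) := by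
  intro x hx
  rw [lowerSkeleton, Set.mem_ofPred_eq, coe_fixedMap]
  exact hX.smul_mem_fixedSkeleton f p hx

/-- The class of a singular chain of `(X^H)_{<p+1}` in the relative chains. -/
noncomputable def relClass (q : ℕ) (a : OrbitCat F) :
    Chain (q + 1) (fixedSkeleton X a.subgroup (p + 1)) →+
      ((skeletonPair F hX p).X₃.X q).obj (op a) :=
  (((skeletonPair F hX p).g.f q).app (op a)).hom.toAddMonoidHom.comp
    (toChain (TopCat.of (fixedSkeleton X a.subgroup (p + 1))) q)

lemma relClass_surjective (q : ℕ) (a : OrbitCat F) :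
    Function.Surjective (relClass F hX p q a) := by
  have : Epi (skeletonPair F hX p).g := (skeletonPair_shortExact F hX p).epi_g
  have : Epi ((skeletonPair F hX p).g.f q) := inferInstance
  exact (FunctorComplex.app_surjective_of_epi ((skeletonPair F hX p).g.f q) (op a)).comp
    (toChain_bijective (TopCat.of (fixedSkeleton X a.subgroup (p + 1))) q).surjective

/-- Exactness in each degree identifies the kernel with the chains coming from the smaller skeleton,
which are those supported in it. -/
lemma relClass_eq_zero_iff (q : ℕ) (a : OrbitCat F)
    (c : Chain (q + 1) (fixedSkeleton X a.subgroup (p + 1))) :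
    relClass F hX p q a c = 0 ↔ c ∈ chainsIn (q + 1) (lowerSkeleton p a.subgroup) := by
  have hS := (skeletonPair_shortExact F hX p).map_of_exact (HomologicalComplex.eval _ _ q)
  let f := ((fixedSkeletonIncl F hX p).app (op a))
  have hf : ∀ b, ((skeletonPair F hX p).f.f q).app (op a)
      (toChain ((fixedSkeletonFunctor F hX p).obj (op a)) q b) =
      toChain ((fixedSkeletonFunctor F hX (p + 1)).obj (op a)) q (push f.hom _ b) :=
    fun b => map_toChain f q b
  have hz : ∀ z, ((skeletonPair F hX p).g.f q).app (op a)
      (((skeletonPair F hX p).f.f q).app (op a) z) = 0 := fun z => by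
    rw [← ModuleCat.comp_apply, ← NatTrans.comp_app, ← HomologicalComplex.comp_f,
      (skeletonPair F hX p).zero]
    rfl
  constructor
  · intro h
    obtain ⟨y, hy⟩ := FunctorComplex.exact_app hS.exact (op a)
      (toChain (TopCat.of (fixedSkeleton X a.subgroup (p + 1))) q c) h
    obtain ⟨b, rfl⟩ :=
      (toChain_bijective (TopCat.of (fixedSkeleton X a.subgroup p)) q).surjective y
    have : push f.hom _ b = c :=
      (toChain_bijective (TopCat.of (fixedSkeleton X a.subgroup (p + 1))) q).injective
        ((hf b).symm.trans hy)
    rw [← this]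
    exact push_mem_chainsIn (U := Set.univ) (fun x _ => x.2) (mem_chainsIn_univ b)
  · intro h
    obtain ⟨b, -, hb⟩ := exists_push_eq (f := f.hom) (S := Set.univ)
      (U := lowerSkeleton p a.subgroup) (fun x => ⟨x.1.1, x.2⟩) (by fun_prop)
      (fun _ => Set.mem_univ _) (fun _ => rfl) h
    rw [← hb]
    exact (congrArg (((skeletonPair F hX p).g.f q).app (op a)) (hf b)).symm.trans (hz _)

lemma relClass_d (q : ℕ) (a : OrbitCat F)
    (c : Chain (q + 2) (fixedSkeleton X a.subgroup (p + 1))) :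
    ((skeletonPair F hX p).X₃.d (q + 1) q).app (op a) (relClass F hX p (q + 1) a c) =
      relClass F hX p q a (bd (q + 1) c) := by
  change _ = ((skeletonPair F hX p).g.f q).app (op a) (toChain (TopCat.of _) q _)
  rw [← d_toChain]
  change (((skeletonPair F hX p).g.f (q + 1) ≫ (skeletonPair F hX p).X₃.d (q + 1) q).app (op a))
    (toChain (TopCat.of _) (q + 1) c) = _
  rw [(skeletonPair F hX p).g.comm]
  rfl

lemma map_relClass (q : ℕ) {a b : OrbitCat F} (f : b ⟶ a)
    (c : Chain (q + 1) (fixedSkeleton X a.subgroup (p + 1))) :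
    ((skeletonPair F hX p).X₃.X q).map f.op (relClass F hX p q a c) =
      relClass F hX p q b (push (fixedMap F hX (p + 1) f) _ c) := by
  have h := NatTrans.naturality_apply ((skeletonPair F hX p).g.f q) f.op
    (toChain (TopCat.of (fixedSkeleton X a.subgroup (p + 1))) q c)
  refine h.symm.trans (congrArg (((skeletonPair F hX p).g.f q).app (op b)) ?_)
  exact map_toChain ((fixedSkeletonFunctor F hX (p + 1)).map f.op) q c

lemma relClass_mem_cycleSub_iff (q : ℕ) (a : OrbitCat F)
    (c : Chain (q + 1) (fixedSkeleton X a.subgroup (p + 1))) :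
    relClass F hX p q a c ∈ FunctorComplex.cycleSub (skeletonPair F hX p).X₃ q (op a) ↔
      bd q c ∈ chainsIn q (lowerSkeleton p a.subgroup) := by
  cases q with
  | zero => exact iff_of_true (FunctorComplex.mem_cycleSub_zero _) (mem_chainsIn_zero _)
  | succ q => rw [FunctorComplex.mem_cycleSub_succ, relClass_d, relClass_eq_zero_iff]

lemma isZero_homology {q : ℕ}
    (h : ∀ a : OrbitCat F, RelAcyclic (lowerSkeleton (X := X) p a.subgroup) q) :
    IsZero ((skeletonPair F hX p).X₃.homology q) := by
  refine FunctorComplex.isZero_homology _ _ ?_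
  rintro ⟨a⟩ x hx
  obtain ⟨c, rfl⟩ := relClass_surjective F hX p q a x
  obtain ⟨d, hd⟩ := h a c ((relClass_mem_cycleSub_iff F hX p q a c).mp hx)
  refine ⟨relClass F hX p (q + 1) a d, ?_⟩
  rw [relClass_d, eq_comm, ← sub_eq_zero, ← map_sub, relClass_eq_zero_iff]
  exact hd

/-- The relative cycles. -/
noncomputable def relCycles (q : ℕ) (a : OrbitCat F) :
    AddSubgroup (Chain (q + 1) (fixedSkeleton X a.subgroup (p + 1))) :=
  (chainsIn q (lowerSkeleton p a.subgroup)).toAddSubgroup.comap (bd q).toAddMonoidHom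

/-- The homology class of a relative cycle. -/
noncomputable def relHomologyClass (q : ℕ) (a : OrbitCat F) :
    relCycles F (X := X) p q a →+ ((skeletonPair F hX p).X₃.homology q).obj (op a) :=
  (FunctorComplex.homologyClass _ q (op a)).comp
    (((relClass F hX p q a).comp (AddSubgroup.subtype _)).codRestrict _ fun c =>
      (relClass_mem_cycleSub_iff F hX p q a c).mpr c.2)

lemma relHomologyClass_apply (q : ℕ) (a : OrbitCat F) (c : relCycles F (X := X) p q a) :
    relHomologyClass F hX p q a c =
      FunctorComplex.homologyClass (skeletonPair F hX p).X₃ q (op a)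
        ⟨relClass F hX p q a c, (relClass_mem_cycleSub_iff F hX p q a c).mpr c.2⟩ := rfl

lemma relHomologyClass_surjective (q : ℕ) (a : OrbitCat F) :
    Function.Surjective (relHomologyClass F hX p q a) := by
  intro y
  obtain ⟨⟨z, hz⟩, rfl⟩ := FunctorComplex.homologyClass_surjective _ _ _ y
  obtain ⟨c, rfl⟩ := relClass_surjective F hX p q a z
  exact ⟨⟨c, (relClass_mem_cycleSub_iff F hX p q a c).mp hz⟩, rfl⟩

lemma relHomologyClass_eq_zero_iff (q : ℕ) (a : OrbitCat F) (c : relCycles F (X := X) p q a) :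
    relHomologyClass F hX p q a c = 0 ↔
      ∃ d, c.1 - bd (q + 1) d ∈ chainsIn (q + 1) (lowerSkeleton p a.subgroup) := by
  refine (FunctorComplex.homologyClass_eq_zero_iff _ q (op a) _).trans ?_
  refine ((relClass_surjective F hX p (q + 1) a).exists).trans (exists_congr fun d => ?_)
  change ((skeletonPair F hX p).X₃.d (q + 1) q).app (op a) (relClass F hX p (q + 1) a d) =
    relClass F hX p q a c ↔ _
  rw [relClass_d, eq_comm, ← sub_eq_zero, ← map_sub, relClass_eq_zero_iff]

lemma push_mem_relCycles (q : ℕ) {a b : OrbitCat F} (f : b ⟶ a) (c : relCycles F (X := X) p q a) :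
    push (fixedMap F hX (p + 1) f) _ c.1 ∈ relCycles F (X := X) p q b := by
  have hc : bd q c.1 ∈ chainsIn q (lowerSkeleton p a.subgroup) := c.2
  have := push_mem_chainsIn (mapsTo_fixedMap F hX p f) hc
  rwa [← bd_push] at this

lemma map_relHomologyClass (q : ℕ) {a b : OrbitCat F} (f : b ⟶ a)
    (c : relCycles F (X := X) p q a) :
    ((skeletonPair F hX p).X₃.homology q).map f.op (relHomologyClass F hX p q a c) =
      relHomologyClass F hX p q b ⟨_, push_mem_relCycles F hX p q f c⟩ := by
  rw [relHomologyClass_apply, FunctorComplex.map_homologyClass, relHomologyClass_apply]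
  have h := map_relClass F hX p q f c.1
  congr 2

/-- Freeness over the orbit category means that at each object the restrictions of the generators
along all morphisms form a basis of an abelian group; the hypothesis says this at the level of
chains. -/
lemma isFreeOn_homology {I : Type v} (K : I → OrbitCat F)
    (γ : ∀ i, relCycles F (X := X) p p (K i))
    (h : ∀ a : OrbitCat F, IsRelBasis (lowerSkeleton (X := X) p a.subgroup) p
      fun s : Σ i, a ⟶ K i => push (fixedMap F hX (p + 1) s.2) _ (γ s.1).1) :
    IsFreeOn ((skeletonPair F hX p).X₃.homology p) K fun i =>
      relHomologyClass F hX p p (K i) (γ i) := by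
  intro a
  set δ : (Σ i, a ⟶ K i) → Chain (p + 1) (fixedSkeleton X a.subgroup (p + 1)) := fun s =>
    push (fixedMap F hX (p + 1) s.2) _ (γ s.1).1 with hδ
  have mem : ∀ m : (Σ i, a ⟶ K i) →₀ ℤ,
      Finsupp.linearCombination ℤ δ m ∈ relCycles F (X := X) p p a := fun m =>
    bd_linearCombination_mem (h a).bd_mem m
  have key : ∀ m, freeHom ((skeletonPair F hX p).X₃.homology p) K
      (fun i => relHomologyClass F hX p p (K i) (γ i)) a m =
      relHomologyClass F hX p p a ⟨_, mem m⟩ := by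
    intro m
    induction m using Finsupp.induction_linear with
    | zero =>
      rw [map_zero, eq_comm]
      exact (congrArg _ (Subtype.ext (map_zero _))).trans (map_zero _)
    | add m m' e e' =>
      rw [map_add, e, e', ← map_add]
      exact congrArg _ (Subtype.ext (map_add _ _ _).symm)
    | single s k =>
      rw [freeHom_single, zmultiplesHom_apply, map_relHomologyClass, ← map_zsmul]
      refine congrArg _ (Subtype.ext ?_)
      exact (Finsupp.linearCombination_single (v := δ) ℤ k s).symm
  constructor
  · rw [injective_iff_map_eq_zero]
    intro m hm
    rw [key, relHomologyClass_eq_zero_iff] at hm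
    obtain ⟨d, hd⟩ := hm
    exact (h a).eq_zero m d hd
  · intro y
    obtain ⟨c, rfl⟩ := relHomologyClass_surjective F hX p p a y
    obtain ⟨m, d, hd⟩ := (h a).exists_sub c.1 c.2
    refine ⟨m, ?_⟩
    rw [key, eq_comm, ← sub_eq_zero, ← map_sub, relHomologyClass_eq_zero_iff]
    exact ⟨d, hd⟩

end SkeletonPair

/-! ### Morphisms of the orbit category -/

namespace OrbitCat

variable {G : Type u} [Group G] {F : Set (Subgroup G)}

lemma hom_ext {a b : OrbitCat F} {f f' : a ⟶ b}
    (h : f.toFun ((1 : G) : G ⧸ a.subgroup) = f'.toFun ((1 : G) : G ⧸ a.subgroup)) : f = f' := by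
  refine MulActionHom.ext fun x => ?_
  obtain ⟨g, rfl⟩ := QuotientGroup.mk_surjective x
  have e : ((g : G) : G ⧸ a.subgroup) = g • ((1 : G) : G ⧸ a.subgroup) := by
    rw [MulAction.Quotient.smul_coe, smul_eq_mul, mul_one]
  rw [e]
  exact (f.map_smul' g _).trans ((congrArg (g • ·) h).trans (f'.map_smul' g _).symm)

/-- The morphism `x H ↦ x g K`. -/
def homMk {a b : OrbitCat F} (g : G) (h : ∀ x ∈ a.subgroup, g⁻¹ * x * g ∈ b.subgroup) :
    a ⟶ b where
  toFun := Quotient.map' (· * g) fun x y hxy => by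
    rw [QuotientGroup.leftRel_apply] at hxy ⊢
    have := h _ hxy
    simpa [mul_assoc] using this
  map_smul' m x := by
    obtain ⟨y, rfl⟩ := QuotientGroup.mk_surjective x
    exact congrArg (QuotientGroup.mk (s := b.subgroup)) (mul_assoc m y g)

lemma homMk_one {a b : OrbitCat F} (g : G) (h : ∀ x ∈ a.subgroup, g⁻¹ * x * g ∈ b.subgroup) :
    (homMk g h).toFun ((1 : G) : G ⧸ a.subgroup) = (g : G ⧸ b.subgroup) :=
  congrArg (QuotientGroup.mk (s := b.subgroup)) (one_mul g)

lemma conj_mem {a b : OrbitCat F} (f : a ⟶ b) {g : G}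
    (hg : f.toFun ((1 : G) : G ⧸ a.subgroup) = (g : G ⧸ b.subgroup)) {x : G}
    (hx : x ∈ a.subgroup) : g⁻¹ * x * g ∈ b.subgroup := by
  have h1 : x • ((1 : G) : G ⧸ a.subgroup) = ((1 : G) : G ⧸ a.subgroup) := by
    rw [MulAction.Quotient.smul_coe, QuotientGroup.eq]
    simpa using a.subgroup.inv_mem hx
  have h2 := f.map_smul' x ((1 : G) : G ⧸ a.subgroup)
  rw [h1] at h2
  change f.toFun _ = x • f.toFun _ at h2
  rw [hg, MulAction.Quotient.smul_coe, QuotientGroup.eq] at h2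
  simpa [mul_assoc] using h2

end OrbitCat

/-! ### Cells of a `G`-CW-complex -/

namespace IsGCWComplex

open Topology Topology.RelCWComplex SingularChain

variable {G : Type u} [Group G] {X : Type u} [TopologicalSpace X]
  [T2Space X] [CWComplex (Set.univ : Set X)] [MulAction G X] [ContinuousConstSMul G X]
  (hX : IsGCWComplex G X)

lemma smul_closedCell {g : G} {n : ℕ} {e e' : cell (Set.univ : Set X) n}
    (h : g • openCell n e = openCell n e') : g • closedCell n e = closedCell n e' := by
  rw [← closure_openCell_eq_closedCell, ← closure_openCell_eq_closedCell, ← closure_smul, h]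

variable (G X) in
/-- Two cells are equivalent if they are in the same orbit. -/
def cellSetoid (n : ℕ) : Setoid (cell (Set.univ : Set X) n) where
  r e e' := ∃ g : G, g • openCell n e = openCell n e'
  iseqv :=
    { refl := fun e => ⟨1, one_smul _ _⟩
      symm := fun ⟨g, h⟩ => ⟨g⁻¹, by rw [← h, inv_smul_smul]⟩
      trans := fun ⟨g, h⟩ ⟨g', h'⟩ => ⟨g' * g, by rw [mul_smul, h, h']⟩ }

variable (G X) in
/-- The orbits of `n`-cells. -/
def CellOrbit (n : ℕ) : Type u := Quotient (cellSetoid G X n)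

/-- A cell in an orbit of cells. -/
noncomputable def rep {n : ℕ} (i : CellOrbit G X n) : cell (Set.univ : Set X) n := Quotient.out i

/-- The centre of a representative of an orbit of cells. -/
noncomputable def centre (s : Σ n, CellOrbit G X n) : X := map s.1 (rep s.2) 0

lemma centre_mem (s : Σ n, CellOrbit G X n) : centre s ∈ openCell s.1 (rep s.2) :=
  map_zero_mem_openCell _ _

include hX

/-- In a Hausdorff space the fixed points of `g` are closed, so admissibility extends from the open
cell to its closure. -/
lemma smul_eq_of_mem_closedCell {g : G} {n : ℕ} {e : cell (Set.univ : Set X) n}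
    (h : g • openCell n e = openCell n e) {x : X} (hx : x ∈ closedCell n e) : g • x = x := by
  have hc : IsClosed {x : X | g • x = x} := isClosed_eq (continuous_const_smul g) continuous_id
  rw [← closure_openCell_eq_closedCell] at hx
  exact closure_minimal (fun y hy => hX.admissible g n e h y hy) hc hx

lemma smul_openCell_eq_of_mem {g : G} {n : ℕ} {e e' : cell (Set.univ : Set X) n} {x : X}
    (hx : x ∈ openCell n e) (h : g • x ∈ openCell n e') : g • openCell n e = openCell n e' := by
  obtain ⟨e'', he⟩ := hX.smul_openCell g n e
  have := eq_of_not_disjoint_openCell (j := e') (i := e'')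
    (Set.not_disjoint_iff.mpr ⟨_, h, he ▸ Set.smul_mem_smul_set hx⟩)
  rw [he]
  cases this
  rfl

lemma exists_smul_rep {n : ℕ} (e : cell (Set.univ : Set X) n) :
    ∃ (i : CellOrbit G X n) (g : G), g • openCell n (rep i) = openCell n e := by
  let := cellSetoid G X n
  exact ⟨Quotient.mk _ e, Quotient.mk_out e⟩

lemma eq_of_smul_rep {n : ℕ} {i i' : CellOrbit G X n} {g g' : G}
    (h : g • openCell n (rep i) = g' • openCell n (rep i')) : i = i' := by
  let := cellSetoid G X n
  refine Quotient.out_equiv_out.mp ⟨g'⁻¹ * g, ?_⟩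
  rw [mul_smul, inv_smul_eq_iff]
  exact h

lemma eq_of_smul_mem {n n' : ℕ} {i : CellOrbit G X n} {i' : CellOrbit G X n'} {g g' : G} {x x' : X}
    (hx : x ∈ openCell n (rep i)) (hx' : x' ∈ openCell n' (rep i'))
    (h : g • x = g' • x') : (⟨n, i⟩ : Σ n, CellOrbit G X n) = ⟨n', i'⟩ := by
  obtain ⟨e, he⟩ := hX.smul_openCell g n (rep i)
  obtain ⟨e', he'⟩ := hX.smul_openCell g' n' (rep i')
  have := eq_of_not_disjoint_openCell (j := e) (i := e') (Set.not_disjoint_iff.mpr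
    ⟨g • x, he ▸ Set.smul_mem_smul_set hx, h ▸ he' ▸ Set.smul_mem_smul_set hx'⟩)
  cases this
  rw [hX.eq_of_smul_rep (he.trans he'.symm)]

/-! ### Finiteness -/

omit hX in
lemma finite_inter_closedCell {U : Set X}
    (h : ∀ n (e : cell (Set.univ : Set X) n), (U ∩ openCell n e).Subsingleton) (n : ℕ)
    (e : cell (Set.univ : Set X) n) : (U ∩ closedCell n e).Finite := by
  obtain ⟨I, hI⟩ := CWComplex.cellFrontier_subset_finite_openCell n e
  have : U ∩ closedCell n e ⊆ (U ∩ openCell n e) ∪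
      ⋃ m ∈ Finset.range n, ⋃ j ∈ I m, U ∩ openCell m j := by
    rintro x ⟨hxU, hx⟩
    rw [← cellFrontier_union_openCell_eq_closedCell] at hx
    rcases hx with hx | hx
    · have := hI hx
      simp only [Set.mem_iUnion] at this
      obtain ⟨m, hm, j, hj, hxj⟩ := this
      refine Or.inr ?_
      simp only [Set.mem_iUnion]
      exact ⟨m, Finset.mem_range.mpr hm, j, hj, hxU, hxj⟩
    · exact Or.inl ⟨hxU, hx⟩
  refine Set.Finite.subset ((h n e).finite.union ?_) this
  exact (Finset.range n).finite_toSet.biUnion fun m _ =>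
    (I m).finite_toSet.biUnion fun j _ => (h m j).finite

/-- By admissibility the set meets each open cell in at most one point. A closed cell is covered by
finitely many open cells, so the intersection with it is finite. -/
lemma isClosed_orbits (T : Set (Σ n, CellOrbit G X n)) :
    IsClosed {x : X | ∃ s ∈ T, ∃ g : G, g • centre s = x} := by
  refine CWComplex.isClosed_of_disjoint_openCell_or_isClosed_inter_closedCell
    (C := (Set.univ : Set X)) (Set.subset_univ _) fun n _ e => Or.inr ?_
  refine (finite_inter_closedCell ?_ n e).isClosed
  rintro m e' x ⟨⟨s, hs, g, rfl⟩, hx⟩ y ⟨⟨s', hs', g', rfl⟩, hy⟩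
  obtain ⟨n1, i1⟩ := s
  obtain ⟨n2, i2⟩ := s'
  have c1 := centre_mem ⟨n1, i1⟩
  have c2 := centre_mem ⟨n2, i2⟩
  obtain ⟨e1, he1⟩ := hX.smul_openCell g n1 (rep i1)
  obtain ⟨e2, he2⟩ := hX.smul_openCell g' n2 (rep i2)
  have h1 := eq_of_not_disjoint_openCell (j := e1) (i := e') (Set.not_disjoint_iff.mpr
    ⟨_, he1 ▸ Set.smul_mem_smul_set c1, hx⟩)
  have h2 := eq_of_not_disjoint_openCell (j := e2) (i := e') (Set.not_disjoint_iff.mpr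
    ⟨_, he2 ▸ Set.smul_mem_smul_set c2, hy⟩)
  cases h1
  cases h2
  obtain rfl := hX.eq_of_smul_rep (he1.trans he2.symm)
  have : (g'⁻¹ * g) • openCell _ (rep i1) = openCell _ (rep i1) := by
    rw [mul_smul, inv_smul_eq_iff, he1, he2]
  have := hX.admissible _ _ _ this _ c1
  rwa [mul_smul, inv_smul_eq_iff] at this

/-- One centre per orbit of cells embeds the discrete set of orbits as a closed subset of the
compact space `X/G`: every set of centres has closed saturation. -/
theorem finite_cellOrbit (hc : IsCocompactAction G X) : Finite (Σ n, CellOrbit G X n) := by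
  let : TopologicalSpace (Σ n, CellOrbit G X n) := ⊥
  have : DiscreteTopology (Σ n, CellOrbit G X n) := ⟨rfl⟩
  have : CompactSpace (MulAction.orbitRel.Quotient G X) := hc
  let p : (Σ n, CellOrbit G X n) → MulAction.orbitRel.Quotient G X := fun s =>
    Quotient.mk'' (centre s)
  have hp : Topology.IsClosedEmbedding p := by
    refine Topology.IsClosedEmbedding.of_continuous_injective_isClosedMap
      continuous_of_discreteTopology ?_ ?_
    · intro s s' h
      obtain ⟨g, hg⟩ := Quotient.eq''.mp h
      have hg' : g • centre s' = centre s := hg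
      exact (hX.eq_of_smul_mem (centre_mem s') (centre_mem s) (g := g) (g' := 1)
        (by rw [one_smul, hg'])).symm
    · intro T _
      refine isQuotientMap_quotient_mk'.isClosed_preimage.mp ?_
      convert hX.isClosed_orbits T using 1
      ext x
      constructor
      · rintro ⟨s, hs, h⟩
        obtain ⟨g, hg⟩ := Quotient.eq''.mp h.symm
        exact ⟨s, hs, g, hg⟩
      · rintro ⟨s, hs, g, rfl⟩
        exact ⟨s, hs, (Quotient.eq''.mpr ⟨g, rfl⟩ : Quotient.mk'' (g • centre s) =
          (Quotient.mk'' (centre s) : MulAction.orbitRel.Quotient G X)).symm⟩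
  have := hp.compactSpace
  exact finite_of_compact_of_discrete

theorem exists_skeletonLT_eq_univ (hc : IsCocompactAction G X) :
    ∃ N : ℕ, ∀ n ≥ N, IsEmpty (CellOrbit G X n) ∧
      (skeletonLT (Set.univ : Set X) (n : ℕ∞) : Set X) = Set.univ := by
  have := hX.finite_cellOrbit hc
  obtain ⟨N, hN⟩ := (Set.finite_range fun s : Σ n, CellOrbit G X n => s.1).bddAbove
  have hE : ∀ n ≥ N + 1, IsEmpty (CellOrbit G X n) := fun n hn =>
    ⟨fun i => absurd (hN ⟨⟨n, i⟩, rfl⟩) (by simp; omega)⟩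
  refine ⟨N + 1, fun n hn => ⟨hE n hn, ?_⟩⟩
  refine Set.eq_univ_of_univ_subset ?_
  refine (CWComplex.iUnion_openCell_eq_complex (C := (Set.univ : Set X))).symm.subset.trans ?_
  rw [← CWComplex.iUnion_openCell_eq_skeletonLT]
  simp only [Set.iUnion_subset_iff]
  intro m e x hx
  simp only [Set.mem_iUnion]
  refine ⟨m, ?_, e, hx⟩
  by_contra hm
  obtain ⟨i, -⟩ := hX.exists_smul_rep e
  exact (hE m (by have : n ≤ m := by exact_mod_cast not_lt.mp hm
                  omega)).false i

end IsGCWComplex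

/-! ### The cells of the fixed point sets -/

namespace IsGCWComplex

open Topology Topology.RelCWComplex SingularChain SkeletonPair

variable {G : Type u} [Group G] {F : Set (Subgroup G)} {X : Type u} [TopologicalSpace X]
  [T2Space X] [CWComplex (Set.univ : Set X)] [MulAction G X] [ContinuousConstSMul G X]
  (hX : IsGCWComplex G X) (hF : ∀ H : Subgroup G, IsCellStabilizer X H → H ∈ F)

/-- The stabiliser of a representative of an orbit of cells. -/
def repStabilizer {n : ℕ} (i : CellOrbit G X n) : OrbitCat F where
  subgroup := MulAction.stabilizer G (openCell n (rep i))
  mem := hF _ ⟨n, rep i, rfl⟩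

include hX in
lemma smul_eq_of_mem_repStabilizer {n : ℕ} {i : CellOrbit G X n} {x : X}
    (hx : x ∈ closedCell n (rep i)) :
    x ∈ MulAction.fixedPoints (repStabilizer hF i).subgroup X :=
  fun g => hX.smul_eq_of_mem_closedCell (MulAction.mem_stabilizer_iff.mp g.2) hx

/-- The characteristic map of a representative, as a map to the fixed points of its stabiliser. -/
noncomputable def repMap {n : ℕ} (i : CellOrbit G X n) :
    C(Ball (Fin n → ℝ), fixedSkeleton X (repStabilizer hF i).subgroup (n + 1)) where
  toFun z := ⟨map n (rep i) z.1,
    hX.smul_eq_of_mem_repStabilizer hF ⟨z.1, z.2, rfl⟩,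
    closedCell_subset_skeletonLT n (rep i) ⟨z.1, z.2, rfl⟩⟩
  continuous_toFun := (continuousOn_iff_continuous_domRestrict.mp
    (continuousOn n (rep i))).subtype_mk _

lemma coe_repMap {n : ℕ} (i : CellOrbit G X n) (z : Ball (Fin n → ℝ)) :
    (repMap hX hF i z : X) = map n (rep i) z.1 := rfl

/-- The characteristic map of a cell of `X^H`. -/
noncomputable def fixedCellMap (n : ℕ) (a : OrbitCat F)
    (s : Σ i : CellOrbit G X n, a ⟶ repStabilizer hF i) :
    C(Ball (Fin n → ℝ), fixedSkeleton X a.subgroup (n + 1)) :=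
  (fixedMap F hX (n + 1) s.2).comp (repMap hX hF s.1)

lemma coe_fixedCellMap {n : ℕ} {a : OrbitCat F} {i : CellOrbit G X n}
    {f : a ⟶ repStabilizer hF i} {g : G}
    (hg : f.toFun ((1 : G) : G ⧸ a.subgroup) = (g : G ⧸ (repStabilizer hF i).subgroup))
    (z : Ball (Fin n → ℝ)) :
    (fixedCellMap hX hF n a ⟨i, f⟩ z : X) = g • map n (rep i) z.1 := by
  refine (coe_fixedMap F hX (n + 1) f _).trans ?_
  rw [coe_repMap]
  exact smul_eq_of_mk_eq (hX.smul_eq_of_mem_repStabilizer hF ⟨z.1, z.2, rfl⟩)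
    ((QuotientGroup.out_eq' _).trans hg)

lemma norm_lt_one {n : ℕ} {z : Ball (Fin n → ℝ)} (hz : z ∉ bdry (Fin n → ℝ)) :
    z.1 ∈ Metric.ball (0 : Fin n → ℝ) 1 :=
  mem_ball_zero_iff.mpr (lt_of_le_of_ne (Ball.norm_le z) hz)

include hX in
/-- A cell meeting `X^H` is a translate of a representative by a morphism of the orbit
category. -/
lemma exists_fixedCell {n : ℕ} {a : OrbitCat F} {e : cell (Set.univ : Set X) n} {x : X}
    (hx : x ∈ openCell n e) (ha : x ∈ MulAction.fixedPoints a.subgroup X) :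
    ∃ (i : CellOrbit G X n) (g : G) (f : a ⟶ repStabilizer hF i),
      g • openCell n (rep i) = openCell n e ∧
        f.toFun ((1 : G) : G ⧸ a.subgroup) = (g : G ⧸ (repStabilizer hF i).subgroup) := by
  obtain ⟨i, g, hg⟩ := hX.exists_smul_rep e
  refine ⟨i, g, OrbitCat.homMk g fun h hh => ?_, hg, OrbitCat.homMk_one _ _⟩
  refine MulAction.mem_stabilizer_iff.mpr ?_
  have h1 : h • x = x := ha ⟨h, hh⟩
  have h2 := hX.smul_openCell_eq_of_mem hx (h1.symm ▸ hx : h • x ∈ openCell n e)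
  rw [mul_smul, mul_smul, hg, h2, ← hg, inv_smul_smul]

lemma mem_lowerSkeleton_iff {n : ℕ} {H : Subgroup G} {x : fixedSkeleton X H (n + 1)} :
    x ∈ lowerSkeleton n H ↔ x.1 ∈ (skeletonLT (Set.univ : Set X) (n : ℕ∞) : Set X) :=
  ⟨fun h => h.2, fun h => ⟨x.2.1, h⟩⟩

lemma isClosed_fixedSkeleton (H : Subgroup G) (n : ℕ) : IsClosed (fixedSkeleton X H n) := by
  refine IsClosed.inter ?_ (Subcomplex.closed _)
  have : MulAction.fixedPoints H X = ⋂ h : H, {x : X | (h : G) • x = x} := by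
    ext x
    simp only [MulAction.mem_fixedPoints, Set.mem_iInter]
    rfl
  rw [this]
  exact isClosed_iInter fun h => isClosed_eq (continuous_const_smul _) continuous_id

/-- A cell `g e` of `X` meets `X^H` exactly when `H` is contained in its stabiliser, that is, when
`g` defines a morphism from `G/H` to `G/K` with `K` the stabiliser of `e`; the cell then lies in
`X^H` entirely. Only the coset of `g` matters, since `K` fixes `e` pointwise. -/
theorem isCellAttachment (n : ℕ) (a : OrbitCat F) :
    IsCellAttachment (lowerSkeleton (X := X) n a.subgroup) n (fixedCellMap hX hF n a) where
  isClosed := by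
    have : lowerSkeleton (X := X) n a.subgroup =
        Subtype.val ⁻¹' (skeletonLT (Set.univ : Set X) (n : ℕ∞) : Set X) :=
      Set.ext fun x => mem_lowerSkeleton_iff
    rw [this]
    exact (Subcomplex.closed _).preimage continuous_subtype_val
  mem_of_mem_bdry := by
    rintro ⟨i, f⟩ z hz
    rw [mem_lowerSkeleton_iff, coe_fixedCellMap hX hF (QuotientGroup.out_eq' _).symm]
    exact hX.smul_mem_skeletonLT _ _ _ (cellFrontier_subset_skeletonLT n (rep i)
      ⟨z.1, mem_sphere_zero_iff_norm.mpr hz, rfl⟩)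
  notMem := by
    rintro ⟨i, f⟩ z hz
    rw [mem_lowerSkeleton_iff, coe_fixedCellMap hX hF (QuotientGroup.out_eq' _).symm]
    intro h
    have h' := hX.smul_mem_skeletonLT (Quotient.out (f.toFun ((1 : G) : G ⧸ a.subgroup)))⁻¹ _ _ h
    rw [inv_smul_smul] at h'
    exact Set.disjoint_left.mp (disjoint_skeletonLT_openCell le_rfl) h'
      ⟨z.1, norm_lt_one hz, rfl⟩
  inj := by
    rintro ⟨i, f⟩ ⟨i', f'⟩ z z' hz hz' h
    obtain ⟨g, hg⟩ := QuotientGroup.mk_surjective (f.toFun ((1 : G) : G ⧸ a.subgroup))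
    obtain ⟨g', hg'⟩ := QuotientGroup.mk_surjective (f'.toFun ((1 : G) : G ⧸ a.subgroup))
    have h1 : g • map n (rep i) z.1 = g' • map n (rep i') z'.1 := by
      rw [← coe_fixedCellMap hX hF hg.symm, ← coe_fixedCellMap hX hF hg'.symm, h]
    have hm : map n (rep i) z.1 ∈ openCell n (rep i) := ⟨z.1, norm_lt_one hz, rfl⟩
    have hm' : map n (rep i') z'.1 ∈ openCell n (rep i') := ⟨z'.1, norm_lt_one hz', rfl⟩
    have hi := hX.eq_of_smul_mem hm hm' h1
    cases hi
    -- Two translates of the same cell that share a point coincide, so the two elements define the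
    -- same coset and hence the same morphism.
    have h2 : g'⁻¹ * g ∈ MulAction.stabilizer G (openCell n (rep i)) := by
      refine MulAction.mem_stabilizer_iff.mpr (hX.smul_openCell_eq_of_mem hm ?_)
      rwa [mul_smul, h1, inv_smul_smul]
    have hf : f = f' := by
      refine OrbitCat.hom_ext ?_
      rw [← hg, ← hg', eq_comm]
      exact QuotientGroup.eq.mpr h2
    subst hf
    refine ⟨rfl, Subtype.ext ?_⟩
    rw [smul_eq_of_mk_eq (hX.smul_eq_of_mem_repStabilizer hF
      (openCell_subset_closedCell _ _ hm)) (hg.trans hg'.symm)] at h1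
    refine (map n (rep i)).injOn ?_ ?_ (smul_left_cancel g' h1) <;> rw [source_eq]
    exacts [norm_lt_one hz, norm_lt_one hz']
  exists_eq := by
    intro y hy
    rw [mem_lowerSkeleton_iff, SetLike.mem_coe, CWComplex.mem_skeletonLT_iff] at hy
    obtain ⟨m, hm, e, he⟩ := CWComplex.mem_skeletonLT_iff.mp y.2.2
    have hmn : m = n := by
      by_contra hne
      refine hy ⟨m, ?_, e, he⟩
      have : m < n + 1 := by exact_mod_cast hm
      exact_mod_cast (by omega : m < n)
    subst hmn
    obtain ⟨i, g, f, hg, hf⟩ := hX.exists_fixedCell hF he y.2.1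
    rw [← hg] at he
    obtain ⟨_, ⟨z, hz, rfl⟩, hzy⟩ := he
    refine ⟨⟨i, f⟩, ⟨z, Metric.ball_subset_closedBall hz⟩, fun h => ?_, Subtype.ext ?_⟩
    · rw [mem_ball_zero_iff] at hz
      exact hz.ne h
    · rw [coe_fixedCellMap hX hF hf]
      exact hzy
  isClosed_of := by
    intro C hCA hC
    have hY : Topology.IsClosedEmbedding
        (Subtype.val : fixedSkeleton X a.subgroup (n + 1) → X) :=
      (isClosed_fixedSkeleton a.subgroup (n + 1)).isClosedEmbedding_subtypeVal
    rw [hY.isClosed_iff_image_isClosed]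
    refine CWComplex.isClosed_of_disjoint_openCell_or_isClosed_inter_closedCell
      (C := (Set.univ : Set X)) (Set.subset_univ _) fun m _ e => ?_
    -- Closedness is tested on the cells of `X`. Cells below dimension `n` see only the part of `C`
    -- in the lower skeleton; a cell of dimension `n` that meets `C` is a cell of the fixed set, and
    -- its trace is a compact image; higher cells miss `C`.
    rcases lt_trichotomy m n with hm | rfl | hm
    · refine Or.inr ?_
      have : Subtype.val '' C ∩ closedCell m e =
          Subtype.val '' (C ∩ lowerSkeleton n a.subgroup) ∩ closedCell m e := by
        ext x
        refine ⟨?_, fun h => ⟨Set.image_mono Set.inter_subset_left h.1, h.2⟩⟩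
        rintro ⟨⟨y, hy, rfl⟩, hx⟩
        refine ⟨⟨y, ⟨hy, mem_lowerSkeleton_iff.mpr ?_⟩, rfl⟩, hx⟩
        exact skeletonLT_mono (by exact_mod_cast hm) (closedCell_subset_skeletonLT m e hx)
      rw [this]
      exact ((hY.isClosed_iff_image_isClosed).mp hCA).inter isClosed_closedCell
    · by_cases hd : Disjoint (Subtype.val '' C) (openCell m e)
      · exact Or.inl hd
      · refine Or.inr ?_
        obtain ⟨_, ⟨y, hy, rfl⟩, hye⟩ := Set.not_disjoint_iff.mp hd
        obtain ⟨i, g, f, hg, hf⟩ := hX.exists_fixedCell hF hye y.2.1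
        have : Subtype.val '' C ∩ closedCell m e =
            Subtype.val '' (fixedCellMap hX hF m a ⟨i, f⟩ ''
              (fixedCellMap hX hF m a ⟨i, f⟩ ⁻¹' C)) := by
          ext x
          constructor
          · rintro ⟨⟨y, hy, rfl⟩, hx⟩
            rw [← smul_closedCell hg] at hx
            obtain ⟨_, ⟨z, hz, rfl⟩, hzy⟩ := hx
            have hzy' : fixedCellMap hX hF m a ⟨i, f⟩ ⟨z, hz⟩ = y := Subtype.ext (by
              rw [coe_fixedCellMap hX hF hf]
              exact hzy)
            exact ⟨y, ⟨⟨z, hz⟩, by rwa [Set.mem_preimage, hzy'], hzy'⟩, rfl⟩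
          · rintro ⟨_, ⟨z, hz, rfl⟩, rfl⟩
            refine ⟨⟨_, hz, rfl⟩, ?_⟩
            rw [coe_fixedCellMap hX hF hf, ← smul_closedCell hg]
            exact Set.smul_mem_smul_set ⟨z.1, z.2, rfl⟩
        rw [this]
        exact (((hC ⟨i, f⟩).isCompact.image (ContinuousMap.continuous _)).image
          continuous_subtype_val).isClosed
    · refine Or.inl (Set.disjoint_left.mpr ?_)
      rintro _ ⟨y, _, rfl⟩ hye
      exact Set.disjoint_left.mp (disjoint_skeletonLT_openCell (by exact_mod_cast hm)) y.2.2 hye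

/-- The generator of the cellular chains given by an orbit of cells. -/
noncomputable def cellCycle {n : ℕ} (i : CellOrbit G X n) :
    relCycles F (X := X) n n (repStabilizer hF i) :=
  ⟨push (repMap hX hF i) _ (IsCellAttachment.gen n), by
    change bd n _ ∈ chainsIn n (lowerSkeleton n (repStabilizer hF i).subgroup)
    rw [bd_push]
    have h := (hX.isCellAttachment hF n (repStabilizer hF i)).isRelBasis.bd_mem ⟨i, 𝟙 _⟩
    have e : fixedCellMap hX hF n (repStabilizer hF i) ⟨i, 𝟙 _⟩ = repMap hX hF i := by
      ext z
      rw [coe_fixedCellMap hX hF (g := 1) rfl, one_smul, coe_repMap]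
    rw [e, bd_push] at h
    exact h⟩

/-- The index set of the basis at `G/H` is the set of pairs of an orbit and a morphism, which is the
shape required of a free module. -/
theorem isFreeOn_cellularModule (n : ℕ) :
    OrbitModule.IsFreeOn (cellularModule F hX n) (fun i : CellOrbit G X n => repStabilizer hF i)
      fun i => relHomologyClass F hX n n (repStabilizer hF i) (cellCycle hX hF i) := by
  refine isFreeOn_homology F hX n _ (fun i => cellCycle hX hF i) fun a => ?_
  have h := (hX.isCellAttachment hF n a).isRelBasis
  convert h using 2 with s
  exact push_push _ _ _

include hF in
theorem isZero_relHomology {n q : ℕ} (hq : q ≠ n) :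
    IsZero ((skeletonPair F hX n).X₃.homology q) :=
  SkeletonPair.isZero_homology F hX n fun a => (hX.isCellAttachment hF n a).relAcyclic hq

end IsGCWComplex

/-! ### The augmentation -/

namespace SingularChain

section Augmentation

variable {Y Z : Type*} [TopologicalSpace Y] [TopologicalSpace Z]

/-- The sum of the coefficients. -/
noncomputable def aug : Chain 1 Y →+ ℤ := Finsupp.liftAddHom fun _ => AddMonoidHom.id ℤ

lemma aug_single (σ : C(Splx 1, Y)) (m : ℤ) : aug (Finsupp.single σ m) = m :=
  Finsupp.liftAddHom_apply_single _ _ _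

lemma aug_push (f : C(Y, Z)) (c : Chain 1 Y) : aug (push f 1 c) = aug c := by
  induction c using Finsupp.induction_linear with
  | zero => simp
  | add a b ha hb => simp only [map_add, ha, hb]
  | single σ m => rw [push_single, aug_single, aug_single]

lemma isEmpty_splx_zero : IsEmpty (Splx 0) :=
  ⟨fun x => by simpa using x.2.2⟩

/-- The lowest boundary of the augmented complex is the sum of coefficients, which links it to the
augmentation of the unaugmented complex. -/
lemma bd_zero_eq (c : Chain 1 Y) :
    bd 0 c = Finsupp.single ⟨fun x => (isEmpty_splx_zero.false x).elim,
      continuous_iff_continuousAt.mpr fun x => (isEmpty_splx_zero.false x).elim⟩ (aug c) := by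
  induction c using Finsupp.induction_linear with
  | zero => simp
  | add a b ha hb => simp only [map_add, ha, hb, Finsupp.single_add]
  | single σ m =>
    rw [bd_single, aug_single]
    simp only [Fin.sum_univ_succ, Fin.val_zero, pow_zero, one_smul, Finset.univ_eq_empty,
      Finset.sum_empty, add_zero]
    have : ∀ τ τ' : C(Splx 0, Y), τ = τ' := fun τ τ' =>
      ContinuousMap.ext fun x => (isEmpty_splx_zero.false x).elim
    exact congrArg (fun τ => Finsupp.single τ m) (this _ _)

lemma aug_bd (c : Chain 2 Y) : aug (bd 1 c) = 0 := by
  have := bd_bd c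
  rw [bd_zero_eq] at this
  exact Finsupp.single_eq_zero.mp this

lemma exists_bd_eq_of_aug_eq_zero [ContractibleSpace Y] {c : Chain 1 Y} (hc : aug c = 0) :
    ∃ d, bd 1 d = c :=
  exists_bd_eq_of_contractible c (by rw [bd_zero_eq, hc, Finsupp.single_zero])

end Augmentation

end SingularChain

/-! ### Singular homology of functors to spaces -/

namespace OrbitChains

open Opposite SingularChain

variable {G : Type u} [Group G] {F : Set (Subgroup G)} (T : (OrbitCat F)ᵒᵖ ⥤ TopCat.{u})

/-- Explicit singular chains as elements of the complex of singular chains. -/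
noncomputable def mk (q : ℕ) (A : (OrbitCat F)ᵒᵖ) :
    Chain (q + 1) (T.obj A) ≃+ ((orbitSingularChains T).X q).obj A :=
  AddEquiv.ofBijective (toChain (T.obj A) q) (toChain_bijective (T.obj A) q)

lemma d_mk (q : ℕ) (A : (OrbitCat F)ᵒᵖ) (c : Chain (q + 2) (T.obj A)) :
    ((orbitSingularChains T).d (q + 1) q).app A (mk T (q + 1) A c) = mk T q A (bd (q + 1) c) :=
  d_toChain (T.obj A) q c

lemma map_mk (q : ℕ) {A B : (OrbitCat F)ᵒᵖ} (f : A ⟶ B) (c : Chain (q + 1) (T.obj A)) :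
    ((orbitSingularChains T).X q).map f (mk T q A c) = mk T q B (push (T.map f).hom _ c) :=
  map_toChain (T.map f) q c

lemma orbitSingularChainsMap_mk {T T' : (OrbitCat F)ᵒᵖ ⥤ TopCat.{u}} (φ : T ⟶ T') (q : ℕ)
    (A : (OrbitCat F)ᵒᵖ) (c : Chain (q + 1) (T.obj A)) :
    ((orbitSingularChainsMap φ).f q).app A (mk T q A c) = mk T' q A (push (φ.app A).hom _ c) :=
  map_toChain (φ.app A) q c

lemma isZero_homology_of_contractible (h : ∀ A, ContractibleSpace (T.obj A)) (q : ℕ) :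
    IsZero ((orbitSingularChains T).homology (q + 1)) := by
  refine FunctorComplex.isZero_homology _ _ fun A x hx => ?_
  obtain ⟨c, rfl⟩ := (mk T (q + 1) A).surjective x
  rw [FunctorComplex.mem_cycleSub_succ, d_mk, AddEquivClass.map_eq_zero_iff] at hx
  have := h A
  obtain ⟨d, rfl⟩ := exists_bd_eq_of_contractible c hx
  exact ⟨_, d_mk T (q + 1) A d⟩

lemma isZero_homology_of_isEmpty (h : ∀ A, IsEmpty (T.obj A)) (q : ℕ) :
    IsZero ((orbitSingularChains T).homology q) := by
  refine FunctorComplex.isZero_homology _ _ fun A x hx => ⟨0, ?_⟩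
  obtain ⟨c, rfl⟩ := (mk T q A).surjective x
  have := h A
  have hE : IsEmpty C(Splx (q + 1), T.obj A) :=
    ⟨fun σ => (h A).false (σ (vert (q + 1) 0))⟩
  rw [map_zero, Subsingleton.elim c 0, map_zero]

/-- The augmentation of the singular chains at an object. -/
noncomputable def augHom (A : (OrbitCat F)ᵒᵖ) :
    ((orbitSingularChains T).X 0).obj A →+ ULift.{u} ℤ :=
  (AddEquiv.ulift.symm.toAddMonoidHom.comp aug).comp (mk T 0 A).symm.toAddMonoidHom

/-- An additive homomorphism between `ℤ`-modules as a morphism. -/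
def homOfAddHom {M N : ModuleCat.{u} ℤ} (f : M →+ N) : M ⟶ N :=
  ModuleCat.ofHom
    { toFun := f
      map_add' := map_add f
      map_smul' := fun k x => by simpa using map_intCast_smul f ℤ ℤ k x }

/-- The augmentation of the singular chains. -/
noncomputable def chainAug : (orbitSingularChains T).X 0 ⟶ orbitConst F where
  app A := homOfAddHom (M := ((orbitSingularChains T).X 0).obj A)
    (N := ModuleCat.of ℤ (ULift.{u} ℤ)) (augHom T A)
  naturality A B f := by
    ext x
    obtain ⟨c, rfl⟩ := (mk T 0 A).surjective x
    change ULift.up (aug ((mk T 0 B).symm (((orbitSingularChains T).X 0).map f (mk T 0 A c)))) =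
      ULift.up (aug ((mk T 0 A).symm (mk T 0 A c)))
    rw [map_mk, AddEquiv.symm_apply_apply, AddEquiv.symm_apply_apply, aug_push]

lemma chainAug_mk (A : (OrbitCat F)ᵒᵖ) (c : Chain 1 (T.obj A)) :
    (chainAug T).app A (mk T 0 A c) = (ULift.up (aug c) : ULift.{u} ℤ) := by
  change ULift.up (aug ((mk T 0 A).symm (mk T 0 A c))) = _
  rw [AddEquiv.symm_apply_apply]

lemma d_chainAug : (orbitSingularChains T).d 1 0 ≫ chainAug T = 0 := by
  ext A x
  obtain ⟨c, rfl⟩ := (mk T 1 A).surjective x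
  change (chainAug T).app A (((orbitSingularChains T).d 1 0).app A (mk T 1 A c)) = 0
  rw [d_mk, chainAug_mk, aug_bd]
  rfl

/-- The augmentation on homology. -/
noncomputable def homologyAug : (orbitSingularChains T).homology 0 ⟶ orbitConst F :=
  (orbitSingularChains T).homologyι 0 ≫
    (orbitSingularChains T).descOpcycles (chainAug T) 1 (by simp) (d_chainAug T)

lemma homologyπ_homologyAug : (orbitSingularChains T).homologyπ 0 ≫ homologyAug T =
    (orbitSingularChains T).iCycles 0 ≫ chainAug T := by
  rw [homologyAug, HomologicalComplex.homology_π_ι_assoc, HomologicalComplex.p_descOpcycles]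

lemma homologyAug_naturality {T T' : (OrbitCat F)ᵒᵖ ⥤ TopCat.{u}} (φ : T ⟶ T') :
    HomologicalComplex.homologyMap (orbitSingularChainsMap φ) 0 ≫ homologyAug T' =
      homologyAug T := by
  rw [← cancel_epi ((orbitSingularChains T).homologyπ 0),
    HomologicalComplex.homologyπ_naturality_assoc, homologyπ_homologyAug, homologyπ_homologyAug,
    HomologicalComplex.cyclesMap_i_assoc]
  congr 1
  ext A x
  obtain ⟨c, rfl⟩ := (mk T 0 A).surjective x
  change (chainAug T').app A (((orbitSingularChainsMap φ).f 0).app A (mk T 0 A c)) =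
    (chainAug T).app A (mk T 0 A c)
  rw [orbitSingularChainsMap_mk, chainAug_mk, chainAug_mk, aug_push]

lemma exists_homologyClass (A : (OrbitCat F)ᵒᵖ) (x : ((orbitSingularChains T).homology 0).obj A) :
    ∃ c : Chain 1 (T.obj A), x = FunctorComplex.homologyClass (orbitSingularChains T) 0 A
      ⟨mk T 0 A c, FunctorComplex.mem_cycleSub_zero _⟩ := by
  obtain ⟨⟨y, hy⟩, rfl⟩ := FunctorComplex.homologyClass_surjective _ _ _ x
  obtain ⟨c, rfl⟩ := (mk T 0 A).surjective y
  exact ⟨c, rfl⟩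

lemma homologyAug_homologyClass (A : (OrbitCat F)ᵒᵖ) (c : Chain 1 (T.obj A)) :
    (homologyAug T).app A (FunctorComplex.homologyClass (orbitSingularChains T) 0 A
      ⟨mk T 0 A c, FunctorComplex.mem_cycleSub_zero _⟩) = (ULift.up (aug c) : ULift.{u} ℤ) := by
  obtain ⟨z, hz⟩ := (FunctorComplex.cyclesEquiv (orbitSingularChains T) 0 A).surjective
    ⟨mk T 0 A c, FunctorComplex.mem_cycleSub_zero _⟩
  rw [← hz, FunctorComplex.homologyClass_cyclesEquiv, ← ModuleCat.comp_apply, ← NatTrans.comp_app,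
    homologyπ_homologyAug, ← chainAug_mk]
  exact congrArg ((chainAug T).app A) (congrArg Subtype.val hz)

lemma homologyAug_eq_zero (h : ∀ A, ContractibleSpace (T.obj A)) (A : (OrbitCat F)ᵒᵖ)
    (x : ((orbitSingularChains T).homology 0).obj A) (hx : (homologyAug T).app A x = 0) :
    x = 0 := by
  obtain ⟨c, rfl⟩ := exists_homologyClass T A x
  rw [homologyAug_homologyClass] at hx
  have := h A
  obtain ⟨d, rfl⟩ := exists_bd_eq_of_aug_eq_zero (congrArg ULift.down hx)
  rw [FunctorComplex.homologyClass_eq_zero_iff]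
  exact ⟨_, d_mk T 0 A d⟩

lemma homologyAug_surjective (h : ∀ A, Nonempty (T.obj A)) (A : (OrbitCat F)ᵒᵖ) :
    Function.Surjective ((homologyAug T).app A) := by
  rintro ⟨m⟩
  obtain ⟨y⟩ := h A
  exact ⟨_, (homologyAug_homologyClass T A
    (Finsupp.single (ContinuousMap.const _ y) m)).trans (by rw [aug_single])⟩

end OrbitChains

/-! ### The homology of the skeleta -/

namespace SkeletonPair

open Opposite

variable {G : Type u} [Group G] (F : Set (Subgroup G)) {X : Type u} [TopologicalSpace X]
  [T2Space X] [Topology.CWComplex (Set.univ : Set X)] [MulAction G X] [ContinuousConstSMul G X]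
  (hX : IsGCWComplex G X)

/-- The homology of the skeleta of the fixed point sets. -/
noncomputable abbrev skelHomology (p q : ℕ) : OrbitModule F :=
  (orbitSingularChains (fixedSkeletonFunctor F hX p)).homology q

/-- The relative homology of two consecutive skeleta of the fixed point sets. -/
noncomputable abbrev relHomology (p q : ℕ) : OrbitModule F :=
  (skeletonPair F hX p).X₃.homology q

/-- The map induced by the inclusion of a skeleton into the next one. -/
noncomputable def incl (p q : ℕ) : skelHomology F hX p q ⟶ skelHomology F hX (p + 1) q :=
  HomologicalComplex.homologyMap (skeletonPair F hX p).f q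

/-- The map to relative homology. -/
noncomputable def proj (p q : ℕ) : skelHomology F hX (p + 1) q ⟶ relHomology F hX p q :=
  HomologicalComplex.homologyMap (skeletonPair F hX p).g q

/-- The connecting homomorphism. -/
noncomputable def connecting (p q : ℕ) : relHomology F hX p (q + 1) ⟶ skelHomology F hX p q :=
  (skeletonPair_shortExact F hX p).δ (q + 1) q (by simp)

lemma exists_connecting_eq (p q : ℕ) (A : (OrbitCat F)ᵒᵖ) (x : (skelHomology F hX p q).obj A)
    (hx : (incl F hX p q).app A x = 0) : ∃ y, (connecting F hX p q).app A y = x :=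
  FunctorComplex.exact_app ((skeletonPair_shortExact F hX p).homology_exact₁ (q + 1) q (by simp))
    A x hx

lemma exists_incl_eq (p q : ℕ) (A : (OrbitCat F)ᵒᵖ) (x : (skelHomology F hX (p + 1) q).obj A)
    (hx : (proj F hX p q).app A x = 0) : ∃ y, (incl F hX p q).app A y = x :=
  FunctorComplex.exact_app ((skeletonPair_shortExact F hX p).homology_exact₂ q) A x hx

lemma exists_proj_eq (p q : ℕ) (A : (OrbitCat F)ᵒᵖ) (x : (relHomology F hX p (q + 1)).obj A)
    (hx : (connecting F hX p q).app A x = 0) : ∃ y, (proj F hX p (q + 1)).app A y = x :=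
  FunctorComplex.exact_app ((skeletonPair_shortExact F hX p).homology_exact₃ (q + 1) q (by simp))
    A x hx

lemma epi_proj_zero (p : ℕ) : Epi (proj F hX p 0) := by
  have := (skeletonPair_shortExact F hX p).epi_g
  exact HomologicalComplex.epi_homologyMap_of_epi_of_not_rel (skeletonPair F hX p).g 0 (by simp)

lemma connecting_incl (p q : ℕ) : connecting F hX p q ≫ incl F hX p q = 0 :=
  (skeletonPair_shortExact F hX p).δ_comp _ _ _

lemma eq_zero_of_isZero {M : OrbitModule F} (h : IsZero M) {A : (OrbitCat F)ᵒᵖ} (x : M.obj A) :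
    x = 0 := by
  have := ModuleCat.isZero_iff_subsingleton.mp ((Functor.isZero_iff _).mp h A)
  exact Subsingleton.elim _ _

lemma isZero_of_forall {M : OrbitModule F} (h : ∀ (A : (OrbitCat F)ᵒᵖ) (x : M.obj A), x = 0) :
    IsZero M :=
  (Functor.isZero_iff _).mpr fun A => ModuleCat.isZero_iff_subsingleton.mpr
    ⟨fun x y => (h A x).trans (h A y).symm⟩

lemma eq_zero_of_incl {p q : ℕ} (h : IsZero (relHomology F hX p (q + 1))) {A : (OrbitCat F)ᵒᵖ}
    {x : (skelHomology F hX p q).obj A} (hx : (incl F hX p q).app A x = 0) : x = 0 := by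
  obtain ⟨y, rfl⟩ := exists_connecting_eq F hX p q A x hx
  rw [eq_zero_of_isZero F h y, map_zero]

/-- Skeleta of high index equal the whole contractible fixed set, so properties can be descended
from there to lower skeleta, and no limit argument is needed. -/
lemma descending {P : ℕ → Prop} {N p₀ : ℕ} (hN : ∀ n ≥ N, P n)
    (h : ∀ p ≥ p₀, P (p + 1) → P p) (p : ℕ) (hp : p₀ ≤ p) : P p := by
  have : ∀ k p, p₀ ≤ p → N ≤ p + k → P p := by
    intro k
    induction k with
    | zero => exact fun p _ h => hN p h
    | succ k ih => exact fun p hp hk => h p hp (ih (p + 1) (by omega) (by omega))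
  exact this N p hp (by omega)

variable (hrel : ∀ p q, q ≠ p → IsZero (relHomology F hX p q))
  {N : ℕ} (hN : ∀ n ≥ N, ∀ A : OrbitCat F, ContractibleSpace (fixedSkeleton X A.subgroup n))

lemma isEmpty_fixedSkeleton_zero (H : Subgroup G) : IsEmpty (fixedSkeleton X H 0) := by
  refine ⟨fun x => ?_⟩
  have h := x.2.2
  rw [Nat.cast_zero, Topology.CWComplex.skeletonLT_zero_eq_empty] at h
  exact h

include hrel

/-- The index `p` means cells of dimension below `p`, so this is vanishing above the dimension, by
induction from the empty skeleton. -/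
lemma isZero_skelHomology_of_le (p : ℕ) : ∀ q, p ≤ q → IsZero (skelHomology F hX p q) := by
  induction p with
  | zero =>
    exact fun q _ => OrbitChains.isZero_homology_of_isEmpty _
      (fun A => isEmpty_fixedSkeleton_zero A.unop.subgroup) q
  | succ p ih =>
    intro q hq
    refine isZero_of_forall F fun A x => ?_
    obtain ⟨y, rfl⟩ := exists_incl_eq F hX p q A x
      (eq_zero_of_isZero F (hrel p q (by omega)) _)
    rw [eq_zero_of_isZero F (ih q (by omega)) y, map_zero]

include hN

/-- Once all cells of dimension up to `q + 2` are present, adding further cells cannot kill classes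
in degree `q + 1`, and these classes die in the contractible whole. -/
lemma isZero_skelHomology_of_lt (p q : ℕ) (hq : q + 3 ≤ p) :
    IsZero (skelHomology F hX p (q + 1)) := by
  refine descending (P := fun p => IsZero (skelHomology F hX p (q + 1))) (N := N)
    (p₀ := q + 3) ?_ ?_ p hq
  · exact fun n hn => OrbitChains.isZero_homology_of_contractible _ (fun A => hN n hn A.unop) q
  · exact fun p hp h => isZero_of_forall F fun A x =>
      eq_zero_of_incl F hX (hrel p (q + 2) (by omega)) (eq_zero_of_isZero F h _)

/-- The augmentation of the homology of a skeleton. -/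
noncomputable def skelAug (p : ℕ) : skelHomology F hX p 0 ⟶ orbitConst F :=
  OrbitChains.homologyAug _

omit hrel hN in
lemma incl_skelAug (p : ℕ) : incl F hX p 0 ≫ skelAug F hX (p + 1) = skelAug F hX p :=
  OrbitChains.homologyAug_naturality (fixedSkeletonIncl F hX p)

lemma eq_zero_of_skelAug (p : ℕ) (hp : 2 ≤ p) : ∀ (A : (OrbitCat F)ᵒᵖ)
    (x : (skelHomology F hX p 0).obj A), (skelAug F hX p).app A x = 0 → x = 0 := by
  refine descending (P := fun p => ∀ (A : (OrbitCat F)ᵒᵖ) (x : (skelHomology F hX p 0).obj A),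
    (skelAug F hX p).app A x = 0 → x = 0) (N := N) (p₀ := 2) ?_ ?_ p hp
  · exact fun n hn A x => OrbitChains.homologyAug_eq_zero _ (fun A => hN n hn A.unop) A x
  · intro p hp h A x hx
    refine eq_zero_of_incl F hX (hrel p 1 (by omega)) (h A _ ?_)
    rw [← ModuleCat.comp_apply, ← NatTrans.comp_app, incl_skelAug, hx]

lemma skelAug_surjective (p : ℕ) (hp : 1 ≤ p) : ∀ A : (OrbitCat F)ᵒᵖ,
    Function.Surjective ((skelAug F hX p).app A) := by
  refine descending (P := fun p => ∀ A : (OrbitCat F)ᵒᵖ,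
    Function.Surjective ((skelAug F hX p).app A)) (N := N) (p₀ := 1) ?_ ?_ p hp
  · exact fun n hn A => OrbitChains.homologyAug_surjective _
      (fun A => have := hN n hn A.unop
        (inferInstance : Nonempty (fixedSkeleton X A.unop.subgroup n))) A
  · intro p hp h A y
    obtain ⟨x, rfl⟩ := h A y
    obtain ⟨z, rfl⟩ := exists_incl_eq F hX p 0 A x
      (eq_zero_of_isZero F (hrel p 0 (by omega)) _)
    exact ⟨z, by rw [← ModuleCat.comp_apply, ← NatTrans.comp_app, incl_skelAug]⟩

/-! ### Exactness of the cellular complex -/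

omit hN in
lemma proj_injective (n : ℕ) (A : (OrbitCat F)ᵒᵖ) (x : (skelHomology F hX (n + 1) n).obj A)
    (hx : (proj F hX n n).app A x = 0) : x = 0 := by
  obtain ⟨y, rfl⟩ := exists_incl_eq F hX n n A x hx
  rw [eq_zero_of_isZero F (isZero_skelHomology_of_le F hX hrel n n le_rfl) y, map_zero]

/-- The projection is injective on degree `n` of the n-skeleton, so a cellular cycle has zero
connecting image and comes from the (n+1)-skeleton; there it bounds because degree `n + 1` vanishes
in the (n+2)-skeleton. -/
lemma cellularBoundary_exact (n : ℕ) :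
    (ShortComplex.mk _ _ (cellularBoundary_comp F hX n)).Exact := by
  refine FunctorComplex.exact_of_app fun A x hx => ?_
  have h1 : (connecting F hX (n + 1) n).app A x = 0 := proj_injective F hX hrel n A _ hx
  obtain ⟨y, rfl⟩ := exists_proj_eq F hX (n + 1) n A x h1
  obtain ⟨z, rfl⟩ := exists_connecting_eq F hX (n + 2) (n + 1) A y
    (eq_zero_of_isZero F (isZero_skelHomology_of_lt F hX hrel hN (n + 3) n le_rfl) _)
  exact ⟨z, rfl⟩

omit hN in
lemma isIso_proj_zero : IsIso (proj F hX 0 0) := by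
  have := epi_proj_zero F hX 0
  have : Mono (proj F hX 0 0) := by
    have : ∀ A, Mono ((proj F hX 0 0).app A) := fun A => by
      rw [ModuleCat.mono_iff_injective, injective_iff_map_eq_zero]
      exact fun x hx => proj_injective F hX hrel 0 A x hx
    exact NatTrans.mono_of_mono_app _
  exact isIso_of_mono_of_epi _

/-- The augmentation of the cellular complex. -/
noncomputable def cellularAug : relHomology F hX 0 0 ⟶ orbitConst F :=
  have := isIso_proj_zero F hX hrel
  inv (proj F hX 0 0) ≫ skelAug F hX 1

omit hN in
lemma proj_cellularAug : proj F hX 0 0 ≫ cellularAug F hX hrel = skelAug F hX 1 := by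
  have := isIso_proj_zero F hX hrel
  exact IsIso.hom_inv_id_assoc (proj F hX 0 0) _

omit hN in
lemma cellularBoundary_aug :
    (connecting F hX 1 0 ≫ proj F hX 0 0) ≫ cellularAug F hX hrel = 0 := by
  rw [Category.assoc, proj_cellularAug, ← incl_skelAug, ← Category.assoc,
    connecting_incl, zero_comp]

lemma epi_cellularAug : Epi (cellularAug F hX hrel) := by
  have : ∀ A, Epi ((cellularAug F hX hrel).app A) := fun A => by
    rw [ModuleCat.epi_iff_surjective]
    intro y
    obtain ⟨x, rfl⟩ := skelAug_surjective F hX hrel hN 1 le_rfl A y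
    refine ⟨(proj F hX 0 0).app A x, ?_⟩
    rw [← proj_cellularAug F hX hrel]
    rfl
  exact NatTrans.epi_of_epi_app _

/-- Degree 0 homology of the 1-skeleton is already detected by the augmentation, so a class of
points with augmentation zero dies there and is a cellular boundary. -/
lemma cellularAug_exact :
    (ShortComplex.mk _ _ (cellularBoundary_aug F hX hrel)).Exact := by
  refine FunctorComplex.exact_of_app fun A x hx => ?_
  have := epi_proj_zero F hX 0
  obtain ⟨y, rfl⟩ := FunctorComplex.app_surjective_of_epi (proj F hX 0 0) A x
  have h1 : (skelAug F hX 1).app A y = 0 := by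
    rw [← proj_cellularAug F hX hrel]
    exact hx
  have h2 : (incl F hX 1 0).app A y = 0 := by
    refine eq_zero_of_skelAug F hX hrel hN 2 le_rfl A _ ?_
    rw [← incl_skelAug] at h1
    exact h1
  obtain ⟨z, rfl⟩ := exists_connecting_eq F hX 1 0 A y h2
  exact ⟨z, rfl⟩

omit hrel hN in
lemma cellularComplex_d (n : ℕ) :
    (cellularComplex F hX).d (n + 1) n = cellularBoundary F hX n :=
  ChainComplex.of_d _ _ _

omit hN in
lemma d_cellularAug : (cellularComplex F hX).d 1 0 ≫ cellularAug F hX hrel = 0 := by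
  rw [cellularComplex_d]
  exact cellularBoundary_aug F hX hrel

/-- The cellular complex as a projective resolution of the constant module. -/
noncomputable def resolution (hproj : ∀ n, Projective (cellularModule F hX n)) :
    ProjectiveResolution (orbitConst F) where
  complex := cellularComplex F hX
  projective := hproj
  π := (ChainComplex.toSingle₀Equiv _ _).symm ⟨cellularAug F hX hrel, d_cellularAug F hX hrel⟩
  quasiIso := ⟨fun n => by
    cases n
    · rw [ChainComplex.quasiIsoAt₀_iff, ShortComplex.quasiIso_iff_of_zeros']
      · refine (ShortComplex.exact_and_epi_g_iff_of_iso ?_).2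
          ⟨cellularAug_exact F hX hrel hN, epi_cellularAug F hX hrel hN⟩
        exact ShortComplex.isoMk (Iso.refl _) (Iso.refl _) (Iso.refl _)
          ((Category.id_comp _).trans
            ((cellularComplex_d F hX 0).symm.trans (Category.comp_id _).symm))
          (by
            refine (Category.id_comp _).trans (Eq.trans ?_ (Category.comp_id _).symm)
            exact (ChainComplex.toSingle₀Equiv_symm_apply_f_zero (C := cellularComplex F hX)
              (X := orbitConst F) (cellularAug F hX hrel) (d_cellularAug F hX hrel)).symm)
      all_goals rfl
    · rename_i n
      rw [quasiIsoAt_iff_exactAt']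
      · rw [HomologicalComplex.exactAt_iff' _ (n + 2) (n + 1) n (by simp) (by simp)]
        refine (ShortComplex.exact_iff_of_iso ?_).mpr (cellularBoundary_exact F hX hrel hN n)
        exact ShortComplex.isoMk (Iso.refl _) (Iso.refl _) (Iso.refl _)
          ((Category.id_comp _).trans
            ((cellularComplex_d F hX (n + 1)).symm.trans (Category.comp_id _).symm))
          ((Category.id_comp _).trans
            ((cellularComplex_d F hX n).symm.trans (Category.comp_id _).symm))
      · apply ChainComplex.exactAt_succ_single_obj⟩

end SkeletonPair

/-! ### Cocycles and `Ext` -/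

namespace CocycleExt

open Abelian

universe w

variable {C : Type u} [Category.{v} C] [Abelian C]

/-- The cochain `f` is a coboundary. -/
def IsCoboundary (K : ChainComplex C ℕ) {M : C} {n : ℕ} (f : K.X n ⟶ M) : Prop :=
  ∃ (j : ℕ) (g : K.X j ⟶ M), K.d n j ≫ g = f

lemma isCoboundary_zero_iff {K : ChainComplex C ℕ} {M : C} {f : K.X 0 ⟶ M} :
    IsCoboundary K f ↔ f = 0 := by
  constructor
  · rintro ⟨j, g, rfl⟩
    rw [K.shape _ _ (by simp), zero_comp]
  · rintro rfl
    exact ⟨0, 0, comp_zero⟩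

lemma isCoboundary_succ_iff {K : ChainComplex C ℕ} {M : C} {n : ℕ} {f : K.X (n + 1) ⟶ M} :
    IsCoboundary K f ↔ ∃ g, K.d (n + 1) n ≫ g = f := by
  refine ⟨?_, fun h => ⟨n, h⟩⟩
  rintro ⟨j, g, rfl⟩
  by_cases hj : j = n
  · subst hj
    exact ⟨g, rfl⟩
  · exact ⟨0, by rw [K.shape (n + 1) j (by simpa using hj), zero_comp, comp_zero]⟩

section Ext

variable [HasExt.{w} C] {X Y : C} (R : ProjectiveResolution X)

/-- In degree 0 a coboundary would come from cohomological degree 1 of the resolution, which is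
zero. -/
lemma extMk_zero_eq_zero_iff (f : R.complex.X 0 ⟶ Y) (hf : R.complex.d 1 0 ≫ f = 0) :
    R.extMk f 1 rfl hf = 0 ↔ f = 0 := by
  simp only [← R.extEquivCohomologyClass.apply_eq_iff_eq,
    ProjectiveResolution.extEquivCohomologyClass_extMk,
    ProjectiveResolution.extEquivCohomologyClass_zero,
    CochainComplex.HomComplex.CohomologyClass.mk_eq_zero_iff]
  rw [CochainComplex.HomComplex.Cocycle.toSingleMk_mem_coboundaries_iff _ _ _ _ _ 1 (by simp)]
  have hz : IsZero (R.cochainComplex.X 1) := R.cochainComplex.isZero_of_isStrictlyLE 0 1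
  constructor
  · rintro ⟨g, hg⟩
    rw [← cancel_epi (R.cochainComplexXIso (-((0 : ℕ) : ℤ)) 0 rfl).hom, ← hg,
      hz.eq_of_src g 0, comp_zero, comp_zero]
  · rintro rfl
    exact ⟨0, by rw [comp_zero, comp_zero]⟩

lemma extMk_eq_zero_iff_isCoboundary {n : ℕ} (f : R.complex.X n ⟶ Y)
    (hf : R.complex.d (n + 1) n ≫ f = 0) :
    R.extMk f (n + 1) rfl hf = 0 ↔ IsCoboundary R.complex f := by
  cases n with
  | zero => rw [isCoboundary_zero_iff, extMk_zero_eq_zero_iff]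
  | succ n => rw [isCoboundary_succ_iff, R.extMk_eq_zero_iff f _ _ hf n rfl]

lemma nontrivial_ext_iff (Y : C) (n : ℕ) : Nontrivial (Ext X Y n) ↔
    ∃ f : R.complex.X n ⟶ Y, R.complex.d (n + 1) n ≫ f = 0 ∧ ¬ IsCoboundary R.complex f := by
  rw [nontrivial_iff_exists_ne (0 : Ext X Y n)]
  constructor
  · rintro ⟨x, hx⟩
    obtain ⟨f, hf, rfl⟩ := R.extMk_surjective x (n + 1) rfl
    exact ⟨f, hf, fun h => hx ((extMk_eq_zero_iff_isCoboundary R f hf).mpr h)⟩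
  · rintro ⟨f, hf, h⟩
    exact ⟨R.extMk f (n + 1) rfl hf, fun h' => h ((extMk_eq_zero_iff_isCoboundary R f hf).mp h')⟩

omit R in
lemma eq_zero_of_biproduct {J : Type} [Fintype J] [HasFiniteBiproducts C] (N : J → C) {n : ℕ}
    (h : ∀ j, Subsingleton (Ext X (N j) n)) (β : Ext X (⨁ N) n) : β = 0 := by
  classical
  rw [← Ext.comp_mk₀_id β, show 𝟙 (⨁ N) = ∑ j, biproduct.π N j ≫ biproduct.ι N j from
    (biproduct.total (f := N)).symm]
  change (Ext.bilinearComp X _ _ n 0 n (add_zero n) β) (Ext.addEquiv₀.symm _) = 0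
  rw [map_sum, map_sum]
  refine Finset.sum_eq_zero fun j _ => ?_
  change β.comp (Ext.mk₀ (biproduct.π N j ≫ biproduct.ι N j)) (add_zero n) = 0
  have := h j
  rw [← Ext.mk₀_comp_mk₀, ← Ext.comp_assoc_of_second_deg_zero,
    Subsingleton.elim (β.comp (Ext.mk₀ (biproduct.π N j)) (add_zero n)) 0, Ext.zero_comp]

/-- If `Ext^{n+1}(X, -)` vanishes and a cocycle which is not a coboundary factors through a finite
sum, then `Ext^n(X, -)` is nonzero on some summand. -/
theorem exists_nontrivial_ext {n : ℕ} (hn : ∀ M : C, Subsingleton (Ext X M (n + 1)))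
    {M : C} (f : R.complex.X n ⟶ M) (hf : R.complex.d (n + 1) n ≫ f = 0)
    (hf' : ¬ IsCoboundary R.complex f) {J : Type} [Finite J] (N : J → C)
    (p : ∀ j, R.complex.X n ⟶ N j) (q : ∀ j, N j ⟶ M)
    (h : ∀ [Fintype J], f = ∑ j, p j ≫ q j) : ∃ j, Nontrivial (Ext X (N j) n) := by
  classical
  have := Fintype.ofFinite J
  have := Abelian.hasFiniteBiproducts (C := C)
  let P : R.complex.X n ⟶ ⨁ N := biproduct.lift p
  let Q : ⨁ N ⟶ M := biproduct.desc q
  have hPQ : P ≫ Q = f := biproduct.lift_desc.trans h.symm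
  -- `P` alone need not be a cocycle, but after passing to the image of `Q`, which embeds in `M`,
  -- the cocycle condition for `f` suffices.
  have hP : R.complex.d (n + 1) n ≫ P ≫ factorThruImage Q = 0 := by
    rw [← cancel_mono (Limits.image.ι Q), Category.assoc, Category.assoc, Limits.image.fac,
      hPQ, hf, zero_comp]
  let α : Ext X (image Q) n := R.extMk (P ≫ factorThruImage Q) (n + 1) rfl hP
  have hα : α ≠ 0 := by
    intro h0
    have h1 := R.extMk_comp_mk₀ (P ≫ factorThruImage Q) (n + 1) rfl hP (Limits.image.ι Q)
    rw [show R.extMk (P ≫ factorThruImage Q) (n + 1) rfl hP = 0 from h0, Ext.zero_comp] at h1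
    refine hf' ((extMk_eq_zero_iff_isCoboundary R f hf).mp ?_)
    rw [h1]
    congr 1
    rw [Category.assoc, Limits.image.fac, hPQ]
  have hS : (ShortComplex.mk (kernel.ι (factorThruImage Q)) (factorThruImage Q)
      (kernel.condition _)).ShortExact :=
    { exact := ShortComplex.exact_kernel _
      mono_f := inferInstanceAs (Mono (kernel.ι (factorThruImage Q)))
      epi_g := inferInstanceAs (Epi (factorThruImage Q)) }
  have := hn (kernel (factorThruImage Q))
  -- The obstruction to lifting lies in degree `n + 1` of the kernel, where `Ext` vanishes.
  obtain ⟨β, hβ⟩ := Ext.covariant_sequence_exact₃ X hS α rfl (Subsingleton.elim _ _)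
  by_contra! hall
  refine hα ?_
  have hβ0 : β = 0 := eq_zero_of_biproduct N hall β
  rw [← hβ, hβ0, Ext.zero_comp]

end Ext

lemma nontrivial_homology_linearYonedaObj_iff [Linear ℤ C] (K : ChainComplex C ℕ) (M : C) (n : ℕ) :
    Nontrivial ((K.linearYonedaObj ℤ M).homology n) ↔
      ∃ f : K.X n ⟶ M, K.d (n + 1) n ≫ f = 0 ∧ ¬ IsCoboundary K f := by
  have h1 : Subsingleton ((K.linearYonedaObj ℤ M).homology n) ↔
      ((K.linearYonedaObj ℤ M).sc n).Exact := by
    rw [← ModuleCat.isZero_iff_subsingleton, ShortComplex.exact_iff_isZero_homology]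
    rfl
  rw [← not_subsingleton_iff_nontrivial, h1, ShortComplex.moduleCat_exact_iff]
  have hnext : (ComplexShape.up ℕ).next n = n + 1 := by simp
  have hd : ∀ (i j : ℕ) (x : K.X i ⟶ M), (K.linearYonedaObj ℤ M).d i j x = K.d j i ≫ x :=
    fun i j x => rfl
  push Not
  constructor
  · rintro ⟨f, hf, h⟩
    refine ⟨f, ?_, ?_⟩
    · have : (K.linearYonedaObj ℤ M).d n ((ComplexShape.up ℕ).next n) f = 0 := hf
      rw [hnext] at this
      exact this
    · rintro ⟨j, g, rfl⟩
      by_cases hj : j + 1 = n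
      · subst hj
        have key : ∀ i, (ComplexShape.up ℕ).prev (j + 1) = i → ∀ g' : K.X i ⟶ M,
            K.d (j + 1) i ≫ g' ≠ K.d (j + 1) j ≫ g := by
          rintro _ rfl g'
          exact h g'
        exact key j (by simp) g rfl
      · refine h 0 ((map_zero _).trans ?_)
        rw [K.shape n j hj, zero_comp]
        rfl
  · rintro ⟨f, hf, h⟩
    refine ⟨f, ?_, ?_⟩
    · change (K.linearYonedaObj ℤ M).d n ((ComplexShape.up ℕ).next n) f = 0
      rw [hnext]
      exact hf
    · exact fun g hg => h ⟨_, g, hg⟩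

end CocycleExt

/-! ### Cohomological dimension of a cocompact classifying space -/

namespace IsClassifyingSpace

open Abelian IsGCWComplex OrbitModule CocycleExt Topology Topology.RelCWComplex

variable {G : Type u} [Group G] {F : Set (Subgroup G)} {X : Type u} [TopologicalSpace X]
  [T2Space X] [CWComplex (Set.univ : Set X)] [MulAction G X] [ContinuousConstSMul G X]

/-- Beyond the largest cell dimension the skeleton is all of `X`, so its fixed sets are
contractible; this supplies the starting point of the descent. -/
lemma exists_resolution (hX : IsClassifyingSpace F X) (hc : IsCocompactAction G X) :
    (∃ R : ProjectiveResolution (orbitConst F),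
      R.complex = cellularComplex F hX.isGCWComplex) ∧
    ∃ N : ℕ, ∀ n ≥ N, IsEmpty (CellOrbit G X n) := by
  obtain ⟨N, hN⟩ := exists_skeletonLT_eq_univ hX.isGCWComplex hc
  refine ⟨⟨SkeletonPair.resolution F hX.isGCWComplex
    (fun p q hq => isZero_relHomology hX.isGCWComplex hX.stabilizer_mem hq) (N := N) ?_
    (fun n => (isFreeOn_cellularModule hX.isGCWComplex hX.stabilizer_mem n).projective), rfl⟩,
    N, fun n hn => (hN n hn).1⟩
  intro n hn A
  rw [fixedSkeleton, (hN n hn).2, Set.inter_univ]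
  exact hX.contractible _ A.mem

lemma nontrivial_groupBredonCohomology_iff (hX : IsClassifyingSpace F X)
    (hc : IsCocompactAction G X) (n : ℕ) (M : OrbitModule F) :
    Nontrivial (GroupBredonCohomology F n M) ↔
      ∃ f : (cellularComplex F hX.isGCWComplex).X n ⟶ M,
        (cellularComplex F hX.isGCWComplex).d (n + 1) n ≫ f = 0 ∧ ¬ IsCoboundary _ f := by
  let : HasExt.{u + 1} (OrbitModule F) := HasExt.standard _
  obtain ⟨⟨R, hR⟩, -⟩ := exists_resolution hX hc
  rw [← hR]
  exact nontrivial_ext_iff R M n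

lemma nontrivial_bredonCohomology_iff (hX : IsClassifyingSpace F X)
    (hc : IsCocompactAction G X) (n : ℕ) (M : OrbitModule F) :
    Nontrivial (BredonCohomology F hX.isGCWComplex n M) ↔
      Nontrivial (GroupBredonCohomology F n M) :=
  (nontrivial_homology_linearYonedaObj_iff _ M n).trans
    (nontrivial_groupBredonCohomology_iff hX hc n M).symm

lemma exists_subsingleton_groupBredonCohomology (hX : IsClassifyingSpace F X)
    (hc : IsCocompactAction G X) :
    ∃ N : ℕ, ∀ n ≥ N, ∀ M, ¬ Nontrivial (GroupBredonCohomology F n M) := by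
  obtain ⟨-, N, hN⟩ := exists_resolution hX hc
  refine ⟨N, fun n hn M h => ?_⟩
  obtain ⟨f, -, hf⟩ := (nontrivial_groupBredonCohomology_iff hX hc n M).mp h
  have := hN n hn
  refine hf ⟨0, 0, ?_⟩
  rw [comp_zero]
  exact (isFreeOn_cellularModule hX.isGCWComplex hX.stabilizer_mem n).hom_ext
    fun i => (IsEmpty.false i).elim

/-- In the top dimension, a non-zero class is detected on the free modules through which a
representing cocycle factors. -/
lemma exists_nontrivial_of_factorization (hX : IsClassifyingSpace F X)
    (hc : IsCocompactAction G X) {n : ℕ}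
    (hn : ∀ M, ¬ Nontrivial (GroupBredonCohomology F (n + 1) M)) {M : OrbitModule F}
    (f : (cellularComplex F hX.isGCWComplex).X n ⟶ M)
    (hf : (cellularComplex F hX.isGCWComplex).d (n + 1) n ≫ f = 0) (hf' : ¬ IsCoboundary _ f)
    {J : Type*} [Finite J] (N : J → OrbitModule F)
    (p : ∀ j, (cellularComplex F hX.isGCWComplex).X n ⟶ N j) (q : ∀ j, N j ⟶ M)
    (h : ∀ [Fintype J], f = ∑ j, p j ≫ q j) :
    ∃ j, Nontrivial (GroupBredonCohomology F n (N j)) := by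
  let : HasExt.{u + 1} (OrbitModule F) := HasExt.standard _
  obtain ⟨⟨R, hR⟩, -⟩ := exists_resolution hX hc
  revert f hf hf' p
  rw [← hR]
  intro f hf hf' p h
  obtain ⟨m, ⟨e⟩⟩ := Finite.exists_equiv_fin J
  obtain ⟨j, hj⟩ := exists_nontrivial_ext R
    (fun M => not_nontrivial_iff_subsingleton.mp (hn M)) f hf hf'
    (fun j => N (e.symm j)) (fun j => p (e.symm j)) (fun j => q (e.symm j)) (by
      intro _
      have := Fintype.ofEquiv _ e.symm
      rw [Equiv.sum_comp e.symm fun j => p j ≫ q j]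
      exact h)
  exact ⟨_, hj⟩

lemma sum_app {M N : OrbitModule F} {J : Type*} [Fintype J] (φ : J → (M ⟶ N))
    (A : (OrbitCat F)ᵒᵖ) (x : M.obj A) : (∑ j, φ j).app A x = ∑ j, (φ j).app A x := by
  let e : (M ⟶ N) →+ N.obj A :=
    { toFun := fun ψ => ψ.app A x
      map_zero' := rfl
      map_add' := fun _ _ => rfl }
  exact map_sum e φ Finset.univ

lemma exists_isCellStabilizer_nontrivial (hX : IsClassifyingSpace F X)
    (hc : IsCocompactAction G X) {n : ℕ}
    (hn : ∀ M, ¬ Nontrivial (GroupBredonCohomology F (n + 1) M)) {M : OrbitModule F}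
    (hM : Nontrivial (GroupBredonCohomology F n M)) :
    ∃ H : OrbitCat F, IsCellStabilizer X H.subgroup ∧
      Nontrivial (GroupBredonCohomology F n (orbitFree H)) := by
  classical
  obtain ⟨f, hf, hf'⟩ := (nontrivial_groupBredonCohomology_iff hX hc n M).mp hM
  have hfree := isFreeOn_cellularModule hX.isGCWComplex hX.stabilizer_mem n
  have hfin := finite_cellOrbit hX.isGCWComplex hc
  have : Finite (CellOrbit G X n) :=
    Finite.of_injective (fun i => (⟨n, i⟩ : Σ n, CellOrbit G X n)) sigma_mk_injective
  -- The `p j` are the coordinate projections of the free module `C_n`, and `q j` sends the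
  -- generator to the value of `f`; the sum of the composites agrees with `f` on generators.
  choose p hp using fun j : CellOrbit G X n =>
    hfree.exists_hom (orbitFree (repStabilizer hX.stabilizer_mem j)) fun i =>
      if h : i = j then h ▸ orbitFreeGen _ else 0
  choose q hq using fun j : CellOrbit G X n =>
    (isFreeOn_orbitFree (repStabilizer hX.stabilizer_mem j)).exists_hom M fun _ =>
      f.app _ (SkeletonPair.relHomologyClass F hX.isGCWComplex n n _
        (cellCycle hX.isGCWComplex hX.stabilizer_mem j))
  obtain ⟨j, hj⟩ := exists_nontrivial_of_factorization hX hc hn f hf hf' _ p q (by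
    intro _
    refine hfree.hom_ext fun i => ?_
    erw [sum_app]
    rw [Finset.sum_eq_single i]
    · change _ = (q i).app _ ((p i).app _ _)
      rw [hp, dif_pos rfl]
      exact (hq i ()).symm
    · intro j _ hj
      change (q j).app _ ((p j).app _ _) = 0
      rw [hp, dif_neg hj.symm, map_zero]
    · simp)
  exact ⟨_, ⟨n, rep j, rfl⟩, hj⟩

/-- A morphism from the orbit of a cell to `G ⧸ L` factors through a translate of the cell whose
stabiliser is contained in `L`. -/
lemma exists_factor_repStabilizer (hX : IsClassifyingSpace F X) {n : ℕ} (i : CellOrbit G X n)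
    {L : OrbitCat F} (g : repStabilizer hX.stabilizer_mem i ⟶ L) :
    ∃ H : OrbitCat F, (IsCellStabilizer X H.subgroup ∧ H.subgroup ≤ L.subgroup) ∧
      ∃ (a : repStabilizer hX.stabilizer_mem i ⟶ H) (b : H ⟶ L), a ≫ b = g := by
  obtain ⟨γ, hγ⟩ := QuotientGroup.mk_surjective
    (g.toFun ((1 : G) : G ⧸ (repStabilizer hX.stabilizer_mem i).subgroup))
  obtain ⟨e, he⟩ := hX.isGCWComplex.smul_openCell γ⁻¹ n (rep i)
  have hs : IsCellStabilizer X (MulAction.stabilizer G (openCell n e)) := ⟨n, e, rfl⟩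
  have hmem : ∀ x, x ∈ MulAction.stabilizer G (openCell n e) ↔
      γ * x * γ⁻¹ ∈ MulAction.stabilizer G (openCell n (rep i)) := by
    intro x
    rw [MulAction.mem_stabilizer_iff, MulAction.mem_stabilizer_iff, ← he, mul_smul, mul_smul,
      smul_eq_iff_eq_inv_smul γ]
  let H : OrbitCat F := ⟨_, hX.stabilizer_mem _ hs⟩
  have hle : H.subgroup ≤ L.subgroup := by
    intro x hx
    have := OrbitCat.conj_mem g hγ.symm ((hmem x).mp hx)
    simpa [mul_assoc] using this
  have ha : ∀ x ∈ (repStabilizer hX.stabilizer_mem i).subgroup, γ⁻¹ * x * γ ∈ H.subgroup := by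
    intro x hx
    refine (hmem _).mpr ?_
    rw [show γ * (γ⁻¹ * x * γ) * γ⁻¹ = x by group]
    exact hx
  have hb : ∀ x ∈ H.subgroup, (1 : G)⁻¹ * x * 1 ∈ L.subgroup := by
    intro x hx
    simpa using hle hx
  refine ⟨H, ⟨hs, hle⟩, OrbitCat.homMk γ ha, OrbitCat.homMk 1 hb, OrbitCat.hom_ext ?_⟩
  refine (congrArg (OrbitCat.homMk 1 hb).toFun (OrbitCat.homMk_one γ ha)).trans ?_
  rw [← hγ]
  exact congrArg (QuotientGroup.mk (s := L.subgroup)) (mul_one γ)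

lemma exists_isCellStabilizer_le_nontrivial (hX : IsClassifyingSpace F X)
    (hc : IsCocompactAction G X) {n : ℕ}
    (hn : ∀ M, ¬ Nontrivial (GroupBredonCohomology F (n + 1) M)) {L : OrbitCat F}
    (hL : Nontrivial (GroupBredonCohomology F n (orbitFree L))) :
    ∃ H : OrbitCat F, IsCellStabilizer X H.subgroup ∧ H.subgroup ≤ L.subgroup ∧
      Nontrivial (GroupBredonCohomology F n (orbitFree H)) := by
  classical
  obtain ⟨f, hf, hf'⟩ := (nontrivial_groupBredonCohomology_iff hX hc n _).mp hL
  have hfree := isFreeOn_cellularModule hX.isGCWComplex hX.stabilizer_mem n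
  have hfin := finite_cellOrbit hX.isGCWComplex hc
  have : Finite (CellOrbit G X n) :=
    Finite.of_injective (fun i => (⟨n, i⟩ : Σ n, CellOrbit G X n)) sigma_mk_injective
  -- The value of `f` on a generator is a finite combination of morphisms to `G/L`. The
  -- factorisation is indexed by an orbit together with a morphism in this support, a finite set,
  -- and the coefficient is placed in `q`.
  let c : ∀ i : CellOrbit G X n, (repStabilizer hX.stabilizer_mem i ⟶ L) →₀ ℤ := fun i =>
    f.app _ (SkeletonPair.relHomologyClass F hX.isGCWComplex n n _
      (cellCycle hX.isGCWComplex hX.stabilizer_mem i))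
  choose H hH a b hab using
    fun j : Σ i : CellOrbit G X n, (c i).support => exists_factor_repStabilizer hX j.1 j.2.1
  choose p hp using fun j : Σ i : CellOrbit G X n, (c i).support =>
    hfree.exists_hom (orbitFree (H j)) fun i =>
      if h : i = j.1 then h ▸ (Finsupp.single (a j) 1 : (_ ⟶ H j) →₀ ℤ) else 0
  choose q hq using fun j : Σ i : CellOrbit G X n, (c i).support =>
    (isFreeOn_orbitFree (H j)).exists_hom (orbitFree L) fun _ =>
      (Finsupp.single (b j) (c j.1 j.2.1) : (H j ⟶ L) →₀ ℤ)
  have hqa : ∀ j, (q j).app (Opposite.op (repStabilizer hX.stabilizer_mem j.1))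
      (Finsupp.single (a j) 1 : (_ ⟶ H j) →₀ ℤ) =
        (Finsupp.single j.2.1 (c j.1 j.2.1) : (_ ⟶ L) →₀ ℤ) := by
    intro j
    have h1 := NatTrans.naturality_apply (q j) (a j).op (orbitFreeGen (H j))
    rw [map_orbitFreeGen, hq j ()] at h1
    refine h1.trans ?_
    refine (Finsupp.mapDomain_single (f := fun r => a j ≫ r)).trans ?_
    rw [hab]
  obtain ⟨j, hj⟩ := exists_nontrivial_of_factorization hX hc hn f hf hf' _ p q (by
    intro _
    have := Fintype.ofFinite (CellOrbit G X n)
    refine hfree.hom_ext fun i => ?_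
    erw [sum_app]
    rw [show (Finset.univ : Finset (Σ i : CellOrbit G X n, (c i).support)) =
      Finset.univ.sigma fun _ => Finset.univ by ext; simp, Finset.sum_sigma,
      Finset.sum_eq_single i]
    · refine Eq.trans (b := ∑ g : (c i).support, (Finsupp.single g.1 (c i g.1) : (_ ⟶ L) →₀ ℤ))
        ?_ (Finset.sum_congr rfl fun g _ => ?_)
      · rw [Finset.sum_coe_sort (c i).support fun g => Finsupp.single g (c i g)]
        exact (Finsupp.sum_single (c i)).symm
      · have e := hp ⟨i, g⟩ i
        rw [dif_pos rfl] at e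
        exact ((congrArg ((q ⟨i, g⟩).app _) e).trans (hqa ⟨i, g⟩)).symm
    · intro j _ hj
      refine Finset.sum_eq_zero fun g _ => ?_
      change (q ⟨j, g⟩).app _ ((p ⟨j, g⟩).app _ _) = 0
      rw [hp, dif_neg hj.symm, map_zero]
    · simp)
  exact ⟨H j, (hH j).1, (hH j).2, hj⟩

end IsClassifyingSpace

/-! ### The dimension is attained, and the main theorem -/

lemma nontrivial_groupBredonCohomology_zero {G : Type u} [Group G] {F : Set (Subgroup G)}
    (hF : F.Nonempty) : Nontrivial (GroupBredonCohomology F 0 (orbitConst F)) := by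
  let : HasExt.{u + 1} (OrbitModule F) := HasExt.standard _
  obtain ⟨H, hH⟩ := hF
  have : Nontrivial (orbitConst F ⟶ orbitConst F) := by
    refine ⟨𝟙 _, 0, fun h => ?_⟩
    have h1 := congrArg (fun φ : orbitConst F ⟶ orbitConst F =>
      φ.app (Opposite.op ⟨H, hH⟩) (ULift.up (1 : ℤ))) h
    exact one_ne_zero (congrArg ULift.down h1 : (1 : ℤ) = 0)
  exact (Abelian.Ext.addEquiv₀ (X := orbitConst F) (Y := orbitConst F)).toEquiv.nontrivial

-- Degree 0 is nonzero, since the identity of the constant module is, and high degrees vanish; so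
-- the supremum is a maximum over a nonempty finite set.
open Classical in
theorem exists_bredonCohomologicalDimension_eq {G : Type u} [Group G] {F : Set (Subgroup G)}
    (hF : F.Nonempty)
    (h : ∃ N : ℕ, ∀ n ≥ N, ∀ M, ¬ Nontrivial (GroupBredonCohomology F n M)) :
    ∃ n : ℕ, bredonCohomologicalDimension F = n ∧
      (∃ M, Nontrivial (GroupBredonCohomology F n M)) ∧
      ∀ k M, Nontrivial (GroupBredonCohomology F k M) → k ≤ n := by
  obtain ⟨N, hN⟩ := h
  have hle : ∀ k, (∃ M, Nontrivial (GroupBredonCohomology F k M)) → k ≤ N := by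
    rintro k ⟨M, hM⟩
    by_contra! hk
    exact hN k hk.le M hM
  have hspec := Nat.findGreatest_spec
    (P := fun n => ∃ M, Nontrivial (GroupBredonCohomology F n M)) (Nat.zero_le N)
    ⟨_, nontrivial_groupBredonCohomology_zero hF⟩
  have hmax : ∀ k M, Nontrivial (GroupBredonCohomology F k M) → k ≤ Nat.findGreatest
      (fun n => ∃ M, Nontrivial (GroupBredonCohomology F n M)) N :=
    fun k M hM => Nat.le_findGreatest (hle k ⟨M, hM⟩) ⟨M, hM⟩
  refine ⟨_, le_antisymm (iSup₂_le ?_) (le_iSup₂_of_le _ hspec le_rfl), hspec, hmax⟩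
  rintro k ⟨M, hM⟩
  exact_mod_cast hmax k M hM

theorem theorem1p3 {G : Type u} [Group G] (F : Set (Subgroup G)) (hF : IsSubgroupFamily F)
    (X : Type u) [TopologicalSpace X] [T2Space X] [Topology.CWComplex (Set.univ : Set X)]
    [MulAction G X] [ContinuousConstSMul G X]
    (hX : IsClassifyingSpace F X) (hc : IsCocompactAction G X) :
    (∃ n : ℕ, bredonCohomologicalDimension F = n ∧
      IsGreatest {k : ℕ | ∃ H : OrbitCat F, IsCellStabilizer X H.subgroup ∧
        Nontrivial (BredonCohomology F hX.isGCWComplex k (orbitFree H))} n) ∧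
    ∀ n : ℕ, bredonCohomologicalDimension F = n →
      ∀ L : OrbitCat F, Nontrivial (GroupBredonCohomology F n (orbitFree L)) →
        ∃ H : OrbitCat F, IsCellStabilizer X H.subgroup ∧ H.subgroup ≤ L.subgroup ∧
          Nontrivial (GroupBredonCohomology F n (orbitFree H)) := by
  obtain ⟨n, hn, ⟨M, hM⟩, hmax⟩ := exists_bredonCohomologicalDimension_eq hF.nonempty
    (hX.exists_subsingleton_groupBredonCohomology hc)
  have hsucc : ∀ M, ¬ Nontrivial (GroupBredonCohomology F (n + 1) M) :=
    fun M h => Nat.not_succ_le_self n (hmax _ M h)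
  refine ⟨⟨n, hn, ?_, ?_⟩, ?_⟩
  · obtain ⟨H, hH, h⟩ := hX.exists_isCellStabilizer_nontrivial hc hsucc hM
    exact ⟨H, hH, (hX.nontrivial_bredonCohomology_iff hc _ _).mpr h⟩
  · rintro k ⟨H, -, h⟩
    exact hmax k _ ((hX.nontrivial_bredonCohomology_iff hc _ _).mp h)
  · intro m hm L hL
    obtain rfl : m = n := by
      rw [hn] at hm
      exact_mod_cast hm.symm
    exact hX.exists_isCellStabilizer_le_nontrivial hc hsucc hL
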